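/- Let $S$ be a scheme. Call an $S$-scheme PFF if it is proper, flat and of finite presentation over $S$. A closed subscheme is an effective Cartier divisor if its ideal sheaf is locally generated by one nonzerodivisor. For a closed subscheme $D\subset X$, the blowup of $X$ along $D$ is the terminal object $b\colon \mathrm{Bl}_DX\to X$ among the morphisms $T\to X$ for which $D\times_XT\subset T$ is an effective Cartier divisor; its exceptional divisor is $b^{-1}(D)=D\times_X\mathrm{Bl}_DX$. Write $I_D\subset\mathcal O_X$ for the ideal sheaf of $D$. (1) Let $\widetilde X,\widetilde D,D$ be PFF over $S$, let $i\colon\widetilde D\hookrightarrow\widetilde X$ be a closed immersion over $S$ whose image is an effective Cartier divisor, and let $q\colon\widetilde D\to D$ be a finite flat morphism over $S$. Assume that for every $y\in D$ the set $i(q^{-1}(y))$ is contained in an affine open subset of $\widetilde X$. Then the pushout $X=\widetilde X\sqcup_{\widetilde D}D$ exists in the category of schemes; $D\to X$ is a closed immersion; $X$ is PFF over $S$; and $\mathcal O_X/I_D^m$ is flat over $S$ for every $m\ge 0$. Furthermore the blowup $\overline X$ of $X$ along $D$ exists, and, if $\overline D$ is its exceptional divisor, there is a unique isomorphism of pairs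 $(\widetilde X,\widetilde D)\simeq(\overline X,\overline D)$ over $(X,D)$, that is, a unique pair of isomorphisms $\widetilde X\simeq\overline X$ and $\widetilde D\simeq\overline D$ compatible with the inclusions $\widetilde D\subset\widetilde X$, $\overline D\subset\overline X$ and with the morphisms to $X$ and to $D$. (2) Conversely, let $D\hookrightarrow X$ be a closed immersion of PFF schemes over $S$ such that the ideal sheaf $I_D^n$ is flat over $S$ for every $n\ge 1$. Let $b\colon\widetilde X\to X$ be the blowup of $X$ along $D$ and let $\widetilde D=b^{-1}(D)$ be its exceptional divisor. Suppose that $\widetilde D\to D$ is finite and flat, and that the canonical map $I_D\to b_*I_{\widetilde D}$ is an isomorphism. Then $b$ is finite, and an isomorphism over $X\setminus D$; the pushout $\widetilde X\sqcup_{\widetilde D}D$ exists in the category of schemes; and there is a unique isomorphism $\widetilde X\sqcup_{\widetilde D}D\to X$ compatible with the morphisms from $\widetilde X$ and from $D$ to $X$. -/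

import Mathlib

open CategoryTheory CategoryTheory.Limits AlgebraicGeometry

universe u

/-- A morphism of schemes that is proper, flat and of finite presentation. (A proper morphism is
quasi-compact and separated, so that locally of finite presentation is the same as of finite
presentation here.) -/
structure IsProperFlatFP {X S : Scheme.{u}} (p : X ⟶ S) : Prop where
  proper : IsProper p
  flat : Flat p
  finitePresentation : LocallyOfFinitePresentation p

/-- The closed subscheme of `X` cut out by the quasi-coherent ideal sheaf `I` is an effective
Cartier divisor: every point has an affine open neighbourhood on which `I` is generated by one
nonzerodivisor. -/
def IsEffectiveCartier {X : Scheme.{u}} (I : X.IdealSheafData) : Prop :=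
  ∀ x : X, ∃ U : X.affineOpens, x ∈ U.1 ∧
    ∃ f ∈ nonZeroDivisors Γ(X, U.1), I.ideal U = Ideal.span {f}

/-- `b : B ⟶ X` is the blowup of `X` along (the closed subscheme cut out by) `I`: it is the
universal, that is terminal, morphism to `X` for which the scheme-theoretic preimage of the centre
is an effective Cartier divisor. -/
structure IsBlowup {B X : Scheme.{u}} (b : B ⟶ X) (I : X.IdealSheafData) : Prop where
  isEffectiveCartier : IsEffectiveCartier (I.comap b)
  existsUnique_lift : ∀ (T : Scheme.{u}) (f : T ⟶ X), IsEffectiveCartier (I.comap f) →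
    ∃! g : T ⟶ B, g ≫ b = f

/-- The quasi-coherent ideal sheaf `I` on `X` is flat over `S` as a module: for affine opens
`V ⊆ S` and `U ⊆ p⁻¹ V`, the ideal `I(U)` is a flat `𝒪_S(V)`-module. -/
def IsFlatIdealOver {X S : Scheme.{u}} (p : X ⟶ S) (I : X.IdealSheafData) : Prop :=
  ∀ (V : S.affineOpens) (U : X.affineOpens) (e : U.1 ≤ p ⁻¹ᵁ V.1),
    letI : Algebra Γ(S, V.1) Γ(X, U.1) := (p.appLE V.1 U.1 e).hom.toAlgebra
    Module.Flat Γ(S, V.1) (I.ideal U)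

/-- For closed immersions `j : D ⟶ X`, `i : D' ⟶ X'` and `b : X' ⟶ X` such that `b` maps `D'` into
`D`, the canonical map `I_D ⟶ b_* I_{D'}` is an isomorphism of sheaves: on every open `U ⊆ X` the map
`𝒪_X(U) ⟶ 𝒪_{X'}(b⁻¹ U)` restricts to a bijection from the sections of `I_D` over `U` onto the
sections of `I_{D'}` over `b⁻¹ U`. -/
def IdealsAgree {X X' D D' : Scheme.{u}} (b : X' ⟶ X) (j : D ⟶ X) (i : D' ⟶ X') : Prop :=
  ∀ U : X.Opens, Set.BijOn (b.app U).hom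
    (RingHom.ker (j.app U).hom) (RingHom.ker (i.app (b ⁻¹ᵁ U)).hom)

/-! Both directions rest on one local notion, the pinching square (`IsPinching`): a commutative
square of schemes with corners `D'`, `X'`, `D`, `X` which over affine opens of `X` is dual to a
fiber square of rings `A = A' ×_{B'} B`, with `A' → B'` surjective and `B → B'` integral. In such a
square `I = ker (A → B)` maps bijectively onto `ker (A' → B')`, so it is a common ideal of `A` and
`A'` (a conductor), and everything follows from this.

`A'` is integral over `A`, and the points of `X` are those of `X'` and `D` glued along `D'`. As `X'
→ X` and `D → X` are closed and `A` is a fiber product, compatible morphisms glue: the square is a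
pushout (`IsPinching.isPushout`). An element of `A'` acts on `I` by multiplication; if `I C = (t)`
with `t` a nonzerodivisor of an `A`-algebra `C`, that action becomes multiplication by a unique
element of `C`. So `A → C` extends uniquely to `A'` (`existsUnique_extension`), and `X' → X` is the
blowup of `D` (`IsPinching.isBlowup`). As a module, `A` is an extension of `B` by `ker (A' → B')`,
which gives flatness and finite presentation; `A/I^m` is treated in the same way, being the fiber
product of `A'/I^m` and `B` for `m ≥ 1`.

For (1) the square is built by gluing the rings of pairs attached to affine opens `U ⊆ X'`, `W ⊆ D`
with the same preimage in `D'`; the hypothesis on the fibers of `q` provides enough of them.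

For (2) the main point is that `b` is finite (`IsBlowup.isFinite`). Then `b` is affine, the
agreement of the ideals makes the square a pinching square, and this is a pushout. Let `K` be the
ideal of `D` on an affine chart. Homogeneous prime avoidance gives a form `f ∈ K^n`, `n > 0`,
vanishing nowhere on a given finite fiber of the exceptional divisor, hence nowhere on the
exceptional divisor after shrinking. Testing this on the algebras `A[K/x]` gives `K^(n+m) ⊆ f K^m +
K^(n+m+1)`, and Nakayama's lemma removes the last term near `D`. A power `g` of `f` then satisfies
`K^(2N) ⊆ g K^N` with `g ∈ K^N`, so the fractions `k / g^m` with `k ∈ K^(Nm)` form the finite module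
`g⁻¹ K^N`. This algebra has the universal property of the blowup. -/

/-- A commutative square of commutative rings `A ⟶ A' ⟶ B'`, `A ⟶ B ⟶ B'` that is cartesian. -/
structure IsFiberSquare {A A' B B' : Type*} [CommRing A] [CommRing A'] [CommRing B] [CommRing B']
    (φ : A →+* A') (ψ : A →+* B) (π : A' →+* B') (ρ : B →+* B') : Prop where
  comm : ∀ a, π (φ a) = ρ (ψ a)
  eq_zero : ∀ a, φ a = 0 → ψ a = 0 → a = 0
  exists_lift : ∀ a' b, π a' = ρ b → ∃ a, φ a = a' ∧ ψ a = b

/-! ### Fiber squares of rings and their conductor. -/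

namespace IsFiberSquare

section

variable {A A' B B' : Type*} [CommRing A] [CommRing A'] [CommRing B] [CommRing B']
    {φ : A →+* A'} {ψ : A →+* B} {π : A' →+* B'} {ρ : B →+* B'}

lemma ext (h : IsFiberSquare φ ψ π ρ) {a b : A} (h₁ : φ a = φ b) (h₂ : ψ a = ψ b) : a = b :=
  sub_eq_zero.mp (h.eq_zero _ (by simp [h₁]) (by simp [h₂]))

lemma exists_ringHom (h : IsFiberSquare φ ψ π ρ) {R : Type*} [CommRing R] (u : R →+* A')
    (v : R →+* B) (huv : π.comp u = ρ.comp v) : ∃ w : R →+* A, φ.comp w = u ∧ ψ.comp w = v := by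
  choose w hw₁ hw₂ using fun r ↦ h.exists_lift (u r) (v r) (RingHom.congr_fun huv r)
  exact ⟨{
    toFun := w
    map_one' := h.ext (by simp [hw₁]) (by simp [hw₂])
    map_mul' := fun x y ↦ h.ext (by simp [hw₁]) (by simp [hw₂])
    map_zero' := h.ext (by simp [hw₁]) (by simp [hw₂])
    map_add' := fun x y ↦ h.ext (by simp [hw₁]) (by simp [hw₂]) },
    RingHom.ext hw₁, RingHom.ext hw₂⟩

/-- A square with `ψ` surjective is cartesian as soon as the kernels correspond; this is the form in
which `IdealsAgree` enters. -/
lemma of_ker_bijOn (comm : ∀ a, π (φ a) = ρ (ψ a)) (hψ : Function.Surjective ψ)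
    (hk : Set.BijOn φ (RingHom.ker ψ) (RingHom.ker π)) : IsFiberSquare φ ψ π ρ where
  comm := comm
  eq_zero a h₁ h₂ := hk.injOn h₂ (zero_mem _) (by simp [h₁])
  exists_lift a' b hab := by
    obtain ⟨a, rfl⟩ := hψ b
    obtain ⟨k, hk₁, hk₂⟩ := hk.surjOn (show a' - φ a ∈ RingHom.ker π by
      simp [RingHom.mem_ker, hab, comm])
    exact ⟨a + k, by simp [hk₂], by simpa using hk₁⟩

lemma surjective (h : IsFiberSquare φ ψ π ρ) (hπ : Function.Surjective π) :
    Function.Surjective ψ := fun b ↦ by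
  obtain ⟨a', ha'⟩ := hπ (ρ b)
  obtain ⟨a, -, ha⟩ := h.exists_lift a' b ha'
  exact ⟨a, ha⟩

/-- The conductor property: `φ` maps `ker ψ` onto the ideal `ker π` of `A'`, so the image of `ker ψ`
absorbs multiplication by `A'`. -/
lemma exists_mul (h : IsFiberSquare φ ψ π ρ) {f : A} (hf : ψ f = 0) (a' : A') :
    ∃ a, φ a = a' * φ f ∧ ψ a = 0 :=
  h.exists_lift _ _ (by simp [h.comm, hf])

lemma exists_of_mem_ker (h : IsFiberSquare φ ψ π ρ) {x : A'} (hx : π x = 0) :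
    ∃ a, φ a = x ∧ ψ a = 0 :=
  h.exists_lift _ _ (by simp [hx])

lemma map_ker (h : IsFiberSquare φ ψ π ρ) : (RingHom.ker ψ).map φ = RingHom.ker π := by
  refine le_antisymm (Ideal.map_le_iff_le_comap.mpr fun a ha ↦ ?_) fun x hx ↦ ?_
  · simpa [RingHom.mem_ker, h.comm] using congr(ρ $ha)
  · obtain ⟨a, rfl, ha⟩ := h.exists_of_mem_ker hx
    exact Ideal.mem_map_of_mem _ ha

/-- A monic equation of `π x` over `B` lifts to a monic `P` over `A`. Then `P(x)` lies in `ker π`,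
hence is the image of some `a` in `A`, and `x` is a root of `P - a`. -/
lemma isIntegral (h : IsFiberSquare φ ψ π ρ) (hπ : Function.Surjective π) (hρ : ρ.IsIntegral) :
    φ.IsIntegral := by
  intro x
  cases subsingleton_or_nontrivial B with
  | inl _ =>
    have : Subsingleton B' := subsingleton_of_zero_eq_one
      (by rw [← ρ.map_one, Subsingleton.elim (1 : B) 0, ρ.map_zero])
    obtain ⟨a, rfl, -⟩ := h.exists_lift x 0 (Subsingleton.elim _ _)
    exact φ.isIntegralElem_map
  | inr _ =>
    obtain ⟨p, hp, hpx⟩ := hρ (π x)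
    -- The factor `X` makes the degree positive, so that subtracting a constant keeps the polynomial
    -- monic.
    obtain ⟨P, hP, hdeg, hPm⟩ := Polynomial.lifts_and_natDegree_eq_and_monic
      ((Polynomial.lifts_iff_coeff_lifts (p * Polynomial.X)).mpr
        fun n ↦ RingHom.mem_range.mpr (h.surjective hπ _)) (hp.mul Polynomial.monic_X)
    have hz : π (P.eval₂ φ x) = 0 := by
      rw [Polynomial.hom_eval₂, show π.comp φ = ρ.comp ψ from RingHom.ext h.comm,
        ← Polynomial.eval₂_map, hP, Polynomial.eval₂_mul, hpx, zero_mul]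
    obtain ⟨a, ha, -⟩ := h.exists_of_mem_ker hz
    refine ⟨P - Polynomial.C a, hPm.sub_of_left ?_, by simp [ha]⟩
    refine Polynomial.degree_C_le.trans_lt (Polynomial.natDegree_pos_iff_degree_pos.mp ?_)
    rw [hdeg, hp.natDegree_mul Polynomial.monic_X, Polynomial.natDegree_X]
    omega

/-- Away from the conductor, points of `Spec A'` are determined by their images in `Spec A`. -/
lemma prime_ext (h : IsFiberSquare φ ψ π ρ) (p q : PrimeSpectrum A')
    (hpq : p.comap φ = q.comap φ) (hp : ¬ RingHom.ker ψ ≤ (p.comap φ).asIdeal) : p = q := by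
  obtain ⟨f, hf, hfp⟩ := SetLike.not_le_iff_exists.mp hp
  have key (p q : PrimeSpectrum A') (hpq : p.comap φ = q.comap φ)
      (hfp : f ∉ (p.comap φ).asIdeal) : p.asIdeal ≤ q.asIdeal := fun x hx ↦ by
    obtain ⟨a, ha, -⟩ := h.exists_mul hf x
    have : a ∈ (p.comap φ).asIdeal := by
      simpa [ha] using p.asIdeal.mul_mem_right _ hx
    rw [hpq] at this hfp
    have h2 : x * φ f ∈ q.asIdeal := by simpa [ha] using this
    exact (q.2.mem_or_mem h2).resolve_right (by simpa using hfp)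
  exact PrimeSpectrum.ext (le_antisymm (key p q hpq hfp) (key q p hpq.symm (hpq ▸ hfp)))

/-- An `f ∈ ker ψ` outside `p` kills `ker φ`, because the products vanish in both `A'` and `B`.
Hence `ker φ ≤ p` and lying over applies. -/
lemma exists_prime_of_ker_not_le (h : IsFiberSquare φ ψ π ρ) (hφ : φ.IsIntegral)
    (p : PrimeSpectrum A) (hp : ¬ RingHom.ker ψ ≤ p.asIdeal) :
    ∃ q : PrimeSpectrum A', q.comap φ = p := by
  obtain ⟨f, hf, hfp⟩ := SetLike.not_le_iff_exists.mp hp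
  have hle : RingHom.ker φ ≤ p.asIdeal := fun a ha ↦ by
    have : a * f = 0 := h.eq_zero _ (by simp [RingHom.mem_ker.mp ha])
      (by simp [RingHom.mem_ker.mp hf])
    exact (p.2.mem_or_mem (this ▸ p.asIdeal.zero_mem)).resolve_right hfp
  algebraize [φ]
  have : Algebra.IsIntegral A A' := ⟨hφ⟩
  have := p.2
  obtain ⟨Q, -, hQ, hQp⟩ := Ideal.exists_ideal_over_prime_of_isIntegral p.asIdeal (⊥ : Ideal A') hle
  exact ⟨⟨Q, hQ⟩, PrimeSpectrum.ext hQp⟩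

lemma exists_prime_of_ker_le (h : IsFiberSquare φ ψ π ρ) (hπ : Function.Surjective π)
    (p : PrimeSpectrum A) (hp : RingHom.ker ψ ≤ p.asIdeal) :
    ∃ q : PrimeSpectrum B, q.comap ψ = p := by
  have : p ∈ Set.range (PrimeSpectrum.comap ψ) := by
    rw [range_comap_of_surjective _ _ (h.surjective hπ)]
    exact hp
  exact this

/-- As `ker π` is generated by the image of `ker ψ`, the prime `p` contains it and so comes from
`B'`. Its image in `Spec B` is `q` because `Spec ψ` is injective. -/
lemma exists_prime_of_comap_eq (h : IsFiberSquare φ ψ π ρ) (hπ : Function.Surjective π)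
    (p : PrimeSpectrum A') (q : PrimeSpectrum B) (hpq : p.comap φ = q.comap ψ) :
    ∃ r : PrimeSpectrum B', r.comap π = p ∧ r.comap ρ = q := by
  have : p ∈ Set.range (PrimeSpectrum.comap π) := by
    rw [range_comap_of_surjective _ _ hπ]
    change RingHom.ker π ≤ p.asIdeal
    rw [← h.map_ker, Ideal.map_le_iff_le_comap]
    change _ ≤ (p.comap φ).asIdeal
    rw [hpq]
    exact fun a ha ↦ by simp [RingHom.mem_ker.mp ha]
  obtain ⟨r, rfl⟩ := this
  refine ⟨r, rfl, PrimeSpectrum.comap_injective_of_surjective ψ (h.surjective hπ) ?_⟩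
  rw [← hpq, ← PrimeSpectrum.comap_comp_apply, ← PrimeSpectrum.comap_comp_apply,
    show π.comp φ = ρ.comp ψ from RingHom.ext h.comm]

/-- The larger ring of a fiber square with surjective `π` is the blowup algebra of its conductor. -/
lemma existsUnique_extension (h : IsFiberSquare φ ψ π ρ) {C : Type*} [CommRing C] (θ : A →+* C)
    {t : C} (ht : t ∈ nonZeroDivisors C) (hθ : (RingHom.ker ψ).map θ = Ideal.span {t}) :
    ∃! θ' : A' →+* C, θ'.comp φ = θ := by
  have htm : t ∈ (RingHom.ker ψ).map θ := hθ ▸ Ideal.mem_span_singleton_self t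
  have hcancel (c d : C) (hcd : ∀ f, ψ f = 0 → c * θ f = d * θ f) : c = d := by
    have key : ∀ s ∈ (RingHom.ker ψ).map θ, c * s = d * s := fun s hs ↦ by
      induction hs using Submodule.span_induction with
      | mem x hx => obtain ⟨f, hf, rfl⟩ := hx; exact hcd f hf
      | zero => simp
      | add x y _ _ hx hy => rw [mul_add, mul_add, hx, hy]
      | smul a x _ hx => rw [smul_eq_mul, mul_left_comm, hx, mul_left_comm]
    exact (mul_cancel_right_mem_nonZeroDivisors ht).mp (key t htm)
  -- Multiplication by `x` preserves the conductor; `c` is the scalar by which it acts after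
  -- extension to the principal ideal `(t)`.
  have hex (x : A') : ∃ c, ∀ f a, ψ f = 0 → ψ a = 0 → φ a = x * φ f → θ a = c * θ f := by
    -- Here `d` stands for `x * s`. Only the cross-multiplied relation is recorded, so `s ↦ d` need
    -- not be shown to be well defined.
    have key : ∀ s ∈ (RingHom.ker ψ).map θ, ∃ d ∈ (RingHom.ker ψ).map θ,
        ∀ f a, ψ f = 0 → ψ a = 0 → φ a = x * φ f → θ a * s = d * θ f := fun s hs ↦ by
      induction hs using Submodule.span_induction with
      | mem s hs =>
        obtain ⟨g, hg, rfl⟩ := hs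
        obtain ⟨b, hb, hb'⟩ := h.exists_mul hg x
        refine ⟨θ b, Ideal.mem_map_of_mem _ hb', fun f a hf ha hfa ↦ ?_⟩
        rw [← map_mul, ← map_mul]
        refine congr(θ $(h.ext ?_ ?_))
        · rw [map_mul, map_mul, hb, hfa]; ring
        · rw [map_mul, map_mul, ha, hf]; simp
      | zero => exact ⟨0, zero_mem _, by simp⟩
      | add y z _ _ hy hz =>
        obtain ⟨d, hd, hd'⟩ := hy
        obtain ⟨e, he, he'⟩ := hz
        refine ⟨d + e, add_mem hd he, fun f a hf ha hfa ↦ ?_⟩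
        rw [mul_add, add_mul, hd' f a hf ha hfa, he' f a hf ha hfa]
      | smul c y _ hy =>
        obtain ⟨d, hd, hd'⟩ := hy
        refine ⟨c * d, Ideal.mul_mem_left _ _ hd, fun f a hf ha hfa ↦ ?_⟩
        rw [smul_eq_mul, mul_left_comm, hd' f a hf ha hfa, mul_assoc]
    obtain ⟨d, hd, hd'⟩ := key t htm
    rw [hθ] at hd
    obtain ⟨c, rfl⟩ := Ideal.mem_span_singleton'.mp hd
    refine ⟨c, fun f a hf ha hfa ↦ (mul_cancel_right_mem_nonZeroDivisors ht).mp ?_⟩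
    rw [hd' f a hf ha hfa]; ring
  choose c hc using hex
  -- The defining relation determines `c x`; the ring axioms, compatibility with `θ` and uniqueness
  -- all reduce to checking that relation.
  have hcu (x : A') (d : C) (hd : ∀ f a, ψ f = 0 → ψ a = 0 → φ a = x * φ f → θ a = d * θ f) :
      c x = d := hcancel _ _ fun f hf ↦ by
    obtain ⟨a, ha, ha'⟩ := h.exists_mul hf x
    rw [← hd f a hf ha' ha, ← hc x f a hf ha' ha]
  have hcφ (a : A) : c (φ a) = θ a := hcu _ _ fun f b hf hb hfb ↦ by
    rw [← map_mul]
    exact congr(θ $(h.ext (by simp [hfb]) (by simp [hf, hb])))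
  refine ⟨{
    toFun := c
    map_one' := by rw [← φ.map_one, hcφ, map_one]
    map_zero' := by rw [← φ.map_zero, hcφ, map_zero]
    map_mul' := fun x y ↦ hcu _ _ fun f a hf ha hfa ↦ ?_
    map_add' := fun x y ↦ hcu _ _ fun f a hf ha hfa ↦ ?_ }, RingHom.ext hcφ,
    fun θ' hθ' ↦ RingHom.ext fun x ↦ (hcu _ _ fun f a hf ha hfa ↦ ?_).symm⟩
  · obtain ⟨v, hv, hv'⟩ := h.exists_mul hf y
    rw [mul_assoc, ← hc y f v hf hv' hv, ← hc x v a hv' ha (by rw [hfa, hv, mul_assoc])]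
  · obtain ⟨u, hu, hu'⟩ := h.exists_mul hf x
    obtain ⟨v, hv, hv'⟩ := h.exists_mul hf y
    rw [add_mul, ← hc x f u hf hu' hu, ← hc y f v hf hv' hv, ← map_add]
    exact congr(θ $(h.ext (by rw [hfa, map_add, hu, hv, add_mul]) (by simp [ha, hu', hv'])))
  · rw [← hθ', RingHom.comp_apply, RingHom.comp_apply, ← map_mul, hfa]

end

section Localization

variable {A A' B B' A₁ A₁' B₁ B₁' : Type*} [CommRing A] [CommRing A'] [CommRing B] [CommRing B']
    [CommRing A₁] [CommRing A₁'] [CommRing B₁] [CommRing B₁']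
    {φ : A →+* A'} {ψ : A →+* B} {π : A' →+* B'} {ρ : B →+* B'}
    {φ₁ : A₁ →+* A₁'} {ψ₁ : A₁ →+* B₁} {π₁ : A₁' →+* B₁'} {ρ₁ : B₁ →+* B₁'}
    [Algebra A A₁] [Algebra A' A₁'] [Algebra B B₁] [Algebra B' B₁']

/-- The localization of a fiber square is a fiber square. -/
lemma localization (h : IsFiberSquare φ ψ π ρ) (g : A) [IsLocalization.Away g A₁]
    [IsLocalization.Away (φ g) A₁'] [IsLocalization.Away (ψ g) B₁]
    [IsLocalization.Away (π (φ g)) B₁']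
    (hφ : φ₁.comp (algebraMap A A₁) = (algebraMap A' A₁').comp φ)
    (hψ : ψ₁.comp (algebraMap A A₁) = (algebraMap B B₁).comp ψ)
    (hπ : π₁.comp (algebraMap A' A₁') = (algebraMap B' B₁').comp π)
    (hρ : ρ₁.comp (algebraMap B B₁) = (algebraMap B' B₁').comp ρ) :
    IsFiberSquare φ₁ ψ₁ π₁ ρ₁ := by
  replace hφ a : φ₁ (algebraMap A A₁ a) = algebraMap A' A₁' (φ a) := RingHom.congr_fun hφ a
  replace hψ a : ψ₁ (algebraMap A A₁ a) = algebraMap B B₁ (ψ a) := RingHom.congr_fun hψ a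
  replace hπ a : π₁ (algebraMap A' A₁' a) = algebraMap B' B₁' (π a) := RingHom.congr_fun hπ a
  replace hρ a : ρ₁ (algebraMap B B₁ a) = algebraMap B' B₁' (ρ a) := RingHom.congr_fun hρ a
  have hu : IsUnit (algebraMap A A₁ g) := IsLocalization.Away.algebraMap_isUnit g
  have huA' : IsUnit (algebraMap A' A₁' (φ g)) := IsLocalization.Away.algebraMap_isUnit _
  have huB : IsUnit (algebraMap B B₁ (ψ g)) := IsLocalization.Away.algebraMap_isUnit _
  have huB' : IsUnit (algebraMap B' B₁' (π (φ g))) := IsLocalization.Away.algebraMap_isUnit _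
  refine ⟨fun z ↦ ?_, fun z hz hz' ↦ ?_, fun z b hzb ↦ ?_⟩
  · obtain ⟨n, a, ha⟩ := IsLocalization.Away.surj g z
    refine (huB'.pow n).mul_left_injective ?_
    have h₁ := congr(π₁ (φ₁ $ha))
    have h₂ := congr(ρ₁ (ψ₁ $ha))
    simp only [map_mul, map_pow, hφ, hψ, hπ, hρ, ← h.comm] at h₁ h₂ ⊢
    rw [h₁, h₂]
  · obtain ⟨n, a, ha⟩ := IsLocalization.Away.surj g z
    have h₁ := congr(φ₁ $ha)
    have h₂ := congr(ψ₁ $ha)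
    rw [map_mul, hz, zero_mul, hφ, ← map_zero (algebraMap A' A₁')] at h₁
    rw [map_mul, hz', zero_mul, hψ, ← map_zero (algebraMap B B₁)] at h₂
    obtain ⟨k, hk⟩ := IsLocalization.Away.exists_of_eq (φ g) h₁.symm
    obtain ⟨l, hl⟩ := IsLocalization.Away.exists_of_eq (ψ g) h₂.symm
    have : g ^ k * g ^ l * a = 0 := h.eq_zero _
      (by rw [map_mul, map_mul, mul_right_comm, map_pow, hk]; simp)
      (by rw [map_mul, map_mul, mul_assoc, map_pow ψ _ l, hl]; simp)
    refine ((hu.pow k).mul (hu.pow l)).mul_left_cancel ((hu.pow n).mul_left_injective ?_)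
    simp only [mul_assoc, ha, mul_zero, zero_mul]
    simpa [mul_assoc] using congr(algebraMap A A₁ $this)
  · obtain ⟨n, x, hx⟩ := IsLocalization.Away.surj (φ g) z
    obtain ⟨m, y, hy⟩ := IsLocalization.Away.surj (ψ g) b
    have : algebraMap B' B₁' (π (x * φ g ^ m)) = algebraMap B' B₁' (ρ (y * ψ g ^ n)) := by
      simp only [← hπ, ← hρ, map_mul, map_pow, ← hx, ← hy, hzb]
      simp only [hπ, hρ, h.comm]
      ring
    obtain ⟨k, hk⟩ := IsLocalization.Away.exists_of_eq (π (φ g)) this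
    obtain ⟨a, ha, ha'⟩ := h.exists_lift (φ g ^ k * (x * φ g ^ m)) (ψ g ^ k * (y * ψ g ^ n))
      (by simpa [← h.comm] using hk)
    obtain ⟨v, hv⟩ := isUnit_iff_exists_inv.mp ((hu.pow k).mul (hu.pow (n + m)))
    refine ⟨algebraMap A A₁ a * v, ?_, ?_⟩
    · have hv' := congr(φ₁ $hv)
      simp only [map_mul, map_pow, hφ, map_one, ha, ← hx] at hv' ⊢
      linear_combination z * hv'
    · have hv' := congr(ψ₁ $hv)
      simp only [map_mul, map_pow, hψ, map_one, ha', ← hy] at hv' ⊢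
      linear_combination b * hv'

end Localization

end IsFiberSquare

/-! ### Working locally on schemes; basic open subschemes. -/

namespace AlgebraicGeometry

lemma Scheme.comp_eq_apply {X Y Y' Z : Scheme.{u}} {f : X ⟶ Y} {g : Y ⟶ Z} {f' : X ⟶ Y'}
    {g' : Y' ⟶ Z} (h : f ≫ g = f' ≫ g') (x : X) : g (f x) = g' (f' x) := by
  rw [← Scheme.Hom.comp_apply, h, Scheme.Hom.comp_apply]

/-- An open cover built from one open neighbourhood for every point. -/
noncomputable def Scheme.openCoverOfPoints {X : Scheme.{u}} (Y : X → Scheme.{u})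
    (f : ∀ x, Y x ⟶ X) (hf : ∀ x, IsOpenImmersion (f x)) (hx : ∀ x, x ∈ Set.range (f x)) :
    X.OpenCover where
  I₀ := X
  X := Y
  f := f
  mem₀ := by
    rw [Scheme.presieve₀_mem_precoverage_iff]
    exact ⟨fun x ↦ ⟨x, hx x⟩, hf⟩

/-- Morphisms agree if they agree locally on the source. -/
lemma Scheme.hom_ext_of_forall_mem_range {X Y : Scheme.{u}} (f g : X ⟶ Y)
    (H : ∀ x : X, ∃ (U : Scheme.{u}) (c : U ⟶ X), IsOpenImmersion c ∧ x ∈ Set.range c ∧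
      c ≫ f = c ≫ g) : f = g := by
  choose U c hc hx h using H
  exact (Scheme.openCoverOfPoints U c hc hx).hom_ext _ _ h

/-- A property local at the target holds if every point of the target has an open neighbourhood
over which it holds. -/
lemma IsZariskiLocalAtTarget.of_forall_isPullback (P : MorphismProperty Scheme.{u})
    [IsZariskiLocalAtTarget P] {X Y : Scheme.{u}} (f : X ⟶ Y)
    (H : ∀ y : Y, ∃ (U V : Scheme.{u}) (c : U ⟶ X) (f' : U ⟶ V) (d : V ⟶ Y), IsOpenImmersion d ∧
      y ∈ Set.range d ∧ IsPullback c f' f d ∧ P f') : P f := by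
  choose U V c f' d hd hy hp hP using H
  refine IsZariskiLocalAtTarget.of_openCover (Scheme.openCoverOfPoints V d hd hy) fun y ↦ ?_
  have : pullback.snd f (d y) = (hp y).isoPullback.inv ≫ f' y := by simp
  change P (pullback.snd f (d y))
  rw [this, P.cancel_left_of_respectsIso]
  exact hP y

/-- A property local at the source holds if every point of the source has an open neighbourhood
on which it holds. -/
lemma IsZariskiLocalAtSource.of_forall_comp (P : MorphismProperty Scheme.{u})
    [IsZariskiLocalAtSource P] {X Y : Scheme.{u}} (f : X ⟶ Y)
    (H : ∀ x : X, ∃ (U : Scheme.{u}) (c : U ⟶ X), IsOpenImmersion c ∧ x ∈ Set.range c ∧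
      P (c ≫ f)) : P f := by
  choose U c hc hx h using H
  exact IsZariskiLocalAtSource.of_openCover (Scheme.openCoverOfPoints U c hc hx) h

/-- The basic open subscheme of an affine scheme. -/
noncomputable abbrev Spec.away {A : CommRingCat.{u}} (g : A) :
    Spec (.of (Localization.Away g)) ⟶ Spec A :=
  Spec.map (CommRingCat.ofHom (algebraMap A (Localization.Away g)))

lemma Spec.mem_range_away {A : CommRingCat.{u}} (g : A) (p : Spec A) :
    p ∈ Set.range (Spec.away g) ↔ g ∉ p.asIdeal := by
  change p ∈ Set.range (PrimeSpectrum.comap (algebraMap A (Localization.Away g))) ↔ _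
  rw [PrimeSpectrum.localization_away_comap_range _ g]
  rfl

instance {A : CommRingCat.{u}} (g : A) : IsOpenImmersion (Spec.away g) :=
  IsOpenImmersion.of_isLocalization g

lemma preimage_opensRange_away {X Y : Scheme.{u}} {A B : CommRingCat.{u}} (f : Y ⟶ X)
    (a : Spec A ⟶ X) [IsOpenImmersion a] (b : Spec B ⟶ Y) [IsOpenImmersion b] (φ : A ⟶ B)
    (h : b ≫ f = Spec.map φ ≫ a) (hr : f ⁻¹ᵁ a.opensRange = b.opensRange) (g : A) (g' : B)
    (hg : g' = φ.hom g) :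
    f ⁻¹ᵁ (Spec.away g ≫ a).opensRange = (Spec.away g' ≫ b).opensRange := by
  subst hg
  have key (z : Spec B) : f (b z) = a (Spec.map φ z) := by
    rw [← Scheme.Hom.comp_apply, h, Scheme.Hom.comp_apply]
  ext y
  constructor
  · rintro ⟨w, hw⟩
    rw [Scheme.Hom.comp_apply] at hw
    obtain ⟨z, rfl⟩ : y ∈ b.opensRange := hr ▸ ⟨_, hw⟩
    rw [key] at hw
    have := a.isOpenEmbedding.injective hw
    obtain ⟨z', rfl⟩ := (Spec.mem_range_away (φ.hom g) z).mpr
      ((Spec.mem_range_away g _).mp ⟨w, this⟩)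
    exact ⟨z', by rw [Scheme.Hom.comp_apply]⟩
  · rintro ⟨z', rfl⟩
    rw [Scheme.Hom.comp_apply]
    change f (b (Spec.away (φ.hom g) z')) ∈ Set.range (Spec.away g ≫ a)
    rw [key]
    obtain ⟨w, hw⟩ := (Spec.mem_range_away g (Spec.map φ (Spec.away (φ.hom g) z'))).mpr
      ((Spec.mem_range_away (φ.hom g) _).mp ⟨z', rfl⟩)
    exact ⟨w, by rw [Scheme.Hom.comp_apply, hw]⟩

/-! ### Pinching squares and their universal property. -/

section

variable {X' D' D X : Scheme.{u}}

/-- An affine chart of a commutative square of schemes `D' ⟶ X' ⟶ X`, `D' ⟶ D ⟶ X`, over which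
the square is dual to a fiber square of rings. -/
structure PinchingChart (i : D' ⟶ X') (q : D' ⟶ D) (ν : X' ⟶ X) (j : D ⟶ X) where
  {A A' B B' : CommRingCat.{u}}
  (φ : A ⟶ A') (ψ : A ⟶ B) (π : A' ⟶ B') (ρ : B ⟶ B')
  isFiberSquare : IsFiberSquare φ.hom ψ.hom π.hom ρ.hom
  surjective : Function.Surjective π.hom
  isIntegral : ρ.hom.IsIntegral
  (a : Spec A ⟶ X) (a' : Spec A' ⟶ X') (b : Spec B ⟶ D) (b' : Spec B' ⟶ D')
  [open_a : IsOpenImmersion a] [open_a' : IsOpenImmersion a']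
  [open_b : IsOpenImmersion b] [open_b' : IsOpenImmersion b']
  a'_comp : a' ≫ ν = Spec.map φ ≫ a
  b_comp : b ≫ j = Spec.map ψ ≫ a
  b'_comp_i : b' ≫ i = Spec.map π ≫ a'
  b'_comp_q : b' ≫ q = Spec.map ρ ≫ b
  preimage_ν : ν ⁻¹ᵁ a.opensRange = a'.opensRange
  preimage_j : j ⁻¹ᵁ a.opensRange = b.opensRange
  preimage_i : i ⁻¹ᵁ a'.opensRange = b'.opensRange

/-- A commutative square of schemes is a pinching square if it is locally on the lower right corner
dual to a fiber square of rings. -/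
structure IsPinching (i : D' ⟶ X') (q : D' ⟶ D) (ν : X' ⟶ X) (j : D ⟶ X) : Prop where
  w : i ≫ ν = q ≫ j
  exists_chart : ∀ x : X, ∃ c : PinchingChart i q ν j, x ∈ Set.range c.a

namespace PinchingChart

attribute [instance] open_a open_a' open_b open_b'

variable {i : D' ⟶ X'} {q : D' ⟶ D} {ν : X' ⟶ X} {j : D ⟶ X} (c : PinchingChart i q ν j)

lemma isPullback_ν : IsPullback (Spec.map c.φ) c.a' c.a ν :=
  IsOpenImmersion.isPullback _ _ _ _ c.a'_comp c.preimage_ν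

lemma isPullback_j : IsPullback (Spec.map c.ψ) c.b c.a j :=
  IsOpenImmersion.isPullback _ _ _ _ c.b_comp c.preimage_j

lemma isPullback_i : IsPullback (Spec.map c.π) c.b' c.a' i :=
  IsOpenImmersion.isPullback _ _ _ _ c.b'_comp_i c.preimage_i

/-- The restriction of a chart to a basic open subset. -/
noncomputable def away (g : c.A) : PinchingChart i q ν j :=
  have : IsLocalization.Away (c.ρ.hom (c.ψ.hom g))
    (Localization.Away (c.π.hom (c.φ.hom g))) := by
      rw [← c.isFiberSquare.comm]; infer_instance
  { A := .of (Localization.Away g)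
    A' := .of (Localization.Away (c.φ.hom g))
    B := .of (Localization.Away (c.ψ.hom g))
    B' := .of (Localization.Away (c.π.hom (c.φ.hom g)))
    φ := CommRingCat.ofHom (IsLocalization.Away.map _ _ c.φ.hom g)
    ψ := CommRingCat.ofHom (IsLocalization.Away.map _ _ c.ψ.hom g)
    π := CommRingCat.ofHom (IsLocalization.Away.map _ _ c.π.hom (c.φ.hom g))
    ρ := CommRingCat.ofHom (IsLocalization.Away.map _ _ c.ρ.hom (c.ψ.hom g))
    isFiberSquare := c.isFiberSquare.localization g
      (by ext; simp [IsLocalization.Away.map]) (by ext; simp [IsLocalization.Away.map])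
      (by ext; simp [IsLocalization.Away.map]) (by ext; simp [IsLocalization.Away.map])
    surjective := RingHom.surjective_localizationPreserves.away _ _ _ _ c.surjective
    isIntegral := RingHom.isIntegral_isStableUnderBaseChange.localizationPreserves.away
      _ _ _ _ c.isIntegral
    a := Spec.away g ≫ c.a
    a' := Spec.away (c.φ.hom g) ≫ c.a'
    b := Spec.away (c.ψ.hom g) ≫ c.b
    b' := Spec.away (c.π.hom (c.φ.hom g)) ≫ c.b'
    a'_comp := by
      rw [Category.assoc, c.a'_comp, ← Spec.map_comp_assoc, ← Spec.map_comp_assoc]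
      congr 2; ext; simp [IsLocalization.Away.map]
    b_comp := by
      rw [Category.assoc, c.b_comp, ← Spec.map_comp_assoc, ← Spec.map_comp_assoc]
      congr 2; ext; simp [IsLocalization.Away.map]
    b'_comp_i := by
      rw [Category.assoc, c.b'_comp_i, ← Spec.map_comp_assoc, ← Spec.map_comp_assoc]
      congr 2; ext; simp [IsLocalization.Away.map]
    b'_comp_q := by
      rw [Category.assoc, c.b'_comp_q, ← Spec.map_comp_assoc, ← Spec.map_comp_assoc]
      congr 2; ext; simp [IsLocalization.Away.map]
    preimage_ν := preimage_opensRange_away _ _ _ _ c.a'_comp c.preimage_ν _ _ rfl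
    preimage_j := preimage_opensRange_away _ _ _ _ c.b_comp c.preimage_j _ _ rfl
    preimage_i := preimage_opensRange_away _ _ _ _ c.b'_comp_i c.preimage_i _ _ rfl }

lemma exists_le (x : X) (hx : x ∈ Set.range c.a) (V : X.Opens) (hV : x ∈ V) :
    ∃ c' : PinchingChart i q ν j, x ∈ Set.range c'.a ∧ Set.range c'.a ⊆ V := by
  obtain ⟨p, rfl⟩ := hx
  obtain ⟨-, ⟨-, ⟨g, rfl⟩, rfl⟩, hpg, hg⟩ :=
    PrimeSpectrum.isBasis_basic_opens.exists_subset_of_mem_open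
    (show p ∈ ((c.a ⁻¹ᵁ V : (Spec c.A).Opens) : Set (Spec c.A)) from hV) (c.a ⁻¹ᵁ V).2
  refine ⟨c.away g, ?_, ?_⟩
  · obtain ⟨z, rfl⟩ := (Spec.mem_range_away g p).mpr hpg
    exact ⟨z, Scheme.Hom.comp_apply _ _ _⟩
  · rintro _ ⟨z, rfl⟩
    have : Spec.away g z ∈ Set.range (Spec.away g) := ⟨z, rfl⟩
    have h2 : c.a (Spec.away g z) ∈ V := hg ((Spec.mem_range_away g _).mp this)
    exact Scheme.Hom.comp_apply (Spec.away g) c.a z ▸ h2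

/-- The part of `X'` over a chart. -/
lemma mem_range_a' {x : X'} : x ∈ Set.range c.a' ↔ ν x ∈ Set.range c.a := by
  rw [← Scheme.Hom.coe_opensRange, ← c.preimage_ν]; rfl

lemma mem_range_b {x : D} : x ∈ Set.range c.b ↔ j x ∈ Set.range c.a := by
  rw [← Scheme.Hom.coe_opensRange, ← c.preimage_j]; rfl

lemma ν_a' (z : Spec c.A') : ν (c.a' z) = c.a (Spec.map c.φ z) :=
  Scheme.comp_eq_apply c.a'_comp z

lemma j_b (z : Spec c.B) : j (c.b z) = c.a (Spec.map c.ψ z) :=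
  Scheme.comp_eq_apply c.b_comp z

/-- Ring homomorphisms into a chart. -/
lemma exists_lift {R : CommRingCat.{u}} (f : R ⟶ c.A') (g : R ⟶ c.B) (h : f ≫ c.π = g ≫ c.ρ) :
    ∃ k : R ⟶ c.A, k ≫ c.φ = f ∧ k ≫ c.ψ = g := by
  obtain ⟨k, hk, hk'⟩ := c.isFiberSquare.exists_ringHom f.hom g.hom congr(($h).hom)
  exact ⟨CommRingCat.ofHom k, CommRingCat.hom_ext hk, CommRingCat.hom_ext hk'⟩

lemma hom_ext {R : CommRingCat.{u}} {f g : R ⟶ c.A} (h₁ : f ≫ c.φ = g ≫ c.φ)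
    (h₂ : f ≫ c.ψ = g ≫ c.ψ) : f = g := by
  ext x
  exact c.isFiberSquare.ext congr(($h₁) x) congr(($h₂) x)

end PinchingChart

namespace IsPinching

variable {i : D' ⟶ X'} {q : D' ⟶ D} {ν : X' ⟶ X} {j : D ⟶ X} (h : IsPinching i q ν j)

include h

lemma exists_chart_le (x : X) (V : X.Opens) (hV : x ∈ V) :
    ∃ c : PinchingChart i q ν j, x ∈ Set.range c.a ∧ Set.range c.a ⊆ V := by
  obtain ⟨c, hc⟩ := h.exists_chart x
  exact c.exists_le x hc V hV

lemma isIntegralHom : IsIntegralHom ν := by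
  have : IsZariskiLocalAtTarget @IsIntegralHom :=
    @HasAffineProperty.instIsZariskiLocalAtTarget _ _ IsIntegralHom.hasAffineProperty
  refine IsZariskiLocalAtTarget.of_forall_isPullback @IsIntegralHom ν fun x ↦ ?_
  obtain ⟨c, hc⟩ := h.exists_chart x
  exact ⟨_, _, c.a', Spec.map c.φ, c.a, inferInstance, hc, c.isPullback_ν.flip,
    IsIntegralHom.SpecMap_iff.mpr (c.isFiberSquare.isIntegral c.surjective c.isIntegral)⟩

lemma isClosedImmersion : IsClosedImmersion j := by
  refine IsZariskiLocalAtTarget.of_forall_isPullback @IsClosedImmersion j fun x ↦ ?_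
  obtain ⟨c, hc⟩ := h.exists_chart x
  exact ⟨_, _, c.b, Spec.map c.ψ, c.a, inferInstance, hc, c.isPullback_j.flip,
    IsClosedImmersion.spec_of_surjective _ (c.isFiberSquare.surjective c.surjective)⟩

/-- With `eq_of_eq` and `exists_of_notMem_range` this describes the points of `X`: off `D` they are
the points of `X'`, and over `D` a point of `X'` comes from `D'`. -/
lemma exists_eq_of_eq {y : X'} {d : D} (hyd : ν y = j d) : ∃ e, i e = y ∧ q e = d := by
  obtain ⟨c, p, hp⟩ := h.exists_chart (j d)
  obtain ⟨y, rfl⟩ := c.mem_range_a'.mpr ⟨p, hp.trans hyd.symm⟩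
  obtain ⟨d, rfl⟩ := c.mem_range_b.mpr ⟨p, hp⟩
  rw [c.ν_a', c.j_b] at hyd
  obtain ⟨r, rfl, rfl⟩ := c.isFiberSquare.exists_prime_of_comap_eq c.surjective y d
    (c.a.isOpenEmbedding.injective hyd)
  exact ⟨c.b' r, Scheme.comp_eq_apply c.b'_comp_i r, Scheme.comp_eq_apply c.b'_comp_q r⟩

omit h in
lemma ker_not_le (c : PinchingChart i q ν j) (p : Spec c.A) (hp : c.a p ∉ Set.range j) :
    ¬ RingHom.ker c.ψ.hom ≤ p.asIdeal := fun hle ↦ by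
  obtain ⟨r, rfl⟩ := c.isFiberSquare.exists_prime_of_ker_le c.surjective p hle
  exact hp ⟨c.b r, c.j_b r⟩

lemma eq_of_eq {y z : X'} (hyz : ν y = ν z) (hy : ν y ∉ Set.range j) : y = z := by
  obtain ⟨c, p, hp⟩ := h.exists_chart (ν y)
  obtain ⟨y, rfl⟩ := c.mem_range_a'.mpr ⟨p, hp⟩
  obtain ⟨z, rfl⟩ := c.mem_range_a'.mpr ⟨p, hp.trans hyz⟩
  rw [c.ν_a', c.ν_a'] at hyz
  rw [c.ν_a'] at hy
  rw [c.isFiberSquare.prime_ext y z (c.a.isOpenEmbedding.injective hyz) (ker_not_le c _ hy)]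

lemma exists_of_notMem_range {x : X} (hx : x ∉ Set.range j) : ∃ y, ν y = x := by
  obtain ⟨c, p, rfl⟩ := h.exists_chart x
  obtain ⟨r, rfl⟩ := c.isFiberSquare.exists_prime_of_ker_not_le
    (c.isFiberSquare.isIntegral c.surjective c.isIntegral) p (ker_not_le c _ hx)
  exact ⟨c.a' r, c.ν_a' r⟩

lemma forall_point {P : X → Prop} (hν : ∀ y, P (ν y)) (hj : ∀ d, P (j d)) (x : X) : P x := by
  by_cases hx : x ∈ Set.range j
  · obtain ⟨d, rfl⟩ := hx
    exact hj d
  · obtain ⟨y, rfl⟩ := h.exists_of_notMem_range hx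
    exact hν y

section Desc

variable {Z : Scheme.{u}} (α : X' ⟶ Z) (β : D ⟶ Z)

omit h in
/-- `γ` is the restriction along `t` of a morphism induced by `α` and `β`. -/
def _root_.AlgebraicGeometry.IsDescRestriction (ν : X' ⟶ X) (j : D ⟶ X) {Z : Scheme.{u}}
    (α : X' ⟶ Z) (β : D ⟶ Z) {U : Scheme.{u}} (t : U ⟶ X) (γ : U ⟶ Z) : Prop :=
  (∀ (T : Scheme.{u}) (s : T ⟶ X') (r : T ⟶ U), s ≫ ν = r ≫ t → r ≫ γ = s ≫ α) ∧
  (∀ (T : Scheme.{u}) (s : T ⟶ D) (r : T ⟶ U), s ≫ j = r ≫ t → r ≫ γ = s ≫ β)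

omit h in
variable {α β} in
lemma _root_.AlgebraicGeometry.IsDescRestriction.comp {U V : Scheme.{u}} {t : U ⟶ X} {γ : U ⟶ Z}
    (hγ : IsDescRestriction ν j α β t γ) (r : V ⟶ U) :
    IsDescRestriction ν j α β (r ≫ t) (r ≫ γ) :=
  ⟨fun T s r' h' ↦ by simpa using hγ.1 T s (r' ≫ r) (by simpa using h'),
    fun T s r' h' ↦ by simpa using hγ.2 T s (r' ≫ r) (by simpa using h')⟩

omit h in
lemma _root_.AlgebraicGeometry.PinchingChart.isDescRestriction (c : PinchingChart i q ν j)
    (γ : Spec c.A ⟶ Z) (h₁ : Spec.map c.φ ≫ γ = c.a' ≫ α) (h₂ : Spec.map c.ψ ≫ γ = c.b ≫ β) :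
    IsDescRestriction ν j α β c.a γ := by
  refine ⟨fun T s r hsr ↦ ?_, fun T s r hsr ↦ ?_⟩
  · rw [← c.isPullback_ν.lift_fst r s hsr.symm, Category.assoc, h₁,
      c.isPullback_ν.lift_snd_assoc]
  · rw [← c.isPullback_j.lift_fst r s hsr.symm, Category.assoc, h₂,
      c.isPullback_j.lift_snd_assoc]

variable {α β} in
-- The two maps agree at points, since every point of a chart comes from `A'` or from `B`. So on a
-- small chart both land in one affine open of `Z`, where they are ring maps into `A`, and `A`
-- embeds in `A' × B`.
lemma desc_unique {U : Scheme.{u}} (t : U ⟶ X) [IsOpenImmersion t] (γ γ' : U ⟶ Z)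
    (hγ : IsDescRestriction ν j α β t γ) (hγ' : IsDescRestriction ν j α β t γ') : γ = γ' := by
  have key (c : PinchingChart i q ν j) (r : Spec c.A ⟶ U) (hr : r ≫ t = c.a) :
      Spec.map c.φ ≫ r ≫ γ = Spec.map c.φ ≫ r ≫ γ' ∧
      Spec.map c.ψ ≫ r ≫ γ = Spec.map c.ψ ≫ r ≫ γ' := by
    constructor
    · rw [← Category.assoc, ← Category.assoc, hγ.1 _ c.a' _ (by simp [hr, c.a'_comp]),
        hγ'.1 _ c.a' _ (by simp [hr, c.a'_comp])]
    · rw [← Category.assoc, ← Category.assoc, hγ.2 _ c.b _ (by simp [hr, c.b_comp]),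
        hγ'.2 _ c.b _ (by simp [hr, c.b_comp])]
  have hlift (W : U.Opens) (x : U) (hx : x ∈ W) : ∃ (c : PinchingChart i q ν j)
      (r : Spec c.A ⟶ U), r ≫ t = c.a ∧ x ∈ Set.range r ∧ Set.range r ⊆ W := by
    obtain ⟨c, ⟨p, hp⟩, hc⟩ := h.exists_chart_le (t x) (t ''ᵁ W) ⟨x, hx, rfl⟩
    refine ⟨c, IsOpenImmersion.lift t c.a (hc.trans (Set.image_subset_range _ _)),
      IsOpenImmersion.lift_fac _ _ _, ⟨p, t.isOpenEmbedding.injective ?_⟩, ?_⟩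
    · rw [← Scheme.Hom.comp_apply, IsOpenImmersion.lift_fac, hp]
    · rintro _ ⟨p, rfl⟩
      obtain ⟨y, hy, hy'⟩ := hc ⟨p, rfl⟩
      convert hy
      refine t.isOpenEmbedding.injective ?_
      rw [← Scheme.Hom.comp_apply, IsOpenImmersion.lift_fac]
      exact hy'.symm
  have hpt (x : U) : γ x = γ' x := by
    obtain ⟨c, r, hr, ⟨p, rfl⟩, -⟩ := hlift ⊤ x trivial
    obtain ⟨k₁, k₂⟩ := key c r hr
    by_cases hp : RingHom.ker c.ψ.hom ≤ p.asIdeal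
    · obtain ⟨z, rfl⟩ := c.isFiberSquare.exists_prime_of_ker_le c.surjective p hp
      exact (Scheme.comp_eq_apply (by simpa using k₂ : (Spec.map c.ψ ≫ r) ≫ γ = (Spec.map c.ψ ≫ r) ≫ γ') z)
    · obtain ⟨z, rfl⟩ := c.isFiberSquare.exists_prime_of_ker_not_le
        (c.isFiberSquare.isIntegral c.surjective c.isIntegral) p hp
      exact (Scheme.comp_eq_apply (by simpa using k₁ : (Spec.map c.φ ≫ r) ≫ γ = (Spec.map c.φ ≫ r) ≫ γ') z)
  refine Scheme.hom_ext_of_forall_mem_range _ _ fun x ↦ ?_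
  obtain ⟨R, v, hv, hxv, -⟩ := Scheme.exists_affine_mem_range_and_range_subset
    (show γ x ∈ (⊤ : Z.Opens) from trivial)
  obtain ⟨c, r, hr, hxr, hrW⟩ := hlift (γ ⁻¹ᵁ v.opensRange ⊓ γ' ⁻¹ᵁ v.opensRange) x
    ⟨hxv, show γ' x ∈ Set.range v from hpt x ▸ hxv⟩
  have : IsOpenImmersion r := by
    have : IsOpenImmersion (r ≫ t) := hr ▸ inferInstance
    exact .of_comp r t
  refine ⟨_, r, this, hxr, ?_⟩
  have e₁ : Set.range (r ≫ γ) ⊆ Set.range v := by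
    rintro _ ⟨p, rfl⟩
    simpa using (hrW ⟨p, rfl⟩).1
  have e₂ : Set.range (r ≫ γ') ⊆ Set.range v := by
    rintro _ ⟨p, rfl⟩
    simpa using (hrW ⟨p, rfl⟩).2
  obtain ⟨f, hf⟩ := Spec.map_surjective (IsOpenImmersion.lift v _ e₁)
  obtain ⟨f', hf'⟩ := Spec.map_surjective (IsOpenImmersion.lift v _ e₂)
  have hf₁ : Spec.map f ≫ v = r ≫ γ := by rw [hf, IsOpenImmersion.lift_fac]
  have hf₂ : Spec.map f' ≫ v = r ≫ γ' := by rw [hf', IsOpenImmersion.lift_fac]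
  obtain ⟨k₁, k₂⟩ := key c r hr
  rw [← hf₁, ← hf₂, ← Spec.map_comp_assoc, ← Spec.map_comp_assoc, cancel_mono,
    Spec.map_inj] at k₁ k₂
  rw [← hf₁, ← hf₂, c.hom_ext k₁ k₂]

/-- Everything over `x` goes to a single point `z`. The points of `X` over which something leaves an
affine neighbourhood of `z` form a closed set `C`, as `ν` and `j` are closed. On a chart missing `C`
both maps come from ring maps, into `A'` and `B`, and these combine into a map to the fiber product
`A`. -/
lemma exists_desc_chart (hαβ : i ≫ α = q ≫ β) (x : X) :
    ∃ (c : PinchingChart i q ν j) (γ : Spec c.A ⟶ Z), x ∈ Set.range c.a ∧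
      IsDescRestriction ν j α β c.a γ := by
  have := h.isIntegralHom
  have := h.isClosedImmersion
  obtain ⟨z, hz₁, hz₂⟩ : ∃ z : Z, (∀ y, ν y = x → α y = z) ∧ (∀ d, j d = x → β d = z) := by
    by_cases hx : x ∈ Set.range j
    · obtain ⟨d, rfl⟩ := hx
      refine ⟨β d, fun y hy ↦ ?_, fun d' hd' ↦ congr(β $(j.isClosedEmbedding.injective hd'))⟩
      obtain ⟨e, rfl, rfl⟩ := h.exists_eq_of_eq hy
      simpa using congr($hαβ e)
    · obtain ⟨y, rfl⟩ := h.exists_of_notMem_range hx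
      exact ⟨α y, fun y' hy' ↦ congr(α $(h.eq_of_eq hy' (hy' ▸ hx))), fun d hd ↦ (hx ⟨d, hd⟩).elim⟩
  obtain ⟨R, v, hv, hxv, -⟩ := Scheme.exists_affine_mem_range_and_range_subset
    (show z ∈ (⊤ : Z.Opens) from trivial)
  let C : Set X := ν '' (α ⁻¹ᵁ v.opensRange : Set X')ᶜ ∪ j '' (β ⁻¹ᵁ v.opensRange : Set D)ᶜ
  have hC : IsClosed C := (ν.isClosedMap _ (α ⁻¹ᵁ v.opensRange).2.isClosed_compl).union
    (j.isClosedEmbedding.isClosedMap _ (β ⁻¹ᵁ v.opensRange).2.isClosed_compl)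
  have hxC : x ∉ C := by
    rintro (⟨y, hy, rfl⟩ | ⟨d, hd, rfl⟩)
    · exact hy (show α y ∈ Set.range v from hz₁ y rfl ▸ hxv)
    · exact hd (show β d ∈ Set.range v from hz₂ d rfl ▸ hxv)
  obtain ⟨c, hxc, hc⟩ := h.exists_chart_le x ⟨Cᶜ, hC.isOpen_compl⟩ hxC
  have e₁ : Set.range (c.a' ≫ α) ⊆ Set.range v := by
    rintro _ ⟨p, rfl⟩
    rw [Scheme.Hom.comp_apply]
    by_contra hp
    exact hc ⟨_, rfl⟩ (.inl ⟨c.a' p, hp, c.ν_a' p⟩)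
  have e₂ : Set.range (c.b ≫ β) ⊆ Set.range v := by
    rintro _ ⟨p, rfl⟩
    rw [Scheme.Hom.comp_apply]
    by_contra hp
    exact hc ⟨_, rfl⟩ (.inr ⟨c.b p, hp, c.j_b p⟩)
  obtain ⟨f, hf⟩ := Spec.map_surjective (IsOpenImmersion.lift v _ e₁)
  obtain ⟨g, hg⟩ := Spec.map_surjective (IsOpenImmersion.lift v _ e₂)
  have hf₁ : Spec.map f ≫ v = c.a' ≫ α := by rw [hf, IsOpenImmersion.lift_fac]
  have hg₁ : Spec.map g ≫ v = c.b ≫ β := by rw [hg, IsOpenImmersion.lift_fac]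
  obtain ⟨k, hk, hk'⟩ := c.exists_lift f g (by
    rw [← Spec.map_inj, ← cancel_mono v, Spec.map_comp, Spec.map_comp, Category.assoc,
      Category.assoc, hf₁, hg₁, ← Category.assoc, ← c.b'_comp_i, Category.assoc, hαβ,
      ← Category.assoc, c.b'_comp_q, Category.assoc])
  refine ⟨c, Spec.map k ≫ v, hxc, c.isDescRestriction α β _ ?_ ?_⟩
  · rw [← Spec.map_comp_assoc, hk, hf₁]
  · rw [← Spec.map_comp_assoc, hk', hg₁]

/-- A pinching square is a pushout square in the category of schemes. -/
theorem isPushout : IsPushout i q ν j := by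
  have hex (Z : Scheme.{u}) (α : X' ⟶ Z) (β : D ⟶ Z) (hαβ : i ≫ α = q ≫ β) :
      ∃ γ : X ⟶ Z, ν ≫ γ = α ∧ j ≫ γ = β := by
    choose c γ hx hγ using h.exists_desc_chart α β hαβ
    let 𝒰 := Scheme.openCoverOfPoints _ (fun x ↦ (c x).a) inferInstance hx
    let g : X ⟶ Z := 𝒰.glueMorphisms γ fun x y ↦ by
      refine h.desc_unique (pullback.fst (𝒰.f x) (𝒰.f y) ≫ 𝒰.f x) _ _ ((hγ x).comp _) ?_
      rw [pullback.condition]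
      exact (hγ y).comp _
    have hg (x : X) : (c x).a ≫ g = γ x := 𝒰.ι_glueMorphisms _ _ x
    refine ⟨g, ?_, ?_⟩
    · refine Scheme.hom_ext_of_forall_mem_range _ _ fun y ↦
        ⟨_, (c (ν y)).a', inferInstance, (c (ν y)).mem_range_a'.mpr (hx _), ?_⟩
      rw [reassoc_of% (c (ν y)).a'_comp, hg]
      exact (hγ _).1 _ _ _ (c (ν y)).a'_comp
    · refine Scheme.hom_ext_of_forall_mem_range _ _ fun y ↦
        ⟨_, (c (j y)).b, inferInstance, (c (j y)).mem_range_b.mpr (hx _), ?_⟩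
      rw [reassoc_of% (c (j y)).b_comp, hg]
      exact (hγ _).2 _ _ _ (c (j y)).b_comp
  choose γ hγ₁ hγ₂ using hex
  refine ⟨⟨h.w⟩, ⟨PushoutCocone.IsColimit.mk h.w (fun s ↦ γ s.pt s.inl s.inr s.condition)
    (fun s ↦ hγ₁ ..) (fun s ↦ hγ₂ ..) fun s m hm₁ hm₂ ↦ ?_⟩⟩
  have aux (g : X ⟶ s.pt) (h₁ : ν ≫ g = s.inl) (h₂ : j ≫ g = s.inr) :
      IsDescRestriction ν j s.inl s.inr (𝟙 X) g :=
    ⟨fun T t r h' ↦ by rw [← h₁, reassoc_of% h'],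
      fun T t r h' ↦ by rw [← h₂, reassoc_of% h']⟩
  exact h.desc_unique (𝟙 X) _ _ (aux m hm₁ hm₂) (aux _ (hγ₁ ..) (hγ₂ ..))

end Desc

end IsPinching

end

end AlgebraicGeometry

/-! ### Open subschemes of pinchings. -/

namespace AlgebraicGeometry

lemma preimage_opensRange_of_comp {X Y X₁ Y₁ Z Z' : Scheme.{u}} {f : Y ⟶ X} {f₁ : Y₁ ⟶ X₁}
    {a : X₁ ⟶ X} {a' : Y₁ ⟶ Y} [IsOpenImmersion a] [IsOpenImmersion a'] (w : a' ≫ f = f₁ ≫ a)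
    {c : Z ⟶ X} {c' : Z' ⟶ Y} {d : Z ⟶ X₁} {d' : Z' ⟶ Y₁}
    [IsOpenImmersion c] [IsOpenImmersion c'] [IsOpenImmersion d] [IsOpenImmersion d']
    (hd : d ≫ a = c) (hd' : d' ≫ a' = c')
    (h : f ⁻¹ᵁ c.opensRange = c'.opensRange) : f₁ ⁻¹ᵁ d.opensRange = d'.opensRange := by
  subst hd hd'
  ext z
  have h₁ : f₁ z ∈ Set.range d ↔ f (a' z) ∈ Set.range (d ≫ a) := by
    rw [Scheme.comp_eq_apply w, Scheme.Hom.comp_base, TopCat.coe_comp, Set.range_comp,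
      a.isOpenEmbedding.injective.mem_set_image]
  have h₂ : z ∈ Set.range d' ↔ a' z ∈ Set.range (d' ≫ a') := by
    rw [Scheme.Hom.comp_base, TopCat.coe_comp, Set.range_comp,
      a'.isOpenEmbedding.injective.mem_set_image]
  exact h₁.trans (Iff.trans (by rw [← Scheme.Hom.coe_opensRange, ← Scheme.Hom.coe_opensRange, ← h]; rfl) h₂.symm)

lemma opensRange_eq_preimage_of_comp {X Y Z : Scheme.{u}} {a : Y ⟶ X} {c : Z ⟶ X} {d : Z ⟶ Y}
    [IsOpenImmersion a] [IsOpenImmersion c] [IsOpenImmersion d] (h : d ≫ a = c) :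
    d.opensRange = a ⁻¹ᵁ c.opensRange := by
  subst h
  rw [Scheme.Hom.opensRange_comp, Scheme.Hom.preimage_image_eq]

/-- Morphisms defined on the members of an open cover glue if they agree locally on overlaps. -/
lemma Scheme.exists_glue {X Y : Scheme.{u}} {K : Type u} {U : K → Scheme.{u}} (t : ∀ k, U k ⟶ X)
    [∀ k, IsOpenImmersion (t k)] (hX : ∀ x : X, ∃ k, x ∈ Set.range (t k)) (γ : ∀ k, U k ⟶ Y)
    (H : ∀ k l (u : U k) (v : U l), t k u = t l v → ∃ (m : K) (r : U m ⟶ U k) (s : U m ⟶ U l),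
      r ≫ t k = t m ∧ s ≫ t l = t m ∧ r ≫ γ k = γ m ∧ s ≫ γ l = γ m ∧ u ∈ Set.range r) :
    ∃ g : X ⟶ Y, ∀ k, t k ≫ g = γ k := by
  let 𝒰 : X.OpenCover :=
    { I₀ := K
      X := U
      f := t
      mem₀ := by
        rw [Scheme.presieve₀_mem_precoverage_iff]
        exact ⟨fun x ↦ hX x, inferInstance⟩ }
  refine ⟨𝒰.glueMorphisms γ fun k l ↦ ?_, fun k ↦ 𝒰.ι_glueMorphisms _ _ k⟩
  refine Scheme.hom_ext_of_forall_mem_range _ _ fun z ↦ ?_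
  change (pullback (t k) (t l) :) at z
  obtain ⟨m, r, s, hr, hs, hr', hs', w, hw⟩ := H k l (pullback.fst (t k) (t l) z)
    (pullback.snd (t k) (t l) z) (Scheme.comp_eq_apply pullback.condition z)
  have : IsOpenImmersion (pullback.lift r s (hr.trans hs.symm) ≫ pullback.fst _ _ ≫ t k) := by
    rw [pullback.lift_fst_assoc, hr]; infer_instance
  have : IsOpenImmersion (pullback.lift r s (hr.trans hs.symm)) :=
    .of_comp _ (pullback.fst _ _ ≫ t k)
  refine ⟨U m, pullback.lift r s (hr.trans hs.symm), this, ⟨w, ?_⟩, ?_⟩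
  · refine (pullback.fst (t k) (t l)).isOpenEmbedding.injective ?_
    rw [← hw, ← Scheme.Hom.comp_apply, pullback.lift_fst]
  · change _ ≫ pullback.fst (t k) (t l) ≫ γ k = _ ≫ pullback.snd (t k) (t l) ≫ γ l
    rw [pullback.lift_fst_assoc, pullback.lift_snd_assoc, hr', hs']

/-- A fiber square of rings with surjective right column gives a pinching square of affine
schemes. -/
lemma IsFiberSquare.isPinching {A A' B B' : CommRingCat.{u}} {φ : A ⟶ A'} {ψ : A ⟶ B}
    {π : A' ⟶ B'} {ρ : B ⟶ B'} (h : IsFiberSquare φ.hom ψ.hom π.hom ρ.hom)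
    (hπ : Function.Surjective π.hom) (hρ : ρ.hom.IsIntegral) :
    IsPinching (Spec.map π) (Spec.map ρ) (Spec.map φ) (Spec.map ψ) where
  w := by
    rw [← Spec.map_comp, ← Spec.map_comp]
    congr 1; ext x; exact h.comm x
  exists_chart x := ⟨
    { φ := φ, ψ := ψ, π := π, ρ := ρ, isFiberSquare := h, surjective := hπ, isIntegral := hρ
      a := 𝟙 _, a' := 𝟙 _, b := 𝟙 _, b' := 𝟙 _
      a'_comp := by simp
      b_comp := by simp
      b'_comp_i := by simp
      b'_comp_q := by simp
      preimage_ν := by simp [Scheme.Hom.opensRange_of_isIso]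
      preimage_j := by simp [Scheme.Hom.opensRange_of_isIso]
      preimage_i := by simp [Scheme.Hom.opensRange_of_isIso] }, x, rfl⟩

section

variable {X' D' D X : Scheme.{u}} {i : D' ⟶ X'} {q : D' ⟶ D} {ν : X' ⟶ X} {j : D ⟶ X}

namespace IsPinching

variable (h : IsPinching i q ν j)

include h

/-- Compatible open subsets of the two upper schemes descend to the lower right corner. -/
lemma exists_opens (U : X'.Opens) (W : D.Opens) (hUW : i ⁻¹ᵁ U = q ⁻¹ᵁ W) :
    ∃ V : X.Opens, ν ⁻¹ᵁ V = U ∧ j ⁻¹ᵁ V = W := by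
  have := h.isIntegralHom
  have := h.isClosedImmersion
  have hw (e : D') : ν (i e) = j (q e) := Scheme.comp_eq_apply h.w e
  have hiff (e : D') : i e ∈ U ↔ q e ∈ W := by
    change e ∈ i ⁻¹ᵁ U ↔ e ∈ q ⁻¹ᵁ W
    rw [hUW]
  -- Both images are closed. The preimages are as required because points of `X'` over `D` come from
  -- `D'`, where `U` and `W` induce the same open subset.
  refine ⟨⟨(ν '' (U : Set X')ᶜ ∪ j '' (W : Set D)ᶜ)ᶜ,
    ((ν.isClosedMap _ U.2.isClosed_compl).union
      (j.isClosedEmbedding.isClosedMap _ W.2.isClosed_compl)).isOpen_compl⟩, ?_, ?_⟩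
  · ext y
    change ¬ (ν y ∈ _) ↔ y ∈ U
    constructor
    · intro hy
      by_contra hyU
      exact hy (.inl ⟨y, hyU, rfl⟩)
    · rintro hy (⟨z, hz, hzy⟩ | ⟨d, hd, hdy⟩)
      · by_cases hyj : ν y ∈ Set.range j
        · obtain ⟨d, hd⟩ := hyj
          obtain ⟨e, rfl, rfl⟩ := h.exists_eq_of_eq hd.symm
          obtain ⟨e', rfl, he'⟩ := h.exists_eq_of_eq (hzy.trans hd.symm)
          exact hz ((hiff e').mpr (he' ▸ (hiff e).mp hy))
        · exact hz (h.eq_of_eq hzy.symm hyj ▸ hy)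
      · obtain ⟨e, rfl, rfl⟩ := h.exists_eq_of_eq hdy.symm
        exact hd ((hiff e).mp hy)
  · ext d
    change ¬ (j d ∈ _) ↔ d ∈ W
    constructor
    · intro hy
      by_contra hyU
      exact hy (.inr ⟨d, hyU, rfl⟩)
    · rintro hd (⟨z, hz, hzy⟩ | ⟨d', hd', hdy⟩)
      · obtain ⟨e, rfl, rfl⟩ := h.exists_eq_of_eq hzy
        exact hz ((hiff e).mpr hd)
      · exact hd' (j.isClosedEmbedding.injective hdy ▸ hd)

lemma opens_ext {V V' : X.Opens} (h₁ : ν ⁻¹ᵁ V = ν ⁻¹ᵁ V') (h₂ : j ⁻¹ᵁ V = j ⁻¹ᵁ V') : V = V' := by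
  ext x
  refine h.forall_point (P := fun x ↦ x ∈ V ↔ x ∈ V') (fun y ↦ ?_) (fun d ↦ ?_) x
  · change y ∈ ν ⁻¹ᵁ V ↔ y ∈ ν ⁻¹ᵁ V'
    rw [h₁]
  · change d ∈ j ⁻¹ᵁ V ↔ d ∈ j ⁻¹ᵁ V'
    rw [h₂]

/-- The restriction of a pinching square to an open subscheme of the lower right corner. -/
lemma restrict {X₁' D₁' D₁ X₁ : Scheme.{u}} {i₁ : D₁' ⟶ X₁'} {q₁ : D₁' ⟶ D₁} {ν₁ : X₁' ⟶ X₁}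
    {j₁ : D₁ ⟶ X₁} {a : X₁ ⟶ X} {a' : X₁' ⟶ X'} {b : D₁ ⟶ D} {b' : D₁' ⟶ D'}
    [IsOpenImmersion a] [IsOpenImmersion a'] [IsOpenImmersion b] [IsOpenImmersion b']
    (hν : a' ≫ ν = ν₁ ≫ a) (hj : b ≫ j = j₁ ≫ a) (hi : b' ≫ i = i₁ ≫ a') (hq : b' ≫ q = q₁ ≫ b)
    (hν' : ν ⁻¹ᵁ a.opensRange = a'.opensRange) (hj' : j ⁻¹ᵁ a.opensRange = b.opensRange)
    (hi' : i ⁻¹ᵁ a'.opensRange = b'.opensRange) : IsPinching i₁ q₁ ν₁ j₁ where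
  w := by
    rw [← cancel_mono a, Category.assoc, Category.assoc, ← hν, ← hj, ← reassoc_of% hi,
      ← reassoc_of% hq, h.w]
  exists_chart x := by
    obtain ⟨c, ⟨p, hp⟩, hc⟩ := h.exists_chart_le (a x) a.opensRange ⟨x, rfl⟩
    have hca : Set.range c.a ⊆ Set.range a := hc
    have hca' : Set.range c.a' ⊆ Set.range a' := by
      intro y hy
      rw [← Scheme.Hom.coe_opensRange a', ← hν']
      exact hca (c.mem_range_a'.mp hy)
    have hcb : Set.range c.b ⊆ Set.range b := by
      intro y hy
      rw [← Scheme.Hom.coe_opensRange b, ← hj']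
      exact hca (c.mem_range_b.mp hy)
    have hcb' : Set.range c.b' ⊆ Set.range b' := by
      rintro _ ⟨y, rfl⟩
      rw [← Scheme.Hom.coe_opensRange b', ← hi']
      refine hca' ⟨Spec.map c.π y, (Scheme.comp_eq_apply c.b'_comp_i y).symm⟩
    refine ⟨
      { φ := c.φ, ψ := c.ψ, π := c.π, ρ := c.ρ, isFiberSquare := c.isFiberSquare
        surjective := c.surjective, isIntegral := c.isIntegral
        a := IsOpenImmersion.lift a c.a hca
        a' := IsOpenImmersion.lift a' c.a' hca'
        b := IsOpenImmersion.lift b c.b hcb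
        b' := IsOpenImmersion.lift b' c.b' hcb'
        a'_comp := by
          rw [← cancel_mono a, Category.assoc, ← hν, IsOpenImmersion.lift_fac_assoc, Category.assoc,
            IsOpenImmersion.lift_fac, c.a'_comp]
        b_comp := by
          rw [← cancel_mono a, Category.assoc, ← hj, IsOpenImmersion.lift_fac_assoc, Category.assoc,
            IsOpenImmersion.lift_fac, c.b_comp]
        b'_comp_i := by
          rw [← cancel_mono a', Category.assoc, ← hi, IsOpenImmersion.lift_fac_assoc,
            Category.assoc, IsOpenImmersion.lift_fac, c.b'_comp_i]
        b'_comp_q := by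
          rw [← cancel_mono b, Category.assoc, ← hq, IsOpenImmersion.lift_fac_assoc,
            Category.assoc, IsOpenImmersion.lift_fac, c.b'_comp_q]
        preimage_ν := preimage_opensRange_of_comp hν (IsOpenImmersion.lift_fac ..)
          (IsOpenImmersion.lift_fac ..) c.preimage_ν
        preimage_j := preimage_opensRange_of_comp hj (IsOpenImmersion.lift_fac ..)
          (IsOpenImmersion.lift_fac ..) c.preimage_j
        preimage_i := preimage_opensRange_of_comp hi (IsOpenImmersion.lift_fac ..)
          (IsOpenImmersion.lift_fac ..) c.preimage_i }, p, a.isOpenEmbedding.injective ?_⟩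
    exact (Scheme.comp_eq_apply (f' := 𝟙 _) (g' := c.a) (by simp) p).trans hp

/-- A morphism of pinching squares which is an open immersion on the upper schemes is an
open immersion. -/
lemma isOpenImmersion {X₁' D₁' D₁ X₁ : Scheme.{u}} {i₁ : D₁' ⟶ X₁'} {q₁ : D₁' ⟶ D₁}
    {ν₁ : X₁' ⟶ X₁} {j₁ : D₁ ⟶ X₁} (h₁ : IsPinching i₁ q₁ ν₁ j₁)
    {a : X₁ ⟶ X} {a' : X₁' ⟶ X'} {b : D₁ ⟶ D} {b' : D₁' ⟶ D'}
    [IsOpenImmersion a'] [IsOpenImmersion b] [IsOpenImmersion b']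
    (hν : a' ≫ ν = ν₁ ≫ a) (hj : b ≫ j = j₁ ≫ a) (hi : b' ≫ i = i₁ ≫ a') (hq : b' ≫ q = q₁ ≫ b)
    (hi' : i ⁻¹ᵁ a'.opensRange = b'.opensRange) (hq' : q ⁻¹ᵁ b.opensRange = b'.opensRange) :
    ∃ _ : IsOpenImmersion a, ν ⁻¹ᵁ a.opensRange = a'.opensRange ∧
      j ⁻¹ᵁ a.opensRange = b.opensRange := by
  -- The open subset descends to some `V`; then `X₁` and `V` are both pushouts of the same diagram,
  -- which identifies `a` with the inclusion of `V`.
  obtain ⟨V, hVν, hVj⟩ := h.exists_opens _ _ (hi'.trans hq'.symm)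
  have e₁ : Set.range (a' ≫ ν) ⊆ Set.range V.ι := by
    rw [Scheme.Opens.range_ι]
    rintro _ ⟨y, rfl⟩
    rw [Scheme.Hom.comp_apply]
    exact (hVν.ge ⟨y, rfl⟩ : a' y ∈ ν ⁻¹ᵁ V)
  have e₂ : Set.range (b ≫ j) ⊆ Set.range V.ι := by
    rw [Scheme.Opens.range_ι]
    rintro _ ⟨y, rfl⟩
    rw [Scheme.Hom.comp_apply]
    exact (hVj.ge ⟨y, rfl⟩ : b y ∈ j ⁻¹ᵁ V)
  have h₂ : IsPinching i₁ q₁ (IsOpenImmersion.lift V.ι _ e₁) (IsOpenImmersion.lift V.ι _ e₂) :=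
    h.restrict (a := V.ι) (a' := a') (b := b) (b' := b') (IsOpenImmersion.lift_fac ..).symm
      (IsOpenImmersion.lift_fac ..).symm hi hq (by simpa using hVν) (by simpa using hVj) hi'
  let e : X₁ ≅ V.toScheme := h₁.isPushout.isoIsPushout _ _ h₂.isPushout
  have he : a = e.hom ≫ V.ι := by
    refine h₁.isPushout.hom_ext ?_ ?_
    · rw [h₁.isPushout.inl_isoIsPushout_hom_assoc, ← hν, IsOpenImmersion.lift_fac]
    · rw [h₁.isPushout.inr_isoIsPushout_hom_assoc, ← hj, IsOpenImmersion.lift_fac]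
  subst he
  have : (e.hom ≫ V.ι).opensRange = V := by
    rw [Scheme.Hom.opensRange_comp_of_isIso, Scheme.Opens.opensRange_ι]
  exact ⟨inferInstance, by rw [this, hVν], by rw [this, hVj]⟩

end IsPinching

end

end AlgebraicGeometry

/-! ### Affine pairs and their rings. -/

namespace AlgebraicGeometry

section

variable {X' D' D : Scheme.{u}}

/-- A pair of affine open subsets of `X'` and `D` with the same preimage in `D'`. -/
structure AffinePair (i : D' ⟶ X') (q : D' ⟶ D) where
  U : X'.Opens
  W : D.Opens
  hU : IsAffineOpen U
  hW : IsAffineOpen W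
  preimage_eq : i ⁻¹ᵁ U = q ⁻¹ᵁ W

namespace AffinePair

variable {i : D' ⟶ X'} {q : D' ⟶ D}

instance : Preorder (AffinePair i q) :=
  Preorder.lift fun P ↦ (P.U, P.W)

variable (P Q : AffinePair i q)

/-- The restriction to the closed subscheme. -/
noncomputable def π : Γ(X', P.U) ⟶ Γ(D', i ⁻¹ᵁ P.U) := i.app P.U

/-- The pullback of functions along the finite map. -/
noncomputable def ρ : Γ(D, P.W) ⟶ Γ(D', i ⁻¹ᵁ P.U) := q.appLE P.W (i ⁻¹ᵁ P.U) P.preimage_eq.le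

/-- The ring of pairs of functions agreeing on `D'`. -/
noncomputable def ring : CommRingCat.{u} :=
  .of (RingHom.eqLocus (P.π.hom.comp (RingHom.fst Γ(X', P.U) Γ(D, P.W)))
    (P.ρ.hom.comp (RingHom.snd Γ(X', P.U) Γ(D, P.W))))

/-- The first projection. -/
noncomputable def φ : P.ring ⟶ Γ(X', P.U) :=
  CommRingCat.ofHom ((RingHom.fst _ _).comp (Subring.subtype _))

/-- The second projection. -/
noncomputable def ψ : P.ring ⟶ Γ(D, P.W) :=
  CommRingCat.ofHom ((RingHom.snd _ _).comp (Subring.subtype _))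

lemma isFiberSquare : IsFiberSquare P.φ.hom P.ψ.hom P.π.hom P.ρ.hom where
  comm a := a.2
  eq_zero _ h₁ h₂ := Subtype.ext (Prod.ext h₁ h₂)
  exists_lift a' b h := ⟨⟨(a', b), h⟩, rfl, rfl⟩

lemma map_π {P Q : AffinePair i q} (h : P ≤ Q) : X'.presheaf.map (homOfLE h.1).op ≫ P.π =
    Q.π ≫ D'.presheaf.map (homOfLE (i.preimage_mono h.1)).op := by
  simp only [π, ← i.appLE_eq_app, Scheme.Hom.map_appLE, Scheme.Hom.appLE_map]

lemma map_ρ {P Q : AffinePair i q} (h : P ≤ Q) : D.presheaf.map (homOfLE h.2).op ≫ P.ρ =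
    Q.ρ ≫ D'.presheaf.map (homOfLE (i.preimage_mono h.1)).op := by
  simp only [ρ, Scheme.Hom.map_appLE, Scheme.Hom.appLE_map]

variable {P Q} in
/-- Restriction of pairs of functions. -/
noncomputable def res (h : P ≤ Q) : Q.ring ⟶ P.ring :=
  CommRingCat.ofHom <| RingHom.codRestrict
    ((((X'.presheaf.map (homOfLE h.1).op).hom.comp Q.φ.hom)).prod
      ((D.presheaf.map (homOfLE h.2).op).hom.comp Q.ψ.hom)) _ fun x ↦ by
    change P.π.hom ((X'.presheaf.map (homOfLE h.1).op).hom (Q.φ.hom x)) =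
      P.ρ.hom ((D.presheaf.map (homOfLE h.2).op).hom (Q.ψ.hom x))
    exact congr(($(map_π h)).hom (Q.φ.hom x)).trans (congr((D'.presheaf.map _).hom
      $(Q.isFiberSquare.comm x)).trans congr(($(map_ρ h)).hom (Q.ψ.hom x)).symm)

lemma res_φ {P Q : AffinePair i q} (h : P ≤ Q) :
    res h ≫ P.φ = Q.φ ≫ X'.presheaf.map (homOfLE h.1).op := rfl

lemma res_ψ {P Q : AffinePair i q} (h : P ≤ Q) :
    res h ≫ P.ψ = Q.ψ ≫ D.presheaf.map (homOfLE h.2).op := rfl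

lemma hom_ext {R : CommRingCat.{u}} {f g : R ⟶ P.ring} (h₁ : f ≫ P.φ = g ≫ P.φ)
    (h₂ : f ≫ P.ψ = g ≫ P.ψ) : f = g := by
  ext x
  exact P.isFiberSquare.ext congr(($h₁) x) congr(($h₂) x)

lemma π_surjective [IsClosedImmersion i] : Function.Surjective P.π.hom :=
  i.app_surjective P.U P.hU

lemma ρ_isIntegral [IsIntegralHom q] : P.ρ.hom.IsIntegral := by
  have : P.ρ = q.app P.W ≫ D'.presheaf.map (eqToHom P.preimage_eq).op := by
    rw [ρ, ← q.appLE_eq_app, Scheme.Hom.appLE_map]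
  rw [this, CommRingCat.hom_comp]
  refine RingHom.IsIntegral.trans _ _ (q.isIntegral_app P.W P.hW) ?_
  exact RingHom.isIntegral_of_surjective _
    (ConcreteCategory.bijective_of_isIso (D'.presheaf.map (eqToHom P.preimage_eq).op)).2

/-- The open immersion onto the first open subset. -/
noncomputable def a' : Spec Γ(X', P.U) ⟶ X' := P.hU.fromSpec

/-- The open immersion onto the second open subset. -/
noncomputable def b : Spec Γ(D, P.W) ⟶ D := P.hW.fromSpec

variable [IsClosedImmersion i] [IsIntegralHom q]

omit [IsIntegralHom q] in
lemma hU' : IsAffineOpen (i ⁻¹ᵁ P.U) := P.hU.preimage i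

/-- The open immersion onto the common preimage. -/
noncomputable def b' : Spec Γ(D', i ⁻¹ᵁ P.U) ⟶ D' := P.hU'.fromSpec

instance : IsOpenImmersion P.a' := inferInstanceAs (IsOpenImmersion P.hU.fromSpec)
instance : IsOpenImmersion P.b := inferInstanceAs (IsOpenImmersion P.hW.fromSpec)
instance : IsOpenImmersion P.b' := inferInstanceAs (IsOpenImmersion P.hU'.fromSpec)

omit [IsClosedImmersion i] [IsIntegralHom q] in
lemma opensRange_a' : P.a'.opensRange = P.U := P.hU.opensRange_fromSpec
omit [IsClosedImmersion i] [IsIntegralHom q] in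
lemma opensRange_b : P.b.opensRange = P.W := P.hW.opensRange_fromSpec
omit [IsIntegralHom q] in
lemma opensRange_b' : P.b'.opensRange = i ⁻¹ᵁ P.U := P.hU'.opensRange_fromSpec

omit [IsIntegralHom q] in
lemma b'_comp_i : P.b' ≫ i = Spec.map P.π ≫ P.a' := by
  rw [π, ← i.appLE_eq_app]
  exact (IsAffineOpen.SpecMap_appLE_fromSpec i P.hU P.hU' le_rfl).symm

omit [IsIntegralHom q] in
lemma b'_comp_q : P.b' ≫ q = Spec.map P.ρ ≫ P.b :=
  (IsAffineOpen.SpecMap_appLE_fromSpec q P.hW P.hU' P.preimage_eq.le).symm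

lemma isPinching : IsPinching (Spec.map P.π) (Spec.map P.ρ) (Spec.map P.φ) (Spec.map P.ψ) :=
  P.isFiberSquare.isPinching P.π_surjective P.ρ_isIntegral

variable {P Q}

omit [IsClosedImmersion i] [IsIntegralHom q] in
lemma map_a' (h : P ≤ Q) : Spec.map (X'.presheaf.map (homOfLE h.1).op) ≫ Q.a' = P.a' :=
  Q.hU.map_fromSpec P.hU _

omit [IsClosedImmersion i] [IsIntegralHom q] in
lemma map_b (h : P ≤ Q) : Spec.map (D.presheaf.map (homOfLE h.2).op) ≫ Q.b = P.b :=
  Q.hW.map_fromSpec P.hW _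

omit [IsIntegralHom q] in
lemma map_b' (h : P ≤ Q) :
    Spec.map (D'.presheaf.map (homOfLE (i.preimage_mono h.1)).op) ≫ Q.b' = P.b' :=
  Q.hU'.map_fromSpec P.hU' _

/-- Restriction is a morphism of pinching squares which is open on the three upper corners, so
`IsPinching.isOpenImmersion` applies. The two preimages are recorded because they decide when one
chart lies inside another. -/
lemma res_isOpenImmersion (h : P ≤ Q) : ∃ _ : IsOpenImmersion (Spec.map (res h)),
    Spec.map Q.φ ⁻¹ᵁ (Spec.map (res h)).opensRange = Q.a' ⁻¹ᵁ P.U ∧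
    Spec.map Q.ψ ⁻¹ᵁ (Spec.map (res h)).opensRange = Q.b ⁻¹ᵁ P.W := by
  have e₁ : IsOpenImmersion (Spec.map (X'.presheaf.map (homOfLE h.1).op)) :=
    have : IsOpenImmersion (Spec.map (X'.presheaf.map (homOfLE h.1).op) ≫ Q.a') := by
      rw [map_a' h]; infer_instance
    .of_comp _ Q.a'
  have e₂ : IsOpenImmersion (Spec.map (D.presheaf.map (homOfLE h.2).op)) :=
    have : IsOpenImmersion (Spec.map (D.presheaf.map (homOfLE h.2).op) ≫ Q.b) := by
      rw [map_b h]; infer_instance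
    .of_comp _ Q.b
  have e₃ : IsOpenImmersion (Spec.map (D'.presheaf.map (homOfLE (i.preimage_mono h.1)).op)) :=
    have : IsOpenImmersion (Spec.map (D'.presheaf.map (homOfLE
        (i.preimage_mono h.1)).op) ≫ Q.b') := by
      rw [map_b' h]; infer_instance
    .of_comp _ Q.b'
  have r₁ : (Spec.map (X'.presheaf.map (homOfLE h.1).op)).opensRange = Q.a' ⁻¹ᵁ P.U := by
    rw [opensRange_eq_preimage_of_comp (map_a' h), opensRange_a']
  have r₂ : (Spec.map (D.presheaf.map (homOfLE h.2).op)).opensRange = Q.b ⁻¹ᵁ P.W := by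
    rw [opensRange_eq_preimage_of_comp (map_b h), opensRange_b]
  have r₃ : (Spec.map (D'.presheaf.map (homOfLE (i.preimage_mono h.1)).op)).opensRange =
      Q.b' ⁻¹ᵁ i ⁻¹ᵁ P.U := by
    rw [opensRange_eq_preimage_of_comp (map_b' h), opensRange_b']
  have := Q.isPinching.isOpenImmersion P.isPinching (a := Spec.map (res h))
    (a' := Spec.map (X'.presheaf.map (homOfLE h.1).op))
    (b := Spec.map (D.presheaf.map (homOfLE h.2).op))
    (b' := Spec.map (D'.presheaf.map (homOfLE (i.preimage_mono h.1)).op))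
    (by rw [← Spec.map_comp, ← Spec.map_comp, res_φ]) (by rw [← Spec.map_comp, ← Spec.map_comp, res_ψ])
    (by rw [← Spec.map_comp, ← Spec.map_comp, map_π h])
    (by rw [← Spec.map_comp, ← Spec.map_comp, map_ρ h])
    (by rw [r₁, r₃, ← Scheme.Hom.comp_preimage, ← Scheme.Hom.comp_preimage, b'_comp_i])
    (by rw [r₂, r₃, P.preimage_eq, ← Scheme.Hom.comp_preimage, ← Scheme.Hom.comp_preimage, b'_comp_q])
  rwa [r₁, r₂] at this

instance (h : P ≤ Q) : IsOpenImmersion (Spec.map (res h)) := (res_isOpenImmersion h).1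

lemma preimage_φ (h : P ≤ Q) : Spec.map Q.φ ⁻¹ᵁ (Spec.map (res h)).opensRange = Q.a' ⁻¹ᵁ P.U :=
  (res_isOpenImmersion h).2.1

lemma preimage_ψ (h : P ≤ Q) : Spec.map Q.ψ ⁻¹ᵁ (Spec.map (res h)).opensRange = Q.b ⁻¹ᵁ P.W :=
  (res_isOpenImmersion h).2.2

/-- Translates inclusions of open subsets of a chart into the order on affine pairs, as needed for
common refinements. -/
lemma le_of_opensRange_le {L : AffinePair i q} (hL : L ≤ Q) {U : X'.Opens} {W : D.Opens}
    {V : (Spec Q.ring).Opens} (hV : Spec.map Q.φ ⁻¹ᵁ V ≤ Q.a' ⁻¹ᵁ U) (hV' : Spec.map Q.ψ ⁻¹ᵁ V ≤ Q.b ⁻¹ᵁ W)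
    (hLV : (Spec.map (res hL)).opensRange ≤ V) : L.U ≤ U ∧ L.W ≤ W := by
  constructor
  · intro x hx
    obtain ⟨y, rfl⟩ : x ∈ Q.a'.opensRange := by rw [opensRange_a']; exact hL.1 hx
    have h₁ : y ∈ Q.a' ⁻¹ᵁ L.U := hx
    rw [← preimage_φ hL] at h₁
    exact hV (hLV h₁)
  · intro x hx
    obtain ⟨y, rfl⟩ : x ∈ Q.b.opensRange := by rw [opensRange_b]; exact hL.2 hx
    have h₁ : y ∈ Q.b ⁻¹ᵁ L.W := hx
    rw [← preimage_ψ hL] at h₁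
    exact hV' (hLV h₁)

/-- The two components of `g` agree on `D'`, so their basic opens form an affine pair, whose chart
is the basic open of `g`. -/
lemma exists_le (Q : AffinePair i q) (V : (Spec Q.ring).Opens) (x : Spec Q.ring) (hx : x ∈ V) :
    ∃ (L : AffinePair i q) (hL : L ≤ Q), x ∈ (Spec.map (res hL)).opensRange ∧
      (Spec.map (res hL)).opensRange ≤ V := by
  obtain ⟨-, ⟨-, ⟨g, rfl⟩, rfl⟩, hxg, hg⟩ :=
    PrimeSpectrum.isBasis_basic_opens.exists_subset_of_mem_open
    (show x ∈ ((V : (Spec Q.ring).Opens) : Set (Spec Q.ring)) from hx) V.2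
  let L : AffinePair i q :=
    { U := X'.basicOpen (Q.φ.hom g)
      W := D.basicOpen (Q.ψ.hom g)
      hU := Q.hU.basicOpen _
      hW := Q.hW.basicOpen _
      preimage_eq := by
        have e₁ : i ⁻¹ᵁ X'.basicOpen (Q.φ.hom g) = D'.basicOpen (Q.π.hom (Q.φ.hom g)) :=
          Scheme.preimage_basicOpen i _
        have e₂ : D'.basicOpen (Q.ρ.hom (Q.ψ.hom g)) = i ⁻¹ᵁ Q.U ⊓ q ⁻¹ᵁ D.basicOpen (Q.ψ.hom g) :=
          Scheme.basicOpen_appLE ..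
        rw [e₁, Q.isFiberSquare.comm, e₂, Q.preimage_eq, inf_eq_right]
        exact q.preimage_mono (D.basicOpen_le _) }
  have hL : L ≤ Q := ⟨X'.basicOpen_le _, D.basicOpen_le _⟩
  have : (Spec.map (res hL)).opensRange = PrimeSpectrum.basicOpen g := by
    refine Q.isPinching.opens_ext ?_ ?_
    · rw [preimage_φ]
      exact Q.hU.fromSpec_preimage_basicOpen _
    · rw [preimage_ψ]
      exact Q.hW.fromSpec_preimage_basicOpen _
  exact ⟨L, hL, this ▸ hxg, this ▸ hg⟩

end AffinePair

end

end AlgebraicGeometry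

/-! ### Existence of pinchings by gluing affine pairs. -/

namespace AlgebraicGeometry

/-- Prime avoidance: the ideal of the complement of `O` lies in no prime of `s`, hence not in their
union. -/
lemma _root_.PrimeSpectrum.exists_basicOpen_of_finite {R : Type*} [CommRing R]
    {s : Set (PrimeSpectrum R)} (hs : s.Finite) {O : Set (PrimeSpectrum R)} (hO : IsOpen O)
    (hsO : s ⊆ O) : ∃ h : R, s ⊆ PrimeSpectrum.basicOpen h ∧
      (PrimeSpectrum.basicOpen h : Set (PrimeSpectrum R)) ⊆ O := by
  obtain rfl | ⟨p₀, -⟩ := s.eq_empty_or_nonempty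
  · exact ⟨0, by simp⟩
  obtain ⟨I, hI⟩ := (PrimeSpectrum.isClosed_iff_zeroLocus_ideal Oᶜ).mp hO.isClosed_compl
  have := (Ideal.subset_union_prime_finite hs (f := fun p : PrimeSpectrum R ↦ p.asIdeal) p₀ p₀
    (fun p _ _ _ ↦ p.isPrime) (I := I)).not.mpr (by
      rintro ⟨p, hp, hIp⟩
      have : p ∈ Oᶜ := by rw [hI]; exact hIp
      exact this (hsO hp))
  obtain ⟨h, hh, hh'⟩ := Set.not_subset.mp this
  refine ⟨h, fun p hp hhp ↦ hh' (Set.mem_biUnion hp hhp), fun p hp ↦ ?_⟩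
  by_contra hpO
  have : p ∈ PrimeSpectrum.zeroLocus I := by rw [← hI]; exact hpO
  exact hp (this hh)

lemma IsAffineOpen.exists_basicOpen_of_finite {X : Scheme.{u}} {U : X.Opens} (hU : IsAffineOpen U)
    {s : Set X} (hs : s.Finite) (hsU : s ⊆ U) (O : X.Opens) (hsO : s ⊆ O) :
    ∃ h : Γ(X, U), s ⊆ X.basicOpen h ∧ X.basicOpen h ≤ O := by
  obtain ⟨h, h₁, h₂⟩ := PrimeSpectrum.exists_basicOpen_of_finite
    (hs.preimage hU.fromSpec.isOpenEmbedding.injective.injOn) (hU.fromSpec ⁻¹ᵁ O).2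
    (fun x hx ↦ hsO hx)
  have key (y) : hU.fromSpec y ∈ X.basicOpen h ↔ y ∈ PrimeSpectrum.basicOpen h := by
    rw [← hU.fromSpec_preimage_basicOpen]; rfl
  have hr {x : X} (hx : x ∈ U) : ∃ y, hU.fromSpec y = x := by
    rwa [← SetLike.mem_coe, ← hU.range_fromSpec] at hx
  refine ⟨h, fun x hx ↦ ?_, fun x hx ↦ ?_⟩
  · obtain ⟨y, rfl⟩ := hr (hsU hx)
    exact (key y).mpr (h₁ hx)
  · obtain ⟨y, rfl⟩ := hr (X.basicOpen_le _ hx)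
    exact h₂ ((key y).mp hx)

namespace AffinePair

variable {X' D' D : Scheme.{u}} {i : D' ⟶ X'} {q : D' ⟶ D}

/-- The diagram of the spectra of the rings of pairs of functions agreeing on `D'`. -/
noncomputable def diagram (i : D' ⟶ X') (q : D' ⟶ D) : AffinePair i q ⥤ Scheme.{u} where
  obj P := Spec P.ring
  map f := Spec.map (res (leOfHom f))
  map_id P := by
    rw [← Spec.map_id, Spec.map_inj]
    refine P.hom_ext ?_ ?_
    · rw [res_φ, Category.id_comp]
      convert Category.comp_id _
      exact X'.presheaf.map_id _
    · rw [res_ψ, Category.id_comp]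
      convert Category.comp_id _
      exact D.presheaf.map_id _
  map_comp {P Q R} f g := by
    rw [← Spec.map_comp, Spec.map_inj]
    refine P.hom_ext ?_ ?_
    · rw [res_φ, Category.assoc, res_φ, ← Category.assoc, res_φ, Category.assoc, ← Functor.map_comp]
      rfl
    · rw [res_ψ, Category.assoc, res_ψ, ← Category.assoc, res_ψ, Category.assoc, ← Functor.map_comp]
      rfl

variable [IsClosedImmersion i] [IsIntegralHom q]

instance {P Q : AffinePair i q} (f : P ⟶ Q) : IsOpenImmersion ((diagram i q).map f) :=
  inferInstanceAs (IsOpenImmersion (Spec.map (res (leOfHom f))))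

/-- Inside a larger chart, overlaps are covered by smaller charts. This local directedness makes the
colimit of the diagram a gluing along open immersions. -/
lemma exists_le_of_eq {P Q R : AffinePair i q} (hP : P ≤ R) (hQ : Q ≤ R) (x : Spec P.ring)
    (y : Spec Q.ring) (hxy : Spec.map (res hP) x = Spec.map (res hQ) y) :
    ∃ (L : AffinePair i q) (hLP : L ≤ P) (hLQ : L ≤ Q) (z : Spec L.ring),
      Spec.map (res hLP) z = x ∧ Spec.map (res hLQ) z = y := by
  obtain ⟨L, hL, ⟨z, hz⟩, hLV⟩ := exists_le R
    ((Spec.map (res hP)).opensRange ⊓ (Spec.map (res hQ)).opensRange) _ ⟨⟨x, rfl⟩, ⟨y, hxy.symm⟩⟩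
  have hLP : L ≤ P := le_of_opensRange_le hL (preimage_φ hP).le (preimage_ψ hP).le
    (hLV.trans inf_le_left)
  have hLQ : L ≤ Q := le_of_opensRange_le hL (preimage_φ hQ).le (preimage_ψ hQ).le
    (hLV.trans inf_le_right)
  have e₁ : Spec.map (res hLP) ≫ Spec.map (res hP) = Spec.map (res hL) :=
    ((diagram i q).map_comp (homOfLE hLP) (homOfLE hP)).symm
  have e₂ : Spec.map (res hLQ) ≫ Spec.map (res hQ) = Spec.map (res hL) :=
    ((diagram i q).map_comp (homOfLE hLQ) (homOfLE hQ)).symm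
  refine ⟨L, hLP, hLQ, z, (Spec.map (res hP)).isOpenEmbedding.injective ?_,
    (Spec.map (res hQ)).isOpenEmbedding.injective ?_⟩
  · rw [← Scheme.Hom.comp_apply, e₁, hz]
  · rw [← Scheme.Hom.comp_apply, e₂, hz, hxy]

instance : (diagram i q ⋙ Scheme.forget).IsLocallyDirected where
  cond {P Q R} f g x y h := by
    obtain ⟨L, hP, hQ, z, h₁, h₂⟩ := exists_le_of_eq (leOfHom f) (leOfHom g) x y h
    exact ⟨L, homOfLE hP, homOfLE hQ, z, h₁, h₂⟩

variable (i q) in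
/-- The scheme obtained from `X'` by pinching `D'` to `D`. -/
noncomputable def glued : Scheme.{u} := colimit (diagram i q)

/-- The charts of the pinched scheme. -/
noncomputable def ι (P : AffinePair i q) : Spec P.ring ⟶ glued i q := colimit.ι (diagram i q) P

instance (P : AffinePair i q) : IsOpenImmersion P.ι :=
  inferInstanceAs (IsOpenImmersion (colimit.ι (diagram i q) P))

lemma res_ι {P Q : AffinePair i q} (h : P ≤ Q) : Spec.map (res h) ≫ Q.ι = P.ι :=
  colimit.w (diagram i q) (homOfLE h)

lemma exists_of_ι_eq {P Q : AffinePair i q} {x : Spec P.ring} {y : Spec Q.ring}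
    (h : P.ι x = Q.ι y) : ∃ (L : AffinePair i q) (hP : L ≤ P) (hQ : L ≤ Q) (z : Spec L.ring),
      Spec.map (res hP) z = x ∧ Spec.map (res hQ) z = y := by
  obtain ⟨L, f, g, z, h₁, h₂⟩ := (Scheme.IsLocallyDirected.ι_eq_ι_iff (diagram i q)).mp h
  exact ⟨L, leOfHom f, leOfHom g, z, h₁, h₂⟩

lemma exists_ι_eq (x : glued i q) : ∃ (P : AffinePair i q) (y : Spec P.ring), P.ι y = x :=
  Scheme.IsLocallyDirected.ι_jointly_surjective (diagram i q) x

/-- The intersection of two affine pairs need not consist of affine opens. It still descends to an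
open subset of the chart, and that is covered by smaller pairs. -/
lemma exists_le_of_opens (P : AffinePair i q) (U : X'.Opens) (W : D.Opens)
    (hUW : i ⁻¹ᵁ U = q ⁻¹ᵁ W) : ∃ V : (Spec P.ring).Opens, Spec.map P.φ ⁻¹ᵁ V = P.a' ⁻¹ᵁ U ∧
      Spec.map P.ψ ⁻¹ᵁ V = P.b ⁻¹ᵁ W ∧ ∀ x ∈ V, ∃ (L : AffinePair i q) (hL : L ≤ P), L.U ≤ U ∧
        L.W ≤ W ∧ x ∈ (Spec.map (res hL)).opensRange := by
  obtain ⟨V, h₁, h₂⟩ := P.isPinching.exists_opens (P.a' ⁻¹ᵁ U) (P.b ⁻¹ᵁ W) (by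
    rw [← Scheme.Hom.comp_preimage, ← Scheme.Hom.comp_preimage, ← b'_comp_i, ← b'_comp_q,
      Scheme.Hom.comp_preimage, Scheme.Hom.comp_preimage, hUW])
  refine ⟨V, h₁, h₂, fun x hx ↦ ?_⟩
  obtain ⟨L, hL, hx, hLV⟩ := exists_le P V x hx
  obtain ⟨h₁, h₂⟩ := le_of_opensRange_le hL h₁.le h₂.le hLV
  exact ⟨L, hL, h₁, h₂, hx⟩

lemma exists_le_of_mem_inf {P Q : AffinePair i q} (x : X') (hP : x ∈ P.U) (hQ : x ∈ Q.U) :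
    ∃ L : AffinePair i q, L ≤ P ∧ L ≤ Q ∧ x ∈ L.U := by
  obtain ⟨y, rfl⟩ : x ∈ P.a'.opensRange := by rwa [opensRange_a']
  obtain ⟨V, h₁, -, h₃⟩ := P.exists_le_of_opens Q.U Q.W Q.preimage_eq
  obtain ⟨L, hL, hU, hW, hx⟩ := h₃ (Spec.map P.φ y) (h₁.ge hQ)
  exact ⟨L, hL, ⟨hU, hW⟩, (preimage_φ hL).le hx⟩

lemma exists_le_of_mem_inf' {P Q : AffinePair i q} (x : D) (hP : x ∈ P.W) (hQ : x ∈ Q.W) :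
    ∃ L : AffinePair i q, L ≤ P ∧ L ≤ Q ∧ x ∈ L.W := by
  obtain ⟨y, rfl⟩ : x ∈ P.b.opensRange := by rwa [opensRange_b]
  obtain ⟨V, -, h₁, h₃⟩ := P.exists_le_of_opens Q.U Q.W Q.preimage_eq
  obtain ⟨L, hL, hU, hW, hx⟩ := h₃ (Spec.map P.ψ y) (h₁.ge hQ)
  exact ⟨L, hL, ⟨hU, hW⟩, (preimage_ψ hL).le hx⟩

lemma exists_ν (hX' : ∀ x : X', ∃ P : AffinePair i q, x ∈ P.U) :
    ∃ ν : X' ⟶ glued i q, ∀ P : AffinePair i q, P.a' ≫ ν = Spec.map P.φ ≫ P.ι := by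
  refine Scheme.exists_glue (fun P : AffinePair i q ↦ P.a') (fun x ↦ ?_) _ fun P Q x y hxy ↦ ?_
  · obtain ⟨P, hP⟩ := hX' x
    exact ⟨P, by rwa [← Scheme.Hom.coe_opensRange, opensRange_a']⟩
  · obtain ⟨L, hLP, hLQ, hx⟩ := exists_le_of_mem_inf (P := P) (Q := Q) (P.a' x)
      (P.opensRange_a'.le ⟨x, rfl⟩) (Q.opensRange_a'.le ⟨y, hxy.symm⟩)
    obtain ⟨z, hz⟩ : P.a' x ∈ L.a'.opensRange := by rwa [opensRange_a']
    refine ⟨L, _, _, map_a' hLP, map_a' hLQ, ?_, ?_, z, P.a'.isOpenEmbedding.injective ?_⟩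
    · rw [← Spec.map_comp_assoc, ← res_φ hLP, Spec.map_comp_assoc, res_ι]
    · rw [← Spec.map_comp_assoc, ← res_φ hLQ, Spec.map_comp_assoc, res_ι]
    · rw [← Scheme.Hom.comp_apply, map_a' hLP, hz]

lemma exists_j (hD : ∀ x : D, ∃ P : AffinePair i q, x ∈ P.W) :
    ∃ j : D ⟶ glued i q, ∀ P : AffinePair i q, P.b ≫ j = Spec.map P.ψ ≫ P.ι := by
  refine Scheme.exists_glue (fun P : AffinePair i q ↦ P.b) (fun x ↦ ?_) _ fun P Q x y hxy ↦ ?_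
  · obtain ⟨P, hP⟩ := hD x
    exact ⟨P, by rwa [← Scheme.Hom.coe_opensRange, opensRange_b]⟩
  · obtain ⟨L, hLP, hLQ, hx⟩ := exists_le_of_mem_inf' (P := P) (Q := Q) (P.b x)
      (P.opensRange_b.le ⟨x, rfl⟩) (Q.opensRange_b.le ⟨y, hxy.symm⟩)
    obtain ⟨z, hz⟩ : P.b x ∈ L.b.opensRange := by rwa [opensRange_b]
    refine ⟨L, _, _, map_b hLP, map_b hLQ, ?_, ?_, z, P.b.isOpenEmbedding.injective ?_⟩
    · rw [← Spec.map_comp_assoc, ← res_ψ hLP, Spec.map_comp_assoc, res_ι]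
    · rw [← Spec.map_comp_assoc, ← res_ψ hLQ, Spec.map_comp_assoc, res_ι]
    · rw [← Scheme.Hom.comp_apply, map_b hLP, hz]

theorem exists_isPinching (hX' : ∀ x : X', ∃ P : AffinePair i q, x ∈ P.U)
    (hD : ∀ x : D, ∃ P : AffinePair i q, x ∈ P.W) :
    ∃ (X : Scheme.{u}) (ν : X' ⟶ X) (j : D ⟶ X), IsPinching i q ν j := by
  obtain ⟨ν, hν⟩ := exists_ν hX'
  obtain ⟨j, hj⟩ := exists_j hD
  refine ⟨glued i q, ν, j, ?_, fun x ↦ ?_⟩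
  · refine Scheme.hom_ext_of_forall_mem_range _ _ fun e ↦ ?_
    obtain ⟨P, hP⟩ := hX' (i e)
    refine ⟨_, P.b', inferInstance, ?_, ?_⟩
    · rwa [← Scheme.Hom.coe_opensRange, opensRange_b']
    · rw [reassoc_of% b'_comp_i, hν, reassoc_of% b'_comp_q, hj, ← Spec.map_comp_assoc,
        ← Spec.map_comp_assoc]
      congr 2
      ext x; exact P.isFiberSquare.comm x
  · obtain ⟨P, y, rfl⟩ := exists_ι_eq x
    refine ⟨
      { φ := P.φ, ψ := P.ψ, π := P.π, ρ := P.ρ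
        isFiberSquare := P.isFiberSquare
        surjective := P.π_surjective
        isIntegral := P.ρ_isIntegral
        a := P.ι, a' := P.a', b := P.b, b' := P.b'
        a'_comp := hν P
        b_comp := hj P
        b'_comp_i := P.b'_comp_i
        b'_comp_q := P.b'_comp_q
        preimage_ν := ?_
        preimage_j := ?_
        preimage_i := by rw [opensRange_a', opensRange_b'] }, y, rfl⟩
    -- A point of `X'` mapping into the chart of `P` lies in some `Q.U`. The two charts meet there
    -- in the chart of a smaller `L`, whose preimage lies in `L.U ⊆ P.U`.
    · ext z
      constructor
      · rintro ⟨p, hp⟩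
        obtain ⟨Q, hQ⟩ := hX' z
        obtain ⟨w, rfl⟩ : z ∈ Q.a'.opensRange := by rwa [opensRange_a']
        obtain ⟨L, hLP, hLQ, r, -, hr⟩ :=
          exists_of_ι_eq (hp.trans (Scheme.comp_eq_apply (hν Q) w))
        rw [opensRange_a']
        exact hLP.1 ((preimage_φ hLQ).le ⟨r, hr⟩)
      · rintro ⟨w, rfl⟩
        exact ⟨_, (Scheme.comp_eq_apply (hν P) w).symm⟩
    · ext z
      constructor
      · rintro ⟨p, hp⟩
        obtain ⟨Q, hQ⟩ := hD z
        obtain ⟨w, rfl⟩ : z ∈ Q.b.opensRange := by rwa [opensRange_b]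
        obtain ⟨L, hLP, hLQ, r, -, hr⟩ :=
          exists_of_ι_eq (hp.trans (Scheme.comp_eq_apply (hj Q) w))
        rw [opensRange_b]
        exact hLP.2 ((preimage_ψ hLQ).le ⟨r, hr⟩)
      · rintro ⟨w, rfl⟩
        exact ⟨_, (Scheme.comp_eq_apply (hj P) w).symm⟩

/-- If the fiber of `q` over `y` is finite and contained in an affine open subset, then there is an
affine pair over a neighbourhood of `y`. -/
lemma exists_mem_W {q : D' ⟶ D} [IsFinite q] (y : D) (U₀ : X'.Opens) (hU₀ : IsAffineOpen U₀)
    (h : ∀ z : D', q z = y → i z ∈ U₀) : ∃ P : AffinePair i q, y ∈ P.W := by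
  obtain ⟨W₁, hW₁, hyW₁, -⟩ := TopologicalSpace.Opens.isBasis_iff_nbhd.mp D.isBasis_affineOpens
    (show y ∈ (⊤ : D.Opens) from trivial)
  have hfin : (i '' (q ⁻¹' {y})).Finite := (q.finite_preimage_singleton y).image _
  -- First `U₀` is shrunk: the new open contains the fiber and avoids the part of `D'` not lying
  -- over `W₁`.
  let C : Set X' := i '' (q ⁻¹ᵁ W₁ : Set D')ᶜ
  have hC : IsClosed C := i.isClosedEmbedding.isClosedMap _ (q ⁻¹ᵁ W₁).2.isClosed_compl
  obtain ⟨g, hg, hgC⟩ := hU₀.exists_basicOpen_of_finite hfin (by rintro _ ⟨z, hz, rfl⟩; exact h z hz)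
    ⟨Cᶜ, hC.isOpen_compl⟩ (by
      rintro _ ⟨z, hz, rfl⟩ ⟨z', hz', he⟩
      rw [i.isClosedEmbedding.injective he] at hz'
      exact hz' (show q z ∈ W₁ from (show q z = y from hz) ▸ hyW₁))
  have hle : i ⁻¹ᵁ X'.basicOpen g ≤ q ⁻¹ᵁ W₁ := by
    intro z hz
    by_contra hz'
    exact hgC hz ⟨z, hz', rfl⟩
  have hU₁ := hU₀.basicOpen g
  generalize X'.basicOpen g = U₁ at *
  -- Then `W₁` is shrunk: `q` is closed, so near `y` the whole preimage lies in `U₁`.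
  obtain ⟨w, hw, hw'⟩ := hW₁.exists_basicOpen_of_finite (Set.finite_singleton y) (by simpa using hyW₁)
    ⟨_, (q.isClosedMap _ (i ⁻¹ᵁ U₁).2.isClosed_compl).isOpen_compl⟩ (by
      rintro _ rfl ⟨z, hz, hzy⟩
      exact hz (hg ⟨z, hzy, rfl⟩))
  -- The pullback of `w` to `D'` extends to a function `a` on `U₁`; the basic opens of `a` and `w`
  -- then have the same preimage in `D'`.
  obtain ⟨a, ha⟩ := i.app_surjective U₁ hU₁ (q.appLE W₁ (i ⁻¹ᵁ U₁) hle w)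
  refine ⟨⟨X'.basicOpen a, D.basicOpen w, hU₁.basicOpen a, hW₁.basicOpen w, ?_⟩, hw rfl⟩
  rw [Scheme.preimage_basicOpen]
  erw [ha]
  rw [Scheme.basicOpen_appLE, inf_eq_right]
  intro z hz
  by_contra hz'
  exact hw' hz ⟨z, hz', rfl⟩

omit [IsIntegralHom q] in
-- A point off `D'` has an affine neighbourhood missing `D'`, which is paired with the empty open of
-- `D`.
lemma exists_mem_U
    (hD : ∀ x : D, ∃ P : AffinePair i q, x ∈ P.W) (x : X') : ∃ P : AffinePair i q, x ∈ P.U := by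
  by_cases hx : x ∈ Set.range i
  · obtain ⟨e, rfl⟩ := hx
    obtain ⟨P, hP⟩ := hD (q e)
    exact ⟨P, P.preimage_eq.ge hP⟩
  · obtain ⟨U, hU, hxU, hUi⟩ := TopologicalSpace.Opens.isBasis_iff_nbhd.mp X'.isBasis_affineOpens
      (show x ∈ (⟨_, i.isClosedEmbedding.isClosed_range.isOpen_compl⟩ : X'.Opens) from hx)
    refine ⟨⟨U, ⊥, hU, isAffineOpen_bot D, ?_⟩, hxU⟩
    ext z
    exact ⟨fun hz ↦ (hUi hz ⟨z, rfl⟩).elim, fun hz ↦ hz.elim⟩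

end AffinePair

end AlgebraicGeometry

/-! ### Flatness of ideals and of their quotients. -/

section

variable {R M N P : Type*} [CommRing R] [AddCommGroup M] [AddCommGroup N] [AddCommGroup P]
  [Module R M] [Module R N] [Module R P] {f : M →ₗ[R] N} {g : N →ₗ[R] P}

/-- The kernel of a surjection of flat modules is flat. -/
lemma Module.Flat.of_exact_left (hf : Function.Injective f) (hg : Function.Surjective g)
    (h : Function.Exact f g) [Module.Flat R N] [Module.Flat R P] : Module.Flat R M := by
  rw [iff_rTensor_preserves_injective_linearMap]
  intro K L _ _ _ _ l hl
  have h₁ := LinearMap.lTensor_injective_of_exact_of_flat g hg f hf h K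
  have h₂ := rTensor_preserves_injective_linearMap (M := N) l hl
  have h₃ : l.rTensor N ∘ₗ f.lTensor K = f.lTensor L ∘ₗ l.rTensor M := by
    rw [LinearMap.rTensor_comp_lTensor, LinearMap.lTensor_comp_rTensor]
  refine Function.Injective.of_comp (f := f.lTensor L) ?_
  rw [← LinearMap.coe_comp, ← h₃]
  exact h₂.comp h₁

/-- An extension of flat modules is flat. -/
lemma Module.Flat.of_exact_middle (hf : Function.Injective f) (hg : Function.Surjective g)
    (h : Function.Exact f g) [Module.Flat R M] [Module.Flat R P] : Module.Flat R N := by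
  rw [iff_rTensor_preserves_injective_linearMap]
  intro K L _ _ _ _ l hl
  have h₁ := LinearMap.lTensor_injective_of_exact_of_flat g hg f hf h L
  have h₂ := rTensor_preserves_injective_linearMap (M := P) l hl
  have h₄ := rTensor_preserves_injective_linearMap (M := M) l hl
  have h₃ : l.rTensor N ∘ₗ f.lTensor K = f.lTensor L ∘ₗ l.rTensor M := by
    rw [LinearMap.rTensor_comp_lTensor, LinearMap.lTensor_comp_rTensor]
  have h₅ : l.rTensor P ∘ₗ g.lTensor K = g.lTensor L ∘ₗ l.rTensor N := by
    rw [LinearMap.rTensor_comp_lTensor, LinearMap.lTensor_comp_rTensor]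
  rw [injective_iff_map_eq_zero]
  intro x hx
  have h₆ : g.lTensor K x = 0 := h₂ (by
    rw [← LinearMap.comp_apply, h₅, LinearMap.comp_apply, hx, map_zero, map_zero])
  obtain ⟨y, rfl⟩ := (_root_.lTensor_exact K h hg x).mp h₆
  have h₇ : l.rTensor M y = 0 := h₁ (by
    rw [← LinearMap.comp_apply, ← h₃, LinearMap.comp_apply, hx, map_zero])
  rw [h₄ (h₇.trans (map_zero _).symm), map_zero]

end

namespace Ideal

variable {A : Type*} [CommRing A]

/-- Locally on the spectrum the ideal is generated by one nonzerodivisor. -/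
def IsLocallyPrincipalNonzerodivisor (I : Ideal A) : Prop :=
  ∀ p : PrimeSpectrum A, ∃ g ∉ p.asIdeal, ∃ t ∈ nonZeroDivisors (Localization.Away g),
    I.map (algebraMap A (Localization.Away g)) = Ideal.span {t}

namespace IsLocallyPrincipalNonzerodivisor

variable {I : Ideal A} (hI : I.IsLocallyPrincipalNonzerodivisor)

include hI

lemma exists_span : ∃ s : Set A, Ideal.span s = ⊤ ∧ ∀ g ∈ s,
    ∃ t ∈ nonZeroDivisors (Localization.Away g),
      I.map (algebraMap A (Localization.Away g)) = Ideal.span {t} := by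
  choose g hg t ht hgt using hI
  refine ⟨Set.range g, ?_, by rintro _ ⟨p, rfl⟩; exact ⟨t p, ht p, hgt p⟩⟩
  by_contra hne
  obtain ⟨m, hm, hle⟩ := Ideal.exists_le_maximal _ hne
  exact hg ⟨m, hm.isPrime⟩ (hle (Ideal.subset_span ⟨_, rfl⟩))

omit hI in
lemma _root_.Ideal.nonempty_linearEquiv_span_singleton {B : Type*} [CommRing B] {t : B}
    (ht : t ∈ nonZeroDivisors B) : Nonempty (B ≃ₗ[B] Ideal.span {t}) := by
  refine ⟨LinearEquiv.ofInjective (LinearMap.toSpanSingleton B B t) ?_ ≪≫ₗ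
    LinearEquiv.ofEq _ _ (LinearMap.range_toSpanSingleton t)⟩
  intro x y hxy
  exact (mul_cancel_right_mem_nonZeroDivisors ht).mp hxy

lemma flat : Module.Flat A I := by
  obtain ⟨s, hs, H⟩ := hI.exists_span
  refine Module.flat_of_isLocalized_span A I s hs
    (fun g ↦ I.map (algebraMap A (Localization.Away g.1)))
    (fun g ↦ Algebra.idealMap I (S := Localization.Away g.1)) fun g ↦ ?_
  obtain ⟨t, ht, h⟩ := H g g.2
  have e := (Ideal.nonempty_linearEquiv_span_singleton ht).some
  rw [h]
  have : Module.Flat (Localization.Away g.1) (Ideal.span {t}) := .of_linearEquiv e.symm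
  have : Module.Flat A (Localization.Away g.1) := IsLocalization.flat _ (Submonoid.powers g.1)
  exact .trans A (Localization.Away g.1) _

lemma finitePresentation : Module.FinitePresentation A I := by
  obtain ⟨s, hs, H⟩ := hI.exists_span
  refine Module.FinitePresentation.of_localizationSpan' (Rₚ := fun g ↦ Localization.Away g.1)
    (Mₚ := fun g ↦ I.map (algebraMap A (Localization.Away g.1))) s hs
    (fun g ↦ Algebra.idealMap I (S := Localization.Away g.1)) fun g ↦ ?_
  obtain ⟨t, ht, h⟩ := H g g.2
  have e := (Ideal.nonempty_linearEquiv_span_singleton ht).some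
  rw [h]
  exact .of_equiv e

end IsLocallyPrincipalNonzerodivisor

/-- Multiplication `I ⊗ J → A` is a composite of two maps, each injective by flatness of one ideal,
so `I ⊗ J ≃ I * J`. -/
lemma flat_mul (I J : Ideal A) [Module.Flat A I] [Module.Flat A J] :
    Module.Flat A (I * J : Ideal A) := by
  let f : TensorProduct A I J →ₗ[A] A := (TensorProduct.rid A A).toLinearMap ∘ₗ
    TensorProduct.map I.subtype J.subtype
  have hf : Function.Injective f := by
    refine (TensorProduct.rid A A).injective.comp ?_
    have : TensorProduct.map I.subtype J.subtype =
        I.subtype.rTensor A ∘ₗ J.subtype.lTensor I := by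
      rw [LinearMap.rTensor_comp_lTensor]
    rw [this]
    exact (Module.Flat.rTensor_preserves_injective_linearMap _ I.subtype_injective).comp
      (Module.Flat.lTensor_preserves_injective_linearMap _ J.subtype_injective)
  have hr : LinearMap.range f = I * J := by
    apply le_antisymm
    · rintro _ ⟨x, rfl⟩
      induction x with
      | zero => simp
      | tmul x y =>
        have : f (x ⊗ₜ y) = x.1 * y.1 := by simp [f, mul_comm]
        rw [this]
        exact Ideal.mul_mem_mul x.2 y.2
      | add x y hx hy => rw [map_add]; exact add_mem hx hy
    · rw [Ideal.mul_le]
      intro x hx y hy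
      exact ⟨⟨x, hx⟩ ⊗ₜ ⟨y, hy⟩, by simp [f, mul_comm]⟩
  rw [← hr]
  exact .of_linearEquiv (LinearEquiv.ofInjective f hf).symm

variable (R : Type*) [CommRing R] [Algebra R A]

/-- `A/IJ` is an extension of `A/J` by `J/IJ = A/I ⊗ J`, and the latter is flat over `R` because
`A/I` is flat over `R` and `J` over `A`. -/
lemma flat_quotient_mul (I J : Ideal A) [Module.Flat A J] [Module.Flat R (A ⧸ I)]
    [Module.Flat R (A ⧸ J)] : Module.Flat R (A ⧸ I * J) := by
  let f : (J ⧸ (I • ⊤ : Submodule A J)) →ₗ[A] A ⧸ (I * J) :=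
    Submodule.mapQ _ _ J.subtype (by
      rw [Submodule.smul_le]
      intro x hx y _
      exact Ideal.mul_mem_mul hx y.2)
  let g : (A ⧸ (I * J)) →ₐ[A] A ⧸ J := Ideal.Quotient.factorₐ A Ideal.mul_le_right
  have hf : Function.Injective f := by
    rw [injective_iff_map_eq_zero]
    intro x hx
    obtain ⟨x, rfl⟩ := Submodule.Quotient.mk_surjective _ x
    have h₁ : x.1 ∈ I * J := by
      rw [← Ideal.Quotient.eq_zero_iff_mem]
      exact hx
    have h₂ : (I • ⊤ : Submodule A J).map J.subtype = I * J := by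
      rw [Submodule.map_smul'', Submodule.map_top, Submodule.range_subtype]
      rfl
    rw [← h₂] at h₁
    obtain ⟨y, hy, hyx⟩ := h₁
    rw [Submodule.Quotient.mk_eq_zero]
    rwa [← J.subtype_injective hyx]
  have hg : Function.Surjective g := Ideal.Quotient.factor_surjective Ideal.mul_le_right
  have hfg : Function.Exact f g := by
    intro x
    obtain ⟨x, rfl⟩ := Ideal.Quotient.mk_surjective x
    constructor
    · intro hx
      have : x ∈ J := Ideal.Quotient.eq_zero_iff_mem.mp hx
      exact ⟨Submodule.Quotient.mk ⟨x, this⟩, rfl⟩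
    · rintro ⟨y, hy⟩
      obtain ⟨y, rfl⟩ := Submodule.Quotient.mk_surjective _ y
      rw [← hy]
      exact Ideal.Quotient.eq_zero_iff_mem.mpr y.2
  have : Module.Flat R (J ⧸ (I • ⊤ : Submodule A J)) := by
    have : Module.Flat R (TensorProduct A (A ⧸ I) J) := .trans R (A ⧸ I) _
    exact .of_linearEquiv ((TensorProduct.quotTensorEquivQuotSMul J I).restrictScalars R).symm
  exact Module.Flat.of_exact_middle (f := f.restrictScalars R) (g := g.toLinearMap.restrictScalars R)
    hf hg hfg

lemma flat_quotient_pow (I : Ideal A) [Module.Flat A I] [Module.Flat R (A ⧸ I)] (m : ℕ) :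
    Module.Flat R (A ⧸ I ^ m) := by
  suffices Module.Flat A (I ^ m : Ideal A) ∧ Module.Flat R (A ⧸ I ^ m) from this.2
  induction m with
  | zero =>
    rw [pow_zero, Ideal.one_eq_top]
    exact ⟨.of_linearEquiv Submodule.topEquiv, inferInstance⟩
  | succ m ih =>
    obtain ⟨_, _⟩ := ih
    rw [pow_succ']
    exact ⟨flat_mul _ _, flat_quotient_mul _ _ _⟩

end Ideal

/-! ### Flatness and finite presentation of the fiber product. -/

namespace IsFiberSquare

section

variable {A A' B B' R : Type*} [CommRing A] [CommRing A'] [CommRing B] [CommRing B'] [CommRing R]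
  {φ : A →+* A'} {ψ : A →+* B} {π : A' →+* B'} {ρ : B →+* B'}

/-- `A` is an extension of `B` by `ker ψ ≃ ker π`, and `ker π` is flat as the kernel of a surjection
of flat modules. -/
lemma flat (h : IsFiberSquare φ ψ π ρ) (hπ : Function.Surjective π) (r : R →+* A)
    (hA' : (φ.comp r).Flat) (hB : (ψ.comp r).Flat) (hB' : (π.comp (φ.comp r)).Flat) : r.Flat := by
  algebraize [r, φ.comp r, ψ.comp r, π.comp (φ.comp r)]
  let φ' : A →ₗ[R] A' := (AlgHom.mk φ fun _ ↦ rfl : A →ₐ[R] A').toLinearMap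
  let ψ' : A →ₗ[R] B := (AlgHom.mk ψ fun _ ↦ rfl : A →ₐ[R] B).toLinearMap
  let π' : A' →ₗ[R] B' := (AlgHom.mk π fun _ ↦ rfl : A' →ₐ[R] B').toLinearMap
  have : Module.Flat R (LinearMap.ker π') :=
    Module.Flat.of_exact_left (LinearMap.ker π').subtype_injective (g := π') hπ
      (LinearMap.exact_subtype_ker_map π')
  let e : LinearMap.ker ψ' →ₗ[R] LinearMap.ker π' :=
    φ'.restrict fun x hx ↦ (h.comm x).trans ((congr_arg ρ hx).trans (map_zero ρ))
  have he : Function.Bijective e := by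
    constructor
    · intro x y hxy
      exact Subtype.ext (h.ext congr(($hxy).1) (x.2.trans y.2.symm))
    · rintro ⟨y, hy⟩
      obtain ⟨a, ha, ha'⟩ := h.exists_lift y 0 (Eq.trans hy (map_zero ρ).symm)
      exact ⟨⟨a, ha'⟩, Subtype.ext ha⟩
  have : Module.Flat R (LinearMap.ker ψ') := .of_linearEquiv (LinearEquiv.ofBijective e he)
  exact Module.Flat.of_exact_middle (LinearMap.ker ψ').subtype_injective (g := ψ')
    (h.surjective hπ) (LinearMap.exact_subtype_ker_map ψ')

/-- Since `φ` maps `ker ψ` onto `ker π`, it maps products onto products. The exponent has to be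
positive: the zeroth power is all of `A'`. -/
lemma exists_mem_ker_pow (h : IsFiberSquare φ ψ π ρ) (m : ℕ) {x : A'}
    (hx : x ∈ RingHom.ker π ^ (m + 1)) : ∃ a ∈ RingHom.ker ψ ^ (m + 1), φ a = x := by
  induction m generalizing x with
  | zero =>
    rw [zero_add, pow_one] at hx ⊢
    obtain ⟨a, ha, ha'⟩ := h.exists_lift x 0 (Eq.trans hx (map_zero ρ).symm)
    exact ⟨a, ha', ha⟩
  | succ m ih =>
    rw [pow_succ] at hx ⊢
    induction hx using Submodule.mul_induction_on' with
    | mem_mul_mem x hx y hy =>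
      obtain ⟨a, ha, rfl⟩ := ih hx
      obtain ⟨b, hb, hb'⟩ := h.exists_lift y 0 (Eq.trans hy (map_zero ρ).symm)
      exact ⟨a * b, Ideal.mul_mem_mul ha hb', by rw [map_mul, hb]⟩
    | add x _ y _ hx hy =>
      obtain ⟨a, ha, rfl⟩ := hx
      obtain ⟨b, hb, rfl⟩ := hy
      exact ⟨a + b, add_mem ha hb, map_add _ _ _⟩

/-- The infinitesimal neighbourhoods of a pinching are pinchings. -/
lemma quotient_ker_pow (h : IsFiberSquare φ ψ π ρ) (m : ℕ) :
    IsFiberSquare (Ideal.quotientMap (I := RingHom.ker ψ ^ (m + 1)) (RingHom.ker π ^ (m + 1)) φ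
        (by rw [← Ideal.map_le_iff_le_comap, Ideal.map_pow]; exact Ideal.pow_right_mono h.map_ker.le _))
      (Ideal.Quotient.lift (RingHom.ker ψ ^ (m + 1)) ψ fun _ hx ↦ Ideal.pow_le_self (by simp) hx)
      (Ideal.Quotient.lift (RingHom.ker π ^ (m + 1)) π fun _ hx ↦ Ideal.pow_le_self (by simp) hx)
      ρ where
  comm a := by
    obtain ⟨a, rfl⟩ := Ideal.Quotient.mk_surjective a
    exact h.comm a
  eq_zero a ha ha' := by
    obtain ⟨a, rfl⟩ := Ideal.Quotient.mk_surjective a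
    obtain ⟨b, hb, hba⟩ := h.exists_mem_ker_pow m (Ideal.Quotient.eq_zero_iff_mem.mp ha)
    have : ψ b = 0 := Ideal.pow_le_self (by simp) hb
    rw [Ideal.Quotient.eq_zero_iff_mem, h.ext hba.symm (Eq.trans ha' this.symm)]
    exact hb
  exists_lift a' b hab := by
    obtain ⟨a', rfl⟩ := Ideal.Quotient.mk_surjective a'
    obtain ⟨a, rfl, rfl⟩ := h.exists_lift a' b hab
    exact ⟨Ideal.Quotient.mk _ a, rfl, rfl⟩

/-- For positive exponents `quotient_ker_pow` reduces this to `flat`; the quotient of `A'` by a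
power of `ker π` is flat because `ker π` is locally free over `A'` and `A' / ker π = B'` is flat. -/
lemma flat_quotient_ker_pow (h : IsFiberSquare φ ψ π ρ) (hπ : Function.Surjective π)
    (hI : (RingHom.ker π).IsLocallyPrincipalNonzerodivisor) (r : R →+* A)
    (hB : (ψ.comp r).Flat) (hB' : (π.comp (φ.comp r)).Flat) (m : ℕ) :
    ((Ideal.Quotient.mk (RingHom.ker ψ ^ m)).comp r).Flat := by
  cases m with
  | zero =>
    rw [pow_zero, Ideal.one_eq_top]
    algebraize [r]
    have : Subsingleton (A ⧸ (⊤ : Ideal A)) := Ideal.Quotient.subsingleton_iff.mpr rfl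
    exact (inferInstance : Module.Flat R (A ⧸ (⊤ : Ideal A)))
  | succ m =>
    refine (h.quotient_ker_pow m).flat ?_ _ ?_ hB hB'
    · intro b
      obtain ⟨a, rfl⟩ := hπ b
      exact ⟨Ideal.Quotient.mk _ a, rfl⟩
    · have := hI.flat
      algebraize [φ.comp r, π.comp (φ.comp r)]
      let π' : A' →ₐ[R] B' := ⟨π, fun _ ↦ rfl⟩
      have : Module.Flat R (A' ⧸ RingHom.ker π) :=
        .of_linearEquiv (Ideal.quotientKerAlgEquivOfSurjective (f := π') hπ).toLinearEquiv
      exact Ideal.flat_quotient_pow R (RingHom.ker π) (m + 1)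

end

end IsFiberSquare

universe w in
/-- An algebra of finite type which is integral over `A` is finite over every ring mapping onto a
suitable finite subset of `A`. -/
lemma Algebra.exists_finite_forall_moduleFinite {R A A' : Type*} [CommRing R] [CommRing A]
    [CommRing A'] [Algebra R A] [Algebra R A'] [Algebra A A'] [IsScalarTower R A A']
    [Algebra.FiniteType R A'] [Algebra.IsIntegral A A'] :
    ∃ T : Set A, T.Finite ∧ ∀ (P : Type w) [CommRing P] [Algebra R P] [Algebra P A'] [Algebra P A]
      [IsScalarTower R P A'] [IsScalarTower P A A'], T ⊆ Set.range (algebraMap P A) →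
      Module.Finite P A' := by
  classical
  obtain ⟨s, hs⟩ := (inferInstance : Algebra.FiniteType R A').out
  choose p hp hp' using fun x : A' ↦ Algebra.IsIntegral.isIntegral (R := A) x
  -- The finite set consists of the coefficients of monic equations over `A` for generators of `A'`.
  refine ⟨s.biUnion fun x ↦ (p x).coeffs, Finset.finite_toSet _, fun P _ _ _ _ _ _ hT ↦ ?_⟩
  have key (x : A') (hx : x ∈ s) : IsIntegral P x := by
    have hl : p x ∈ Polynomial.lifts (algebraMap P A) := by
      rw [Polynomial.lifts_iff_coeff_lifts]
      intro n
      by_cases hn : (p x).coeff n = 0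
      · exact ⟨0, by rw [hn, map_zero]⟩
      · exact hT (Finset.mem_coe.mpr (Finset.mem_biUnion.mpr
          ⟨x, hx, Polynomial.coeff_mem_coeffs hn⟩))
    obtain ⟨y, hy, -, hym⟩ := Polynomial.lifts_and_natDegree_eq_and_monic hl (hp x)
    refine ⟨y, hym, ?_⟩
    rw [IsScalarTower.algebraMap_eq P A A', ← Polynomial.eval₂_map, hy, hp']
  have hint : Algebra.IsIntegral P A' := by
    have : (⊤ : Subalgebra R A') ≤ (integralClosure P A').restrictScalars R := by
      rw [← hs, Algebra.adjoin_le_iff]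
      exact key
    exact ⟨fun x ↦ this (show x ∈ (⊤ : Subalgebra R A') from trivial)⟩
  have : Algebra.FiniteType P A' := .of_restrictScalars_finiteType R P A'
  exact Algebra.IsIntegral.finite

namespace IsFiberSquare
universe v
variable {R A A' B B' : Type v} [CommRing A] [CommRing A'] [CommRing B] [CommRing B'] [CommRing R]
  {φ : A →+* A'} {ψ : A →+* B} {π : A' →+* B'} {ρ : B →+* B'}

/-- Finite generation of `A` is not known beforehand, so a polynomial ring `P → A` is chosen making
`A'` finite over `P` and `P → B` surjective. Then `A'` and `B` are finitely presented `P`-modules,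
and so is `ker π`, which is finitely presented over `A'`. Hence so is `A`, an extension of `B` by
`ker ψ ≃ ker π`. -/
lemma finitePresentation (h : IsFiberSquare φ ψ π ρ) (hπ : Function.Surjective π)
    (hρ : ρ.IsIntegral) (hI : (RingHom.ker π).IsLocallyPrincipalNonzerodivisor) (r : R →+* A)
    (hA' : (φ.comp r).FinitePresentation) (hB : (ψ.comp r).FinitePresentation) :
    r.FinitePresentation := by
  have hφ := h.isIntegral hπ hρ
  algebraize [r, φ.comp r, ψ.comp r, φ, ψ]
  have : Algebra.FiniteType R A' := inferInstance
  have : Algebra.FiniteType R B := inferInstance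
  obtain ⟨T, hT, H⟩ := Algebra.exists_finite_forall_moduleFinite (R := R) (A := A) (A' := A')
  obtain ⟨s, hs⟩ := (inferInstance : Algebra.FiniteType R B).out
  choose l hl using h.surjective hπ
  let T' : Set A := T ∪ l '' s
  have : Finite T' := (hT.union (s.finite_toSet.image l)).to_subtype
  let P := MvPolynomial T' R
  let f : P →ₐ[R] A := MvPolynomial.aeval Subtype.val
  have hf : T' ⊆ Set.range f := fun x hx ↦ ⟨MvPolynomial.X ⟨x, hx⟩, MvPolynomial.aeval_X _ _⟩
  let := f.toRingHom.toAlgebra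
  let := (φ.comp f.toRingHom).toAlgebra
  let := (ψ.comp f.toRingHom).toAlgebra
  have : IsScalarTower P A A' := .of_algebraMap_eq' rfl
  have : IsScalarTower P A B := .of_algebraMap_eq' rfl
  have : IsScalarTower R P A := .of_algebraMap_eq' f.comp_algebraMap.symm
  have : IsScalarTower R P A' := .of_algebraMap_eq fun x ↦ congr_arg φ (f.commutes x).symm
  have : IsScalarTower R P B := .of_algebraMap_eq fun x ↦ congr_arg ψ (f.commutes x).symm
  have : Module.Finite P A' := H P (Set.subset_union_left.trans hf)
  have hPB : Function.Surjective (Algebra.linearMap P B) := by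
    have : (⊤ : Subalgebra R B) ≤ (IsScalarTower.toAlgHom R P B).range := by
      rw [← hs, Algebra.adjoin_le_iff]
      intro x hx
      obtain ⟨y, hy⟩ := hf (Set.mem_union_right _ ⟨x, hx, rfl⟩)
      refine ⟨y, ?_⟩
      change ψ (f y) = x
      rw [hy, hl]
    intro b
    exact this (show b ∈ (⊤ : Subalgebra R B) from trivial)
  have : Module.Finite P B := .of_surjective _ hPB
  have : Algebra.FinitePresentation P A' := .of_restrict_scalars_finitePresentation R P A'
  have : Algebra.FinitePresentation P B := .of_restrict_scalars_finitePresentation R P B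
  have : Module.FinitePresentation P A' := .of_finite_of_finitePresentation _ _
  have : Module.FinitePresentation P B := .of_finite_of_finitePresentation _ _
  have := hI.finitePresentation
  have : Module.FinitePresentation P (RingHom.ker π) := .trans P _ A'
  let ψ' : A →ₗ[P] B := (IsScalarTower.toAlgHom P A B).toLinearMap
  let φ' : A →ₗ[P] A' := (IsScalarTower.toAlgHom P A A').toLinearMap
  let e : LinearMap.ker ψ' →ₗ[P] (RingHom.ker π : Ideal A').restrictScalars P :=
    φ'.restrict fun x hx ↦ (h.comm x).trans ((congr_arg ρ hx).trans (map_zero ρ))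
  have he : Function.Bijective e := by
    constructor
    · intro x y hxy
      exact Subtype.ext (h.ext congr(($hxy).1) (x.2.trans y.2.symm))
    · rintro ⟨y, hy⟩
      obtain ⟨a, ha, ha'⟩ := h.exists_lift y 0 (Eq.trans hy (map_zero ρ).symm)
      exact ⟨⟨a, ha'⟩, Subtype.ext ha⟩
  have : Module.FinitePresentation P (LinearMap.ker ψ') :=
    @Module.FinitePresentation.of_equiv _ _ _ _ _ _ _ _ (LinearEquiv.ofBijective e he).symm this
  have : Module.FinitePresentation P A :=
    Module.finitePresentation_of_ker ψ' (h.surjective hπ)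
  exact Algebra.FinitePresentation.trans R P A

end IsFiberSquare

/-! ### Ideal sheaves on affine charts and effective Cartier divisors. -/

namespace AlgebraicGeometry

namespace Scheme.IdealSheafData

variable {X Y : Scheme.{u}}

/-- The ideal of a ring corresponding to an ideal sheaf on its spectrum. -/
noncomputable def specIdeal {C : CommRingCat.{u}} (I : (Spec C).IdealSheafData) : Ideal C :=
  (I.ideal ⟨⊤, isAffineOpen_top _⟩).comap (Scheme.ΓSpecIso C).inv.hom

/-- The ideal of `C` induced by an ideal sheaf on `X` along a morphism from the spectrum of `C`. -/
noncomputable def on (I : X.IdealSheafData) {C : CommRingCat.{u}} (c : Spec C ⟶ X) : Ideal C :=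
  (I.comap c).specIdeal

lemma specIdeal_le_iff {C : CommRingCat.{u}} {I J : (Spec C).IdealSheafData} :
    I.specIdeal ≤ J.specIdeal ↔ I ≤ J := by
  refine ⟨fun h ↦ le_of_isAffine fun x hx ↦ ?_, fun h ↦ Ideal.comap_mono (h _)⟩
  have e : (Scheme.ΓSpecIso C).inv.hom ((Scheme.ΓSpecIso C).hom.hom x) = x :=
    congr(($((Scheme.ΓSpecIso C).hom_inv_id)).hom x)
  have h₁ : (Scheme.ΓSpecIso C).inv.hom ((Scheme.ΓSpecIso C).hom.hom x) ∈
      I.ideal ⟨⊤, isAffineOpen_top _⟩ := by rwa [e]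
  have h₂ : (Scheme.ΓSpecIso C).inv.hom ((Scheme.ΓSpecIso C).hom.hom x) ∈
      J.ideal ⟨⊤, isAffineOpen_top _⟩ := h h₁
  rwa [e] at h₂

lemma specIdeal_injective {C : CommRingCat.{u}} {I J : (Spec C).IdealSheafData}
    (h : I.specIdeal = J.specIdeal) : I = J :=
  le_antisymm (specIdeal_le_iff.mp h.le) (specIdeal_le_iff.mp h.ge)

lemma specIdeal_ker {C B : CommRingCat.{u}} (ψ : C ⟶ B) :
    (Spec.map ψ).ker.specIdeal = RingHom.ker ψ.hom := by
  ext x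
  have e : (Scheme.ΓSpecIso C).inv ≫ (Spec.map ψ).appTop = ψ ≫ (Scheme.ΓSpecIso B).inv :=
    (Scheme.ΓSpecIso_inv_naturality ψ).symm
  rw [specIdeal, Scheme.Hom.ker_apply]
  change (Spec.map ψ).appTop.hom ((Scheme.ΓSpecIso C).inv.hom x) = 0 ↔ ψ.hom x = 0
  have := congr(($e).hom x)
  change (Spec.map ψ).appTop.hom ((Scheme.ΓSpecIso C).inv.hom x) =
    (Scheme.ΓSpecIso B).inv.hom (ψ.hom x) at this
  rw [this]
  exact map_eq_zero_iff _ (ConcreteCategory.bijective_of_isIso (Scheme.ΓSpecIso B).inv).1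

/-- Every ideal comes from an ideal sheaf. -/
lemma exists_specIdeal_eq {C : CommRingCat.{u}} (K : Ideal C) :
    ∃ I : (Spec C).IdealSheafData, I.specIdeal = K :=
  ⟨(Spec.map (CommRingCat.ofHom (Ideal.Quotient.mk K))).ker, by
    rw [specIdeal_ker, CommRingCat.hom_ofHom, Ideal.mk_ker]⟩

lemma specIdeal_map {C C' : CommRingCat.{u}} (f : C ⟶ C') (J : (Spec C').IdealSheafData) :
    (J.map (Spec.map f)).specIdeal = J.specIdeal.comap f.hom := by
  have : J = (Spec.map (CommRingCat.ofHom (Ideal.Quotient.mk J.specIdeal))).ker :=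
    specIdeal_injective (by rw [specIdeal_ker, CommRingCat.hom_ofHom, Ideal.mk_ker])
  conv_lhs => rw [this]
  rw [map_ker, ← Spec.map_comp, specIdeal_ker]
  ext x
  exact Ideal.Quotient.eq_zero_iff_mem

/-- Pullback of ideal sheaves is left adjoint to `map`, as extension of ideals is to contraction.
Since every ideal comes from an ideal sheaf, the adjoints correspond. -/
lemma specIdeal_comap {C C' : CommRingCat.{u}} (f : C ⟶ C') (I : (Spec C).IdealSheafData) :
    (I.comap (Spec.map f)).specIdeal = I.specIdeal.map f.hom := by
  have key (J : (Spec C').IdealSheafData) : (I.comap (Spec.map f)).specIdeal ≤ J.specIdeal ↔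
      I.specIdeal.map f.hom ≤ J.specIdeal := by
    rw [specIdeal_le_iff, ← le_map_iff_comap_le, ← specIdeal_le_iff, specIdeal_map,
      Ideal.map_le_iff_le_comap]
  apply le_antisymm
  · obtain ⟨J, hJ⟩ := exists_specIdeal_eq (I.specIdeal.map f.hom)
    rw [← hJ, key, hJ]
  · rw [← key]

variable (I : X.IdealSheafData)

lemma on_SpecMap_comp {C C' : CommRingCat.{u}} (f : C ⟶ C') (c : Spec C ⟶ X) :
    I.on (Spec.map f ≫ c) = (I.on c).map f.hom := by
  rw [on, on, comap_comp, specIdeal_comap]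

lemma on_comap {C : CommRingCat.{u}} (c : Spec C ⟶ Y) (f : Y ⟶ X) :
    (I.comap f).on c = I.on (c ≫ f) := by
  rw [on, on, comap_comp]

lemma on_ker_of_isPullback {C B : CommRingCat.{u}} {ψ : C ⟶ B} {b : Spec B ⟶ Y} {c : Spec C ⟶ X}
    {j : Y ⟶ X} [IsClosedImmersion j] (h : IsPullback (Spec.map ψ) b c j) :
    j.ker.on c = RingHom.ker ψ.hom := by
  rw [on, ← ker_fst_of_isClosedImmersion, ← specIdeal_ker, ← h.isoPullback_hom_fst,
    Scheme.Hom.ker_comp_of_isIso]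

lemma exists_ringEquiv {C : CommRingCat.{u}} (c : Spec C ⟶ X) [IsOpenImmersion c]
    (U : X.affineOpens) (hU : c.opensRange = U.1) :
    ∃ e : C ≃+* Γ(X, U), ∀ I : X.IdealSheafData, I.on c = (I.ideal U).comap e := by
  obtain ⟨U, hU'⟩ := U
  obtain rfl : c ''ᵁ ⊤ = U := by rw [Scheme.Hom.image_top_eq_opensRange]; exact hU
  refine ⟨((Scheme.ΓSpecIso C).symm ≪≫ (c.appIso ⊤).symm).commRingCatIsoToRingEquiv, fun I ↦ ?_⟩
  rw [on, specIdeal, ideal_comap_of_isOpenImmersion, Ideal.comap_comap]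
  rfl

lemma on_pow {C : CommRingCat.{u}} (c : Spec C ⟶ X) [IsOpenImmersion c] (m : ℕ) :
    (I ^ m).on c = I.on c ^ m := by
  obtain ⟨e, he⟩ := exists_ringEquiv c ⟨c.opensRange, isAffineOpen_opensRange c⟩ rfl
  rw [he, he]
  change Ideal.comap e (I.ideal _ ^ m) = _
  rw [← Ideal.map_symm, ← Ideal.map_symm, Ideal.map_pow]

variable {I}

lemma ext_on {J : X.IdealSheafData} (h : ∀ x : X, ∃ (C : CommRingCat.{u}) (c : Spec C ⟶ X),
    IsOpenImmersion c ∧ x ∈ Set.range c ∧ I.on c = J.on c) : I = J := by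
  choose C c hc hx h using h
  refine ext_of_iSup_eq_top (fun x ↦ ⟨(c x).opensRange, isAffineOpen_opensRange (c x)⟩) ?_ fun x ↦ ?_
  · exact top_le_iff.mp fun x _ ↦ TopologicalSpace.Opens.mem_iSup.mpr ⟨x, hx x⟩
  · obtain ⟨e, he⟩ := exists_ringEquiv (c x) ⟨(c x).opensRange, isAffineOpen_opensRange (c x)⟩ rfl
    have := h x
    rw [he, he] at this
    exact Ideal.comap_injective_of_surjective _ e.surjective this

end Scheme.IdealSheafData

open Scheme.IdealSheafData

variable {X Y : Scheme.{u}} {I : X.IdealSheafData}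

lemma map_mem_nonZeroDivisors_of_flat {C C' : Type*} [CommRing C] [CommRing C'] {f : C →+* C'}
    (hf : f.Flat) {t : C} (ht : t ∈ nonZeroDivisors C) : f t ∈ nonZeroDivisors C' := by
  algebraize [f]
  rw [← isRegular_iff_mem_nonZeroDivisors, ← isLeftRegular_iff_isRegular] at ht ⊢
  have := IsSMulRegular.of_flat (S := C') (x := t) ht
  exact this

lemma isEffectiveCartier_iff : IsEffectiveCartier I ↔ ∀ x : X, ∃ (C : CommRingCat.{u})
    (c : Spec C ⟶ X), IsOpenImmersion c ∧ x ∈ Set.range c ∧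
      ∃ t ∈ nonZeroDivisors C, I.on c = Ideal.span {t} := by
  constructor
  · intro h x
    obtain ⟨U, hx, t, ht, hU⟩ := h x
    have hU' : IsOpenImmersion U.2.fromSpec := U.2.isOpenImmersion_fromSpec
    obtain ⟨e, he⟩ := exists_ringEquiv U.2.fromSpec U U.2.opensRange_fromSpec
    refine ⟨_, U.2.fromSpec, inferInstance, by rwa [U.2.range_fromSpec], e.symm t, ?_, ?_⟩
    · exact map_mem_nonZeroDivisors_of_flat (f := e.symm.toRingHom)
        (RingHom.Flat.of_bijective e.symm.bijective) ht
    · rw [he, hU, ← Ideal.map_symm, Ideal.map_span, Set.image_singleton]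
  · intro h x
    obtain ⟨C, c, hc, hx, t, ht, h⟩ := h x
    obtain ⟨e, he⟩ := exists_ringEquiv c ⟨c.opensRange, isAffineOpen_opensRange c⟩ rfl
    refine ⟨⟨c.opensRange, isAffineOpen_opensRange c⟩, hx, e t, ?_, ?_⟩
    · exact map_mem_nonZeroDivisors_of_flat (f := e.toRingHom)
        (RingHom.Flat.of_bijective e.bijective) ht
    · rw [he] at h
      apply Ideal.comap_injective_of_surjective _ e.surjective
      rw [h, ← Ideal.map_symm, Ideal.map_span, Set.image_singleton]
      simp

lemma exists_away_range_le {C : CommRingCat.{u}} (c : Spec C ⟶ X) (p : Spec C) (V : X.Opens)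
    (hV : c p ∈ V) : ∃ g : C, g ∉ p.asIdeal ∧ Set.range (Spec.away g ≫ c) ⊆ V := by
  obtain ⟨-, ⟨-, ⟨g, rfl⟩, rfl⟩, hpg, hg⟩ :=
    PrimeSpectrum.isBasis_basic_opens.exists_subset_of_mem_open
    (show p ∈ ((c ⁻¹ᵁ V : (Spec C).Opens) : Set (Spec C)) from hV) (c ⁻¹ᵁ V).2
  refine ⟨g, hpg, ?_⟩
  rintro _ ⟨z, rfl⟩
  rw [Scheme.Hom.comp_apply]
  exact hg ((Spec.mem_range_away g _).mp ⟨z, rfl⟩)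

lemma mem_range_away_comp {C : CommRingCat.{u}} (c : Spec C ⟶ X) (p : Spec C) {g : C}
    (hg : g ∉ p.asIdeal) : c p ∈ Set.range (Spec.away g ≫ c) := by
  obtain ⟨z, rfl⟩ := (Spec.mem_range_away g p).mpr hg
  exact ⟨z, Scheme.Hom.comp_apply _ _ _⟩

lemma flat_of_isOpenImmersion_SpecMap {C C' : CommRingCat.{u}} (f : C ⟶ C')
    [IsOpenImmersion (Spec.map f)] : f.hom.Flat :=
  Flat.SpecMap_iff.mp inferInstance

/-- Charts of an effective Cartier divisor can be chosen arbitrarily small. -/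
lemma IsEffectiveCartier.exists_chart_le (h : IsEffectiveCartier I) (x : X) (V : X.Opens)
    (hV : x ∈ V) : ∃ (C : CommRingCat.{u}) (c : Spec C ⟶ X), IsOpenImmersion c ∧
      x ∈ Set.range c ∧ Set.range c ⊆ V ∧ ∃ t ∈ nonZeroDivisors C, I.on c = Ideal.span {t} := by
  obtain ⟨C, c, hc, ⟨p, rfl⟩, t, ht, h⟩ := isEffectiveCartier_iff.mp h x
  obtain ⟨g, hg, hgV⟩ := exists_away_range_le c p V hV
  refine ⟨_, Spec.away g ≫ c, inferInstance, mem_range_away_comp c p hg, hgV, _,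
    map_mem_nonZeroDivisors_of_flat (flat_of_isOpenImmersion_SpecMap
      (CommRingCat.ofHom (algebraMap C (Localization.Away g)))) ht, ?_⟩
  rw [on_SpecMap_comp, h, Ideal.map_span, Set.image_singleton]

lemma IsEffectiveCartier.comap (h : IsEffectiveCartier I) (f : Y ⟶ X) [IsOpenImmersion f] :
    IsEffectiveCartier (I.comap f) := by
  rw [isEffectiveCartier_iff]
  intro y
  obtain ⟨C, c, hc, ⟨p, hp⟩, hV, t, ht, h⟩ := h.exists_chart_le (f y) f.opensRange ⟨y, rfl⟩
  replace hV : Set.range c ⊆ Set.range f := hV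
  refine ⟨C, IsOpenImmersion.lift f c hV, inferInstance, ⟨p, f.isOpenEmbedding.injective ?_⟩, t, ht,
    ?_⟩
  · rw [← Scheme.Hom.comp_apply, IsOpenImmersion.lift_fac, hp]
  · rw [on_comap, IsOpenImmersion.lift_fac, h]

lemma IsEffectiveCartier.isLocallyPrincipalNonzerodivisor (h : IsEffectiveCartier I)
    {C : CommRingCat.{u}} (c : Spec C ⟶ X) [IsOpenImmersion c] :
    (I.on c).IsLocallyPrincipalNonzerodivisor := by
  intro p
  obtain ⟨C', c', hc', ⟨p', hp'⟩, -, t, ht, h⟩ := (h.comap c).exists_chart_le p ⊤ trivial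
  obtain ⟨g, hg, hgV⟩ := exists_away_range_le (𝟙 (Spec C)) p c'.opensRange ⟨p', hp'⟩
  rw [Category.comp_id] at hgV
  replace hgV : Set.range (Spec.away g) ⊆ Set.range c' := hgV
  obtain ⟨f, hf⟩ := Spec.map_surjective (IsOpenImmersion.lift c' _ hgV)
  have hf' : Spec.map f ≫ c' = Spec.away g := by rw [hf, IsOpenImmersion.lift_fac]
  have : IsOpenImmersion (Spec.map f) := hf ▸ inferInstance
  refine ⟨g, hg, f.hom t, map_mem_nonZeroDivisors_of_flat (flat_of_isOpenImmersion_SpecMap f) ht, ?_⟩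
  have := on_SpecMap_comp (I.comap c) f c'
  rw [hf', h, Ideal.map_span, Set.image_singleton, on_comap, on_SpecMap_comp] at this
  exact this

end AlgebraicGeometry

/-! ### Properness, flatness and finite presentation of the pinched scheme. -/

namespace AlgebraicGeometry

lemma isZariskiLocalAtSource_flat : IsZariskiLocalAtSource @Flat.{u} :=
  @HasRingHomProperty.instIsZariskiLocalAtSource _ _ (inferInstance : HasRingHomProperty @Flat _)

lemma isZariskiLocalAtSource_locallyOfFinitePresentation :
    IsZariskiLocalAtSource @LocallyOfFinitePresentation.{u} :=
  @HasRingHomProperty.instIsZariskiLocalAtSource _ _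
    (inferInstance : HasRingHomProperty @LocallyOfFinitePresentation _)

attribute [local instance] isZariskiLocalAtSource_flat
  isZariskiLocalAtSource_locallyOfFinitePresentation

lemma of_comp_mono (P : MorphismProperty Scheme.{u}) [P.IsStableUnderBaseChange]
    {X Y Z : Scheme.{u}} (f : X ⟶ Y) (s : Y ⟶ Z) [Mono s] (h : P (f ≫ s)) : P f :=
  P.of_postcomp (W' := MorphismProperty.monomorphisms _) f s (inferInstanceAs (Mono s)) h

/-- Separatedness over a base descends along surjective universally closed morphisms. -/
lemma IsSeparated.of_comp_surjective {X Y Z : Scheme.{u}} (f : X ⟶ Y) (g : Y ⟶ Z)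
    [UniversallyClosed f] [Surjective f] [IsSeparated (f ≫ g)] : IsSeparated g := by
  constructor
  refine .of_isPreimmersion _ ?_
  let m : pullback (f ≫ g) (f ≫ g) ⟶ pullback g g :=
    pullback.map _ _ _ _ f f (𝟙 Z) (by simp) (by simp)
  have hm : pullback.diagonal (f ≫ g) ≫ m = f ≫ pullback.diagonal g := by
    apply pullback.hom_ext
    · rw [Category.assoc, pullback.lift_fst, pullback.diagonal_fst_assoc, Category.assoc,
        pullback.diagonal_fst, Category.comp_id]
    · rw [Category.assoc, pullback.lift_snd, pullback.diagonal_snd_assoc, Category.assoc,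
        pullback.diagonal_snd, Category.comp_id]
  have hm' : UniversallyClosed m :=
    MorphismProperty.pullbackMap (P := @UniversallyClosed) ‹_› ‹_› rfl rfl
  -- Because `f` is surjective, the diagonal of `g` is the image of the diagonal of `f ≫ g` under
  -- the closed map `m = f × f`.
  have : Set.range (pullback.diagonal g) = m '' Set.range (pullback.diagonal (f ≫ g)) := by
    rw [← Set.range_comp, ← f.surjective.range_comp]
    congr 1
    ext x
    exact (Scheme.comp_eq_apply hm x).symm
  rw [this]
  exact m.isClosedMap _ (pullback.diagonal (f ≫ g)).isClosedEmbedding.isClosed_range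

lemma isProper_coprod_desc {X Y Z : Scheme.{u}} (f : X ⟶ Z) (g : Y ⟶ Z) [IsProper f]
    [IsProper g] : IsProper (coprod.desc f g) := by
  have : IsProper (coprod.map f g) :=
    IsZariskiLocalAtTarget.coprodMap (P := @IsProper) f g inferInstance inferInstance
  have e : coprod.desc f g = coprod.map f g ≫ coprod.desc (𝟙 Z) (𝟙 Z) := by simp
  have : IsFinite (coprod.desc (𝟙 Z) (𝟙 Z)) := inferInstance
  rw [e]
  infer_instance

open Scheme.IdealSheafData in
/-- A closed immersion on an affine chart. -/
lemma IsClosedImmersion.exists_isPullback {D X : Scheme.{u}} (j : D ⟶ X) [IsClosedImmersion j]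
    {I : X.IdealSheafData} (hI : j.ker = I) {C : CommRingCat.{u}} (c : Spec C ⟶ X) :
    ∃ k : Spec (.of (C ⧸ I.on c)) ⟶ D,
      IsPullback (Spec.map (CommRingCat.ofHom (Ideal.Quotient.mk (I.on c)))) k c j := by
  have hc : IsClosedImmersion (Spec.map (CommRingCat.ofHom (Ideal.Quotient.mk (I.on c)))) :=
    IsClosedImmersion.spec_of_surjective _ Ideal.Quotient.mk_surjective
  have hI' : I.comap c = (Spec.map (CommRingCat.ofHom (Ideal.Quotient.mk (I.on c)))).ker := by
    apply specIdeal_injective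
    rw [specIdeal_ker, CommRingCat.hom_ofHom, Ideal.mk_ker, on]
  have hle : j.ker ≤
      (Spec.map (CommRingCat.ofHom (Ideal.Quotient.mk (I.on c))) ≫ c).ker := by
    rw [← map_ker, le_map_iff_comap_le, hI, hI']
  refine ⟨IsClosedImmersion.lift j _ hle, isPullback_of_isClosedImmersion _ _ _ _ ?_ ?_⟩
  · rw [IsClosedImmersion.lift_fac]
  · rw [hI, hI']

section

variable {X' D' D X S : Scheme.{u}} {i : D' ⟶ X'} {q : D' ⟶ D} {ν : X' ⟶ X} {j : D ⟶ X}

/-- A chart of a pinching square on which a morphism to `S` is given by a ring homomorphism. -/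
lemma IsPinching.exists_chart_over (h : IsPinching i q ν j) (p : X ⟶ S) (x : X) :
    ∃ (c : PinchingChart i q ν j) (R : CommRingCat.{u}) (s : Spec R ⟶ S) (r : R ⟶ c.A),
      IsOpenImmersion s ∧ x ∈ Set.range c.a ∧ c.a ≫ p = Spec.map r ≫ s := by
  obtain ⟨R, s, hs, hxs, -⟩ :=
    Scheme.exists_affine_mem_range_and_range_subset (x := p x) (U := ⊤) trivial
  obtain ⟨c, hc, hcV⟩ := h.exists_chart_le x (p ⁻¹ᵁ s.opensRange) hxs
  have hcV' : Set.range (c.a ≫ p) ⊆ Set.range s := by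
    rintro _ ⟨z, rfl⟩
    rw [Scheme.Hom.comp_apply]
    exact hcV ⟨z, rfl⟩
  obtain ⟨r, hr⟩ := Spec.map_surjective (IsOpenImmersion.lift s _ hcV')
  exact ⟨c, R, s, r, hs, hc, by rw [hr, IsOpenImmersion.lift_fac]⟩

namespace PinchingChart

variable (c : PinchingChart i q ν j) {p : X ⟶ S} {R : CommRingCat.{u}} {s : Spec R ⟶ S} {r : R ⟶ c.A}
  [IsOpenImmersion s] (hr : c.a ≫ p = Spec.map r ≫ s)

include hr in
lemma of_comp_ν (P : MorphismProperty Scheme.{u}) [P.IsStableUnderBaseChange]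
    [IsZariskiLocalAtSource P] (h : P (ν ≫ p)) : P (Spec.map (r ≫ c.φ)) := by
  refine of_comp_mono P _ s ?_
  rw [Spec.map_comp, Category.assoc, ← hr, ← Category.assoc, ← c.a'_comp, Category.assoc]
  exact IsZariskiLocalAtSource.comp h c.a'

include hr in
lemma of_comp_j (P : MorphismProperty Scheme.{u}) [P.IsStableUnderBaseChange]
    [IsZariskiLocalAtSource P] (h : P (j ≫ p)) : P (Spec.map (r ≫ c.ψ)) := by
  refine of_comp_mono P _ s ?_
  rw [Spec.map_comp, Category.assoc, ← hr, ← Category.assoc, ← c.b_comp, Category.assoc]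
  exact IsZariskiLocalAtSource.comp h c.b

include hr in
lemma of_comp_i (P : MorphismProperty Scheme.{u}) [P.IsStableUnderBaseChange]
    [IsZariskiLocalAtSource P] (h : P (i ≫ ν ≫ p)) : P (Spec.map (r ≫ c.φ ≫ c.π)) := by
  refine of_comp_mono P _ s ?_
  rw [Spec.map_comp, Spec.map_comp, Category.assoc, Category.assoc, ← hr, ← Category.assoc _ _ p,
    ← c.a'_comp, Category.assoc, ← Category.assoc, ← c.b'_comp_i, Category.assoc]
  exact IsZariskiLocalAtSource.comp h c.b'

lemma isLocallyPrincipalNonzerodivisor [IsClosedImmersion i] (hi : IsEffectiveCartier i.ker) :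
    (RingHom.ker c.π.hom).IsLocallyPrincipalNonzerodivisor := by
  rw [← Scheme.IdealSheafData.on_ker_of_isPullback c.isPullback_i]
  exact hi.isLocallyPrincipalNonzerodivisor c.a'

end PinchingChart

namespace IsPinching

variable (h : IsPinching i q ν j) {p : X ⟶ S}

include h

lemma flat (hX' : Flat (ν ≫ p)) (hD : Flat (j ≫ p)) (hD' : Flat (i ≫ ν ≫ p)) : Flat p := by
  refine IsZariskiLocalAtSource.of_forall_comp _ p fun x ↦ ?_
  obtain ⟨c, R, s, r, hs, hc, hr⟩ := h.exists_chart_over p x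
  refine ⟨_, c.a, inferInstance, hc, ?_⟩
  have : Flat (Spec.map r) := Flat.SpecMap_iff.mpr (c.isFiberSquare.flat c.surjective r.hom
    (Flat.SpecMap_iff.mp (c.of_comp_ν hr @Flat hX'))
    (Flat.SpecMap_iff.mp (c.of_comp_j hr @Flat hD))
    (Flat.SpecMap_iff.mp (c.of_comp_i hr @Flat hD')))
  rw [hr]
  infer_instance

lemma locallyOfFinitePresentation [IsClosedImmersion i] (hi : IsEffectiveCartier i.ker)
    (hX' : LocallyOfFinitePresentation (ν ≫ p)) (hD : LocallyOfFinitePresentation (j ≫ p)) :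
    LocallyOfFinitePresentation p := by
  refine IsZariskiLocalAtSource.of_forall_comp _ p fun x ↦ ?_
  obtain ⟨c, R, s, r, hs, hc, hr⟩ := h.exists_chart_over p x
  refine ⟨_, c.a, inferInstance, hc, ?_⟩
  have : LocallyOfFinitePresentation (Spec.map r) := (LocallyOfFinitePresentation.SpecMap_iff _).mpr
    (c.isFiberSquare.finitePresentation c.surjective c.isIntegral
      (c.isLocallyPrincipalNonzerodivisor hi) r.hom
      ((LocallyOfFinitePresentation.SpecMap_iff _).mp
        (c.of_comp_ν hr @LocallyOfFinitePresentation hX'))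
      ((LocallyOfFinitePresentation.SpecMap_iff _).mp
        (c.of_comp_j hr @LocallyOfFinitePresentation hD)))
  rw [hr]
  infer_instance

lemma flat_pow [IsClosedImmersion i] (hi : IsEffectiveCartier i.ker)
    (hD : Flat (j ≫ p)) (hD' : Flat (i ≫ ν ≫ p)) (m : ℕ) :
    Flat ((j.ker ^ m).subschemeι ≫ p) := by
  have hj := h.isClosedImmersion
  refine IsZariskiLocalAtSource.of_forall_comp _ _ fun x ↦ ?_
  obtain ⟨c, R, s, r, hs, hc, hr⟩ := h.exists_chart_over p ((j.ker ^ m).subschemeι x)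
  obtain ⟨k, hk⟩ := IsClosedImmersion.exists_isPullback (j.ker ^ m).subschemeι
    (Scheme.IdealSheafData.ker_subschemeι _) c.a
  have hon : (j.ker ^ m).on c.a = RingHom.ker c.ψ.hom ^ m := by
    rw [Scheme.IdealSheafData.on_pow, Scheme.IdealSheafData.on_ker_of_isPullback c.isPullback_j]
  have hfl : Flat (Spec.map (CommRingCat.ofHom (Ideal.Quotient.mk ((j.ker ^ m).on c.a))) ≫
      Spec.map r) := by
    rw [← Spec.map_comp, Flat.SpecMap_iff, hon]
    exact c.isFiberSquare.flat_quotient_ker_pow c.surjective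
      (c.isLocallyPrincipalNonzerodivisor hi) r.hom
      (Flat.SpecMap_iff.mp (c.of_comp_j hr @Flat hD))
      (Flat.SpecMap_iff.mp (c.of_comp_i hr @Flat hD')) m
  refine ⟨_, k, MorphismProperty.of_isPullback hk inferInstance, ?_, ?_⟩
  · obtain ⟨y, hy⟩ := hc
    obtain ⟨z, -, hz⟩ := Scheme.exists_preimage_of_isPullback hk y x hy
    exact ⟨z, hz⟩
  · rw [← Category.assoc, ← hk.w, Category.assoc, hr, ← Category.assoc]
    infer_instance

/-- The morphism `X' ⨿ D → X` is integral and surjective, and its source is proper over `S`;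
universal closedness and separatedness descend along it, and finite type comes from `hp`. -/
lemma isProper (hX' : IsProper (ν ≫ p)) (hD : IsProper (j ≫ p))
    (hp : LocallyOfFinitePresentation p) : IsProper p := by
  have hj := h.isClosedImmersion
  have hν := h.isIntegralHom
  have : IsIntegralHom (coprod.desc ν j) := inferInstance
  have : Surjective (coprod.desc ν j) := by
    constructor
    intro x
    refine h.forall_point (P := fun x ↦ ∃ y, coprod.desc ν j y = x) (fun y ↦ ?_) (fun d ↦ ?_) x
    · exact ⟨(coprod.inl : X' ⟶ X' ⨿ D) y, by rw [← Scheme.Hom.comp_apply, coprod.inl_desc]⟩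
    · exact ⟨(coprod.inr : D ⟶ X' ⨿ D) d, by rw [← Scheme.Hom.comp_apply, coprod.inr_desc]⟩
  have : IsProper (coprod.desc ν j ≫ p) := by
    rw [coprod.desc_comp]
    exact isProper_coprod_desc _ _
  have : UniversallyClosed p := .of_comp_surjective (coprod.desc ν j) p
  have : IsSeparated p := .of_comp_surjective (coprod.desc ν j) p
  exact { }

lemma isProperFlatFP [IsClosedImmersion i] (hi : IsEffectiveCartier i.ker)
    (hX' : IsProperFlatFP (ν ≫ p)) (hD : IsProperFlatFP (j ≫ p))
    (hD' : IsProperFlatFP (i ≫ ν ≫ p)) : IsProperFlatFP p :=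
  have hp := h.locallyOfFinitePresentation hi hX'.finitePresentation hD.finitePresentation
  ⟨h.isProper hX'.proper hD.proper hp, h.flat hX'.flat hD.flat hD'.flat, hp⟩

end IsPinching

end

end AlgebraicGeometry

/-! ### Blowups, and pinchings as blowups. -/

namespace AlgebraicGeometry

/-- Lifts of a morphism exist if they exist locally and are locally unique. -/
lemma Scheme.existsUnique_lift_of_forall {B X T : Scheme.{u}} (b : B ⟶ X) (f : T ⟶ X)
    (huniq : ∀ (U : Scheme.{u}) (t : U ⟶ T) [IsOpenImmersion t] (g g' : U ⟶ B),
      g ≫ b = t ≫ f → g' ≫ b = t ≫ f → g = g')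
    (H : ∀ x : T, ∃ (U : Scheme.{u}) (t : U ⟶ T) (g : U ⟶ B), IsOpenImmersion t ∧
      x ∈ Set.range t ∧ g ≫ b = t ≫ f) : ∃! g : T ⟶ B, g ≫ b = f := by
  choose U t g ht hx hg using H
  let 𝒰 := Scheme.openCoverOfPoints U t ht hx
  have hglue (k l : T) : pullback.fst (t k) (t l) ≫ g k = pullback.snd (t k) (t l) ≫ g l := by
    refine huniq _ (pullback.fst (t k) (t l) ≫ t k) _ _ ?_ ?_
    · rw [Category.assoc, hg, Category.assoc]
    · rw [Category.assoc, hg, pullback.condition, Category.assoc]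
  refine ⟨𝒰.glueMorphisms g hglue, 𝒰.hom_ext _ _ fun k ↦ ?_, fun g' hg' ↦ ?_⟩
  · exact (𝒰.ι_glueMorphisms_assoc g hglue k b).trans (hg k)
  · refine 𝒰.hom_ext _ _ fun k ↦ Eq.trans ?_ (𝒰.ι_glueMorphisms g hglue k).symm
    have := ht k
    exact huniq _ (t k) _ _ (by rw [← hg']; exact Category.assoc _ _ _) (hg k)

/-- The ring homomorphism `φ` has the universal property of the blowup of the ideal `K`. -/
def _root_.RingHom.IsBlowupAlgebra {A A' : Type u} [CommRing A] [CommRing A'] (φ : A →+* A')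
    (K : Ideal A) : Prop :=
  ∀ (C : Type u) [CommRing C] (θ : A →+* C) (t : C), t ∈ nonZeroDivisors C →
    K.map θ = Ideal.span {t} → ∃! θ' : A' →+* C, θ'.comp φ = θ

open Scheme.IdealSheafData in
/-- A morphism which locally on the target is dual to a ring homomorphism with the universal property
of the blowup is a blowup. -/
lemma IsBlowup.of_charts {B X : Scheme.{u}} {b : B ⟶ X} {I : X.IdealSheafData}
    (hI : IsEffectiveCartier (I.comap b))
    (H : ∀ x : X, ∃ (A A' : CommRingCat.{u}) (φ : A ⟶ A') (a : Spec A ⟶ X) (a' : Spec A' ⟶ B),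
      IsOpenImmersion a ∧ x ∈ Set.range a ∧ IsPullback (Spec.map φ) a' a b ∧
        φ.hom.IsBlowupAlgebra (I.on a)) : IsBlowup b I := by
  refine ⟨hI, fun T f hf ↦ ?_⟩
  -- On a small affine chart the ideal of the centre is principal and `f` lands in one chart of `X`,
  -- so lifting `f` becomes the extension problem of `IsBlowupAlgebra`.
  have chart {U : Scheme.{u}} (f : U ⟶ X) (hf : IsEffectiveCartier (I.comap f)) (x : U) :
      ∃ (A A' : CommRingCat.{u}) (φ : A ⟶ A') (a : Spec A ⟶ X) (a' : Spec A' ⟶ B)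
        (C : CommRingCat.{u}) (s : Spec C ⟶ U) (θ : A ⟶ C), IsOpenImmersion s ∧ x ∈ Set.range s ∧
        IsOpenImmersion a ∧ IsPullback (Spec.map φ) a' a b ∧ s ≫ f = Spec.map θ ≫ a ∧
        ∃! θ' : A' →+* C, θ'.comp φ.hom = θ.hom := by
    obtain ⟨A, A', φ, a, a', ha, hc, hp, hu⟩ := H (f x)
    obtain ⟨C, s, hs, hx, hsV, t, ht, ht'⟩ := hf.exists_chart_le x (f ⁻¹ᵁ a.opensRange) hc
    have hr : Set.range (s ≫ f) ⊆ Set.range a := by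
      rintro _ ⟨z, rfl⟩
      rw [Scheme.Hom.comp_apply]
      exact hsV ⟨z, rfl⟩
    obtain ⟨θ, hθ⟩ := Spec.map_surjective (IsOpenImmersion.lift a _ hr)
    have hθ' : s ≫ f = Spec.map θ ≫ a := by rw [hθ, IsOpenImmersion.lift_fac]
    refine ⟨A, A', φ, a, a', C, s, θ, hs, hx, ha, hp, hθ', hu C θ.hom t ht ?_⟩
    rw [← ht', on_comap, hθ', on_SpecMap_comp]
  refine Scheme.existsUnique_lift_of_forall b f ?_ fun x ↦ ?_
  · intro U t _ g g' hg hg'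
    refine Scheme.hom_ext_of_forall_mem_range _ _ fun x ↦ ?_
    have hf' := hf.comap t
    rw [← comap_comp] at hf'
    obtain ⟨A, A', φ, a, a', C, s, θ, hs, hx, ha, hp, hθ, huniq⟩ := chart _ hf' x
    have key (g : U ⟶ B) (hg : g ≫ b = t ≫ f) :
        ∃ θ' : A' ⟶ C, θ'.hom.comp φ.hom = θ.hom ∧ s ≫ g = Spec.map θ' ≫ a' := by
      have e : Spec.map θ ≫ a = (s ≫ g) ≫ b := by rw [← hθ, Category.assoc, hg]
      obtain ⟨θ', hθ'⟩ := Spec.map_surjective (hp.lift _ _ e)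
      refine ⟨θ', ?_, by rw [hθ', hp.lift_snd]⟩
      have : Spec.map (φ ≫ θ') = Spec.map θ := by rw [Spec.map_comp, hθ', hp.lift_fst]
      exact congr(($(Spec.map_injective this)).hom)
    obtain ⟨θ₁, h₁, e₁⟩ := key g hg
    obtain ⟨θ₂, h₂, e₂⟩ := key g' hg'
    have : θ₁ = θ₂ := CommRingCat.hom_ext (huniq.unique h₁ h₂)
    exact ⟨_, s, hs, hx, by rw [e₁, e₂, this]⟩
  · obtain ⟨A, A', φ, a, a', C, s, θ, hs, hx, ha, hp, hθ, θ', hθ', -⟩ := chart f hf x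
    refine ⟨_, s, Spec.map (CommRingCat.ofHom θ') ≫ a', hs, hx, ?_⟩
    rw [Category.assoc, ← hp.w, hθ, ← Spec.map_comp_assoc]
    congr 2
    exact CommRingCat.hom_ext hθ'

namespace IsPinching

open Scheme.IdealSheafData

variable {X' D' D X : Scheme.{u}} {i : D' ⟶ X'} {q : D' ⟶ D} {ν : X' ⟶ X} {j : D ⟶ X}
  (h : IsPinching i q ν j)

include h

lemma comap_ker [IsClosedImmersion i] : j.ker.comap ν = i.ker := by
  have hj := h.isClosedImmersion
  refine ext_on fun x ↦ ?_
  obtain ⟨c, hc⟩ := h.exists_chart (ν x)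
  refine ⟨_, c.a', inferInstance, c.mem_range_a'.mpr hc, ?_⟩
  rw [on_comap, c.a'_comp, on_SpecMap_comp, on_ker_of_isPullback c.isPullback_j,
    on_ker_of_isPullback c.isPullback_i, c.isFiberSquare.map_ker]

/-- Identifies `D'` with the preimage of `D`, that is, with the exceptional divisor. -/
lemma isPullback [IsClosedImmersion i] : IsPullback i q ν j :=
  have := h.isClosedImmersion
  isPullback_of_isClosedImmersion _ _ _ _ h.w h.comap_ker

omit h in
lemma of_iso {X₁ : Scheme.{u}} (h : IsPinching i q ν j) (e : X ≅ X₁) :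
    IsPinching i q (ν ≫ e.hom) (j ≫ e.hom) where
  w := by rw [← Category.assoc, h.w, Category.assoc]
  exists_chart x := by
    obtain ⟨c, z, hz⟩ := h.exists_chart (e.inv x)
    have hpre : e.hom ⁻¹ᵁ (c.a ≫ e.hom).opensRange = c.a.opensRange := by
      rw [Scheme.Hom.opensRange_comp, Scheme.Hom.preimage_image_eq]
    exact ⟨{ c with
      a := c.a ≫ e.hom
      a'_comp := by rw [← Category.assoc, c.a'_comp, Category.assoc]
      b_comp := by rw [← Category.assoc, c.b_comp, Category.assoc]
      open_a := inferInstance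
      open_a' := c.open_a'
      open_b := c.open_b
      open_b' := c.open_b'
      preimage_ν := by rw [Scheme.Hom.comp_preimage, hpre, c.preimage_ν]
      preimage_j := by rw [Scheme.Hom.comp_preimage, hpre, c.preimage_j] }, z, by
        change (c.a ≫ e.hom) z = x
        rw [Scheme.Hom.comp_apply, hz, ← Scheme.Hom.comp_apply, e.inv_hom_id]
        rfl⟩

lemma isBlowup [IsClosedImmersion i] (hi : IsEffectiveCartier i.ker) : IsBlowup ν j.ker := by
  have hj := h.isClosedImmersion
  refine .of_charts (by rwa [h.comap_ker]) fun x ↦ ?_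
  obtain ⟨c, hc⟩ := h.exists_chart x
  refine ⟨_, _, c.φ, c.a, c.a', inferInstance, hc, c.isPullback_ν, fun C _ θ t ht hθ ↦ ?_⟩
  rw [on_ker_of_isPullback c.isPullback_j] at hθ
  exact c.isFiberSquare.existsUnique_extension θ ht hθ

end IsPinching

lemma IsBlowup.existsUnique_iso {B B' X : Scheme.{u}} {b : B ⟶ X} {b' : B' ⟶ X}
    {I : X.IdealSheafData} (h : IsBlowup b I) (h' : IsBlowup b' I) :
    ∃! e : B ≅ B', e.hom ≫ b' = b := by
  obtain ⟨f, hf, hf'⟩ := h'.existsUnique_lift B b h.isEffectiveCartier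
  obtain ⟨g, hg, -⟩ := h.existsUnique_lift B' b' h'.isEffectiveCartier
  have h₁ := (h.existsUnique_lift B b h.isEffectiveCartier).unique (y₁ := f ≫ g) (y₂ := 𝟙 _)
    (by rw [Category.assoc, hg, hf]) (Category.id_comp _)
  have h₂ := (h'.existsUnique_lift B' b' h'.isEffectiveCartier).unique (y₁ := g ≫ f) (y₂ := 𝟙 _)
    (by rw [Category.assoc, hf, hg]) (Category.id_comp _)
  exact ⟨⟨f, g, h₁, h₂⟩, hf, fun e he ↦ Iso.ext (hf' _ he)⟩

/-- Blowups of the same centre are isomorphic, compatibly with their exceptional divisors. -/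
lemma IsBlowup.existsUnique_iso_pair {X' D' D X B : Scheme.{u}} {i : D' ⟶ X'} {q : D' ⟶ D}
    {ν : X' ⟶ X} {j : D ⟶ X} {b : B ⟶ X} (hp : IsPullback i q ν j) {I : X.IdealSheafData}
    (hν : IsBlowup ν I) (hb : IsBlowup b I) :
    ∃! e : (X' ≅ B) × (D' ≅ pullback b j), e.1.hom ≫ b = ν ∧
      e.2.hom ≫ pullback.fst b j = i ≫ e.1.hom ∧ e.2.hom ≫ pullback.snd b j = q := by
  obtain ⟨e, he, he'⟩ := hν.existsUnique_iso hb
  have hp' : IsPullback (i ≫ e.hom) q b j :=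
    hp.of_iso (.refl _) e (.refl _) (.refl _) (by simp) (by simp) (by simp [he]) (by simp)
  refine ⟨(e, hp'.isoPullback), ⟨he, by simp, by simp⟩, ?_⟩
  rintro ⟨e₁, e₂⟩ ⟨h₁, h₂, h₃⟩
  dsimp at h₁ h₂ h₃
  obtain rfl := he' e₁ h₁
  congr 1
  ext : 1
  apply pullback.hom_ext
  · rw [h₂, hp'.isoPullback_hom_fst]
  · rw [h₃, hp'.isoPullback_hom_snd]

open Scheme.IdealSheafData in
/-- Blowups are stable under restriction to open subschemes of the target. -/
lemma IsBlowup.of_isPullback {B X B' U : Scheme.{u}} {b : B ⟶ X} {I : X.IdealSheafData}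
    (h : IsBlowup b I) {a' : B' ⟶ B} {b' : B' ⟶ U} {a : U ⟶ X} [IsOpenImmersion a]
    (hp : IsPullback a' b' b a) : IsBlowup b' (I.comap a) where
  isEffectiveCartier := by
    have : IsOpenImmersion a' := MorphismProperty.of_isPullback hp.flip inferInstance
    rw [← comap_comp, ← hp.w, comap_comp]
    exact h.isEffectiveCartier.comap a'
  existsUnique_lift T f hf := by
    rw [← comap_comp] at hf
    obtain ⟨g, hg, hg'⟩ := h.existsUnique_lift T _ hf
    refine ⟨hp.lift g f hg, hp.lift_snd _ _ _, fun k hk ↦ hp.hom_ext ?_ ?_⟩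
    · rw [hp.lift_fst, hg' (k ≫ a') (by
        change (k ≫ a') ≫ b = f ≫ a
        rw [Category.assoc, hp.w, ← Category.assoc]
        exact congr($hk ≫ a))]
    · rw [hp.lift_snd, hk]

open Scheme.IdealSheafData in
lemma isEffectiveCartier_top {X : Scheme.{u}} : IsEffectiveCartier (⊤ : X.IdealSheafData) := by
  intro x
  obtain ⟨U, hU, hx, -⟩ := TopologicalSpace.Opens.isBasis_iff_nbhd.mp X.isBasis_affineOpens
    (show x ∈ (⊤ : X.Opens) from trivial)
  exact ⟨⟨U, hU⟩, hx, 1, one_mem _, by rw [Ideal.span_singleton_one]; rfl⟩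

open Scheme.IdealSheafData in
lemma IsBlowup.isIso {B X : Scheme.{u}} {b : B ⟶ X} (h : IsBlowup b ⊤) : IsIso b := by
  have h' : IsBlowup (𝟙 X) ⊤ := by
    refine ⟨?_, fun T f hf ↦ ⟨f, Category.comp_id f, fun g hg ↦ (Category.comp_id g).symm.trans hg⟩⟩
    rw [comap_id]
    exact isEffectiveCartier_top
  obtain ⟨e, he, -⟩ := h.existsUnique_iso h'
  rw [Category.comp_id] at he
  rw [← he]
  infer_instance

open Scheme.IdealSheafData in
lemma isEffectiveCartier_of_isLocallyPrincipalNonzerodivisor {C : CommRingCat.{u}}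
    {I : (Spec C).IdealSheafData} (h : I.specIdeal.IsLocallyPrincipalNonzerodivisor) :
    IsEffectiveCartier I := by
  rw [isEffectiveCartier_iff]
  intro p
  obtain ⟨g, hg, t, ht, h⟩ := h p
  exact ⟨_, Spec.away g, inferInstance, (Spec.mem_range_away g p).mpr hg, t, ht, by
    rw [on, specIdeal_comap]; exact h⟩

open Scheme.IdealSheafData in
/-- A ring homomorphism with the universal property of the blowup gives a blowup. -/
lemma isBlowup_SpecMap {A A' : CommRingCat.{u}} (φ : A ⟶ A') (I : (Spec A).IdealSheafData)
    (h : (I.specIdeal.map φ.hom).IsLocallyPrincipalNonzerodivisor)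
    (h' : φ.hom.IsBlowupAlgebra I.specIdeal) : IsBlowup (Spec.map φ) I := by
  refine .of_charts (isEffectiveCartier_of_isLocallyPrincipalNonzerodivisor ?_) fun x ↦
    ⟨A, A', φ, 𝟙 _, 𝟙 _, inferInstance, ⟨x, rfl⟩, IsPullback.of_vert_isIso ⟨by simp⟩, ?_⟩
  · rwa [specIdeal_comap]
  · rwa [on, comap_id]

/-- Pinchings of a scheme along a divisor with finite maps to the base of the pinching exist. -/
lemma exists_isPinching {X' D' D : Scheme.{u}} {i : D' ⟶ X'} {q : D' ⟶ D} [IsClosedImmersion i]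
    [IsFinite q] (H : ∀ y : D, ∃ U : X'.affineOpens, ∀ z : D', q z = y → i z ∈ U.1) :
    ∃ (X : Scheme.{u}) (ν : X' ⟶ X) (j : D ⟶ X), IsPinching i q ν j := by
  have hD (y : D) : ∃ P : AffinePair i q, y ∈ P.W := by
    obtain ⟨U, hU⟩ := H y
    exact AffinePair.exists_mem_W y U.1 U.2 hU
  exact AffinePair.exists_isPinching (AffinePair.exists_mem_U hD) hD

/-- Pushouts along pinchings are pinching squares. -/
lemma isPinching_of_isPushout {X' D' D X : Scheme.{u}} {i : D' ⟶ X'} {q : D' ⟶ D} {ν : X' ⟶ X}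
    {j : D ⟶ X} [IsClosedImmersion i] [IsFinite q]
    (H : ∀ y : D, ∃ U : X'.affineOpens, ∀ z : D', q z = y → i z ∈ U.1)
    (h : IsPushout i q ν j) : IsPinching i q ν j := by
  obtain ⟨X₀, ν₀, j₀, h₀⟩ := exists_isPinching H
  have := h₀.of_iso (h₀.isPushout.isoIsPushout _ _ h)
  rwa [h₀.isPushout.inl_isoIsPushout_hom, h₀.isPushout.inr_isoIsPushout_hom] at this

end AlgebraicGeometry

/-! ### Forms on the blowup and homogeneous prime avoidance. -/

namespace Ideal

section

variable {A : Type*} [CommRing A] {K : Ideal A} {C : Type*} [CommRing C]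

/-- The element `f`, viewed as a form of degree `n`, does not vanish at `p` when divided by the
`n`-th power of the equation `t`. -/
def NonvanishingAt (θ : A →+* C) (t : C) (p : Ideal C) (n : ℕ) (f : A) : Prop :=
  ∃ a ∉ p, θ f = a * t ^ n

variable {θ : A →+* C} {t : C} (ht : t ∈ nonZeroDivisors C) (hK : K.map θ = span {t})
  {p : Ideal C}

include hK in
lemma exists_map_eq_mul_pow {n : ℕ} {f : A} (hf : f ∈ K ^ n) : ∃ a, θ f = a * t ^ n := by
  have := mem_map_of_mem θ hf
  rw [Ideal.map_pow, hK, span_singleton_pow, mem_span_singleton'] at this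
  obtain ⟨a, ha⟩ := this
  exact ⟨a, ha.symm⟩

include ht in
lemma eq_of_mul_pow_eq {n : ℕ} {a b : C} (h : a * t ^ n = b * t ^ n) : a = b :=
  (mul_cancel_right_mem_nonZeroDivisors (pow_mem ht n)).mp h

namespace NonvanishingAt

include ht in
lemma notMem {n : ℕ} {f : A} (h : NonvanishingAt θ t p n f) {a : C} (ha : θ f = a * t ^ n) :
    a ∉ p := by
  obtain ⟨b, hb, hf⟩ := h
  rwa [eq_of_mul_pow_eq ht (ha.symm.trans hf)]

include ht hK in
lemma mul_iff [p.IsPrime] {n m : ℕ} {f g : A} (hf : f ∈ K ^ n) (hg : g ∈ K ^ m) :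
    NonvanishingAt θ t p (n + m) (f * g) ↔
      NonvanishingAt θ t p n f ∧ NonvanishingAt θ t p m g := by
  obtain ⟨a, ha⟩ := exists_map_eq_mul_pow hK hf
  obtain ⟨b, hb⟩ := exists_map_eq_mul_pow hK hg
  have e : θ (f * g) = a * b * t ^ (n + m) := by rw [map_mul, ha, hb]; ring
  refine ⟨fun h ↦ ?_, fun ⟨h₁, h₂⟩ ↦ ⟨a * b, ?_, e⟩⟩
  · have := h.notMem ht e
    exact ⟨⟨a, fun h' ↦ this (p.mul_mem_right _ h'), ha⟩, b, fun h' ↦ this (p.mul_mem_left _ h'), hb⟩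
  · exact fun h ↦ (‹p.IsPrime›.mem_or_mem h).elim (h₁.notMem ht ha) (h₂.notMem ht hb)

include ht hK in
lemma pow_iff [p.IsPrime] {n : ℕ} {f : A} (hf : f ∈ K ^ n) (m : ℕ) :
    NonvanishingAt θ t p (n * (m + 1)) (f ^ (m + 1)) ↔ NonvanishingAt θ t p n f := by
  induction m with
  | zero => simp
  | succ m ih =>
    have hf' : f ^ (m + 1) ∈ K ^ (n * (m + 1)) := by rw [pow_mul]; exact pow_mem_pow hf _
    rw [pow_succ, mul_add, mul_one, mul_iff ht hK hf' hf, ih, and_self]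

include hK in
lemma add {n : ℕ} {f g : A} (h : NonvanishingAt θ t p n f) (hg : g ∈ K ^ n)
    (hg' : ¬ NonvanishingAt θ t p n g) : NonvanishingAt θ t p n (f + g) := by
  obtain ⟨a, ha, hf⟩ := h
  obtain ⟨b, hb⟩ := exists_map_eq_mul_pow hK hg
  have hbp : b ∈ p := by_contra fun h ↦ hg' ⟨b, h, hb⟩
  refine ⟨a + b, fun h ↦ ha ?_, by rw [map_add, hf, hb, add_mul]⟩
  simpa using p.sub_mem h hbp

include ht hK in
-- Otherwise `K` would extend into `p * (t)`, so `t = z * t` with `z ∈ p`, and cancelling `t` gives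
-- `1 ∈ p`.
lemma exists_mem [p.IsPrime] : ∃ f ∈ K, NonvanishingAt θ t p 1 f := by
  by_contra! H
  have hle : K.map θ ≤ p * span {t} := map_le_iff_le_comap.mpr fun f hf ↦ by
    obtain ⟨a, ha⟩ := exists_map_eq_mul_pow (n := 1) hK (by rwa [pow_one])
    rw [mem_comap, ha, pow_one]
    exact mul_mem_mul (by_contra fun h ↦ H f hf ⟨a, h, ha⟩) (mem_span_singleton_self t)
  have : t ∈ p * span {t} := hle (hK ▸ mem_span_singleton_self t)
  obtain ⟨z, hz, hzt⟩ := mem_mul_span_singleton.mp this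
  have : z = 1 := (mul_cancel_right_mem_nonZeroDivisors ht).mp (by rw [hzt, one_mul])
  exact ‹p.IsPrime›.one_notMem (this ▸ hz)

end NonvanishingAt

open NonvanishingAt in
/-- Homogeneous prime avoidance. -/
lemma exists_forall_nonvanishingAt {ι : Type*} {C : ι → Type*} [∀ i, CommRing (C i)]
    (θ : ∀ i, A →+* C i) (t : ∀ i, C i) (p : ∀ i, Ideal (C i)) [∀ i, (p i).IsPrime]
    (ht : ∀ i, t i ∈ nonZeroDivisors (C i)) (hK : ∀ i, K.map (θ i) = span {t i}) (s : Finset ι) :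
    ∃ n, ∃ f ∈ K ^ (n + 1), ∀ i ∈ s, NonvanishingAt (θ i) (t i) (p i) (n + 1) f := by
  classical
  induction s using Finset.strongInduction with
  | H s ih =>
  -- If nonvanishing at `k` forces nonvanishing at `i`, the point `i` can be dropped.
  by_cases hs : ∃ i ∈ s, ∃ k ∈ s, i ≠ k ∧ ∀ n, ∀ f ∈ K ^ n,
      NonvanishingAt (θ k) (t k) (p k) n f → NonvanishingAt (θ i) (t i) (p i) n f
  · obtain ⟨i, hi, k, hk, hik, H⟩ := hs
    obtain ⟨n, f, hf, hfs⟩ := ih (s.erase i) (Finset.erase_ssubset hi)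
    refine ⟨n, f, hf, fun l hl ↦ ?_⟩
    by_cases hli : l = i
    · subst hli
      exact H _ _ hf (hfs k (Finset.mem_erase.mpr ⟨hik.symm, hk⟩))
    · exact hfs l (Finset.mem_erase.mpr ⟨hli, hl⟩)
  push Not at hs
  obtain rfl | ⟨k, hk⟩ := s.eq_empty_or_nonempty
  · exact ⟨0, 0, zero_mem _, by simp⟩
  obtain ⟨n, f, hf, hfs⟩ := ih (s.erase k) (Finset.erase_ssubset hk)
  by_cases hfk : NonvanishingAt (θ k) (t k) (p k) (n + 1) f
  · refine ⟨n, f, hf, fun l hl ↦ ?_⟩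
    by_cases hlk : l = k
    · rwa [hlk]
    · exact hfs l (Finset.mem_erase.mpr ⟨hlk, hl⟩)
  -- Some form vanishes at every other point but not at `k`: a product of forms, each vanishing at
  -- one of those points and not at `k`.
  have key (s' : Finset ι) (hs' : s' ⊆ s.erase k) : ∃ m, ∃ g ∈ K ^ (m + 1),
      NonvanishingAt (θ k) (t k) (p k) (m + 1) g ∧
      ∀ i ∈ s', ¬ NonvanishingAt (θ i) (t i) (p i) (m + 1) g := by
    induction s' using Finset.induction with
    | empty =>
      obtain ⟨g, hg, hg'⟩ := exists_mem (p := p k) (ht k) (hK k)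
      exact ⟨0, g, by simpa using hg, hg', by simp⟩
    | insert i s' _ ih' =>
      obtain ⟨m, g, hg, hgk, hgs⟩ := ih' ((Finset.subset_insert _ _).trans hs')
      obtain ⟨hik, hi⟩ := Finset.mem_erase.mp (hs' (Finset.mem_insert_self i s'))
      obtain ⟨l, e, he, hek, hei⟩ := hs i hi k hk hik
      have hm (x : ι) := NonvanishingAt.mul_iff (p := p x) (ht x) (hK x) he hg
      have hml : l + (m + 1) = l + m + 1 := rfl
      refine ⟨l + m, e * g, ?_, (hm k).mpr ⟨hek, hgk⟩, fun x hx h ↦ ?_⟩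
      · rw [← hml, pow_add]; exact mul_mem_mul he hg
      · obtain rfl | hx := Finset.mem_insert.mp hx
        · exact hei ((hm x).mp h).1
        · exact hgs x hx ((hm x).mp h).2
  obtain ⟨m, g, hg, hgk, hgs⟩ := key _ subset_rfl
  have hfm : f ^ (m + 1) ∈ K ^ ((n + 1) * (m + 1)) := by rw [pow_mul]; exact pow_mem_pow hf _
  have hgn : g ^ (n + 1) ∈ K ^ ((n + 1) * (m + 1)) := by
    rw [mul_comm, pow_mul]; exact pow_mem_pow hg _
  have hfm' (i : ι) := pow_iff (p := p i) (ht i) (hK i) hf m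
  have hgn' (i : ι) : NonvanishingAt (θ i) (t i) (p i) ((n + 1) * (m + 1)) (g ^ (n + 1)) ↔
      NonvanishingAt (θ i) (t i) (p i) (m + 1) g := by
    rw [mul_comm]; exact pow_iff (p := p i) (ht i) (hK i) hg n
  have e : n * (m + 1) + m + 1 = (n + 1) * (m + 1) := by ring
  -- In the common degree `(n + 1) * (m + 1)` exactly one of the two summands vanishes at each point
  -- of `s`.
  refine ⟨n * (m + 1) + m, f ^ (m + 1) + g ^ (n + 1), ?_, fun i hi ↦ ?_⟩
  · rw [e]; exact add_mem hfm hgn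
  rw [e]
  by_cases hik : i = k
  · subst hik
    have := ((hgn' i).mpr hgk).add (hK i) hfm (mt (hfm' i).mp hfk)
    rwa [add_comm (g ^ _)] at this
  · have hi' := Finset.mem_erase.mpr ⟨hik, hi⟩
    exact ((hfm' i).mpr (hfs i hi')).add (hK i) hgn (mt (hgn' i).mp (hgs i hi'))

end

/-! ### Charts of the blowup algebra. -/

section

variable {A : Type*} [CommRing A] (K : Ideal A) (N : ℕ) (g : A) {L : Type*} [CommRing L]
  [Algebra A L]

/-- The quotients of elements of powers of `K ^ N` by powers of `g`. -/
def IsBlowupFraction (x : L) : Prop :=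
  ∃ m, ∃ k ∈ K ^ (N * m), algebraMap A L g ^ m * x = algebraMap A L k

variable {K N g}

lemma IsBlowupFraction.mul {x y : L} (hx : IsBlowupFraction K N g x)
    (hy : IsBlowupFraction K N g y) : IsBlowupFraction K N g (x * y) := by
  obtain ⟨m, k, hk, hx⟩ := hx
  obtain ⟨n, l, hl, hy⟩ := hy
  refine ⟨m + n, k * l, by rw [mul_add, pow_add]; exact mul_mem_mul hk hl, ?_⟩
  rw [map_mul, ← hx, ← hy, pow_add, mul_mul_mul_comm]

lemma IsBlowupFraction.add (hg : g ∈ K ^ N) {x y : L} (hx : IsBlowupFraction K N g x)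
    (hy : IsBlowupFraction K N g y) : IsBlowupFraction K N g (x + y) := by
  obtain ⟨m, k, hk, hx⟩ := hx
  obtain ⟨n, l, hl, hy⟩ := hy
  have h (a : ℕ) : g ^ a ∈ K ^ (N * a) := by rw [pow_mul]; exact pow_mem_pow hg a
  refine ⟨m + n, g ^ n * k + g ^ m * l, ?_, ?_⟩
  · rw [mul_add, pow_add]
    exact add_mem (by rw [mul_comm (g ^ n)]; exact mul_mem_mul hk (h n)) (mul_mem_mul (h m) hl)
  · rw [map_add, map_mul, map_mul, map_pow, map_pow, ← hx, ← hy, pow_add]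
    ring

lemma isBlowupFraction_algebraMap (r : A) : IsBlowupFraction K N g (algebraMap A L r) :=
  ⟨0, r, by simp, by simp⟩

end

/-- The chart of the blowup algebra of `K` on which `g`, viewed as a form of degree `N`, is
invertible. -/
def blowupSubalgebra {A : Type*} [CommRing A] (K : Ideal A) (N : ℕ) (g : A) (hg : g ∈ K ^ N)
    (L : Type*) [CommRing L] [Algebra A L] : Subalgebra A L where
  carrier := { x | IsBlowupFraction K N g x }
  mul_mem' hx hy := hx.mul hy
  add_mem' hx hy := hx.add hg hy
  algebraMap_mem' := isBlowupFraction_algebraMap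

section

variable {A : Type*} [CommRing A] {K : Ideal A} {N : ℕ} {g : A} (hg : g ∈ K ^ N)
  {L : Type*} [CommRing L] [Algebra A L] [IsLocalization.Away g L]

lemma algebraMap_blowupSubalgebra_mem_nonZeroDivisors :
    algebraMap A (blowupSubalgebra K N g hg L) g ∈ nonZeroDivisors _ := by
  have hu : IsUnit (algebraMap A L g) := IsLocalization.Away.algebraMap_isUnit g
  rw [mem_nonZeroDivisors_iff_right]
  intro x hx
  have : (x : L) * algebraMap A L g = 0 := congr_arg Subtype.val hx
  exact Subtype.ext (hu.mul_left_eq_zero.mp this)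

/-- On the chart of the blowup algebra, the `N`-th power of the extended ideal is generated by
`g`. -/
lemma map_pow_blowupSubalgebra : (K ^ N).map (algebraMap A (blowupSubalgebra K N g hg L)) =
    span {algebraMap A (blowupSubalgebra K N g hg L) g} := by
  have hu : IsUnit (algebraMap A L g) := IsLocalization.Away.algebraMap_isUnit g
  refine le_antisymm (map_le_iff_le_comap.mpr fun k hk ↦ ?_)
    ((span_singleton_le_iff_mem _).mpr (mem_map_of_mem _ hg))
  obtain ⟨x, hx⟩ := hu.dvd (a := algebraMap A L k)
  rw [mem_comap, mem_span_singleton']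
  refine ⟨⟨x, 1, k, by rwa [mul_one], by rw [pow_one, hx]⟩, Subtype.ext ?_⟩
  exact (mul_comm _ _).trans hx.symm

/-- An ideal with a power generated by a nonzerodivisor is locally generated by a nonzerodivisor. -/
lemma isLocallyPrincipalNonzerodivisor_of_pow {J : Ideal A} (hg : g ∈ nonZeroDivisors A)
    (hJ : J ^ (N + 1) = span {g}) : J.IsLocallyPrincipalNonzerodivisor := by
  intro p
  -- Since `J * J ^ N = (g)` is not contained in `p * (g)`, some product `x * y` equals `z * g` with
  -- `z ∉ p`. Where `z` is invertible, `x` generates `J`.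
  obtain ⟨x, hx, y, hy, z, hz, hxy⟩ : ∃ x ∈ J, ∃ y ∈ J ^ N, ∃ z ∉ p.asIdeal, z * g = x * y := by
    by_contra! H
    have hle : J * J ^ N ≤ p.asIdeal * span {g} := mul_le.mpr fun x hx y hy ↦ by
      have : x * y ∈ J ^ (N + 1) := by rw [pow_succ']; exact mul_mem_mul hx hy
      rw [hJ, mem_span_singleton'] at this
      obtain ⟨z, hz⟩ := this
      rw [mem_mul_span_singleton]
      exact ⟨z, by_contra fun h ↦ H x hx y hy z h hz, hz⟩
    rw [← pow_succ', hJ] at hle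
    obtain ⟨z, hz, hzg⟩ := mem_mul_span_singleton.mp (hle (mem_span_singleton_self g))
    have : z = 1 := (mul_cancel_right_mem_nonZeroDivisors hg).mp (by rw [hzg, one_mul])
    exact p.isPrime.one_notMem (this ▸ hz)
  have hzu : IsUnit (algebraMap A (Localization.Away z) z) :=
    IsLocalization.Away.algebraMap_isUnit z
  have hflat : (algebraMap A (Localization.Away z)).Flat := by
    rw [RingHom.flat_algebraMap_iff]
    exact IsLocalization.flat _ (Submonoid.powers z)
  refine ⟨z, hz, algebraMap A _ x, ?_, le_antisymm (map_le_iff_le_comap.mpr fun w hw ↦ ?_)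
    ((span_singleton_le_iff_mem _).mpr (mem_map_of_mem _ hx))⟩
  · have hg' := AlgebraicGeometry.map_mem_nonZeroDivisors_of_flat hflat hg
    have : algebraMap A (Localization.Away z) x * algebraMap A (Localization.Away z) y ∈
        nonZeroDivisors (Localization.Away z) := by
      rw [← map_mul, ← hxy, map_mul]
      exact mul_mem hzu.mem_nonZeroDivisors hg'
    exact (mul_mem_nonZeroDivisors.mp this).1
  · have : w * y ∈ J ^ (N + 1) := by rw [pow_succ']; exact mul_mem_mul hw hy
    rw [hJ, mem_span_singleton'] at this
    obtain ⟨c, hc⟩ := this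
    have e : w * z = x * c := (mul_cancel_right_mem_nonZeroDivisors hg).mp (by
      rw [mul_assoc, hxy, mul_assoc, hc]; ring)
    obtain ⟨v, hv⟩ := hzu.exists_right_inv
    rw [mem_comap, mem_span_singleton']
    refine ⟨algebraMap A _ c * v, ?_⟩
    calc algebraMap A (Localization.Away z) c * v * algebraMap A _ x
        = algebraMap A _ (w * z) * v := by rw [e, map_mul]; ring
      _ = algebraMap A _ w := by rw [map_mul, mul_assoc, hv, mul_one]

end

/-! ### Reductions of ideals and finiteness of the blowup algebra. -/

section

variable {A : Type*} [CommRing A] {K : Ideal A} {n : ℕ} {f : A}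

/-- A form of degree `n` which vanishes nowhere on the exceptional divisor generates the
powers of generators, up to higher order. -/
lemma exists_pow_mem_of_forall_sup_eq_top {x : A} (hx : x ∈ K) (hf : f ∈ K ^ n)
    (H : ∀ c : blowupSubalgebra K 1 x (by rwa [pow_one]) (Localization.Away x),
      algebraMap A _ f = c * algebraMap A _ x ^ n → span {c} ⊔ span {algebraMap A _ x} = ⊤) :
    ∃ m, x ^ (n + m) ∈ span {f} * K ^ m ⊔ K ^ (n + m + 1) := by
  have hx1 : x ∈ K ^ 1 := by rwa [pow_one]
  have hu : IsUnit (algebraMap A (Localization.Away x) x) :=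
    IsLocalization.Away.algebraMap_isUnit x
  have hK := map_pow_blowupSubalgebra hx1 (L := Localization.Away x)
  rw [pow_one] at hK
  obtain ⟨c, hc⟩ := exists_map_eq_mul_pow hK hf
  have h1 : (1 : blowupSubalgebra K 1 x hx1 (Localization.Away x)) ∈
      span {c} ⊔ span {algebraMap A _ x} := H c hc ▸ Submodule.mem_top
  obtain ⟨y, hy, z, hz, hyz⟩ := Submodule.mem_sup.mp h1
  obtain ⟨y, rfl⟩ := mem_span_singleton'.mp hy
  obtain ⟨z, rfl⟩ := mem_span_singleton'.mp hz
  -- Clearing the denominators of `y` and `z` in `y * c + z * x = 1` and multiplying by `x ^ n`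
  -- gives the relation in the localization; a further factor `x ^ s` brings it back to `A`.
  obtain ⟨my, k, hk, hy'⟩ := y.2
  obtain ⟨mz, l, hl, hz'⟩ := z.2
  rw [one_mul] at hk hl
  have e : algebraMap A (Localization.Away x) (x ^ (n + (my + mz))) = algebraMap A _
      (f * (x ^ mz * k) + x ^ (n + 1) * (x ^ my * l)) := by
    have h1 : (y : Localization.Away x) * c + z * algebraMap A _ x = 1 := congr_arg Subtype.val hyz
    have h2 : algebraMap A (Localization.Away x) f = c * algebraMap A _ x ^ n :=
      congr_arg Subtype.val hc
    rw [map_add, map_mul, map_mul, map_mul, map_mul, h2, ← hy', ← hz', map_pow, map_pow, map_pow,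
      map_pow]
    linear_combination (- algebraMap A (Localization.Away x) x ^ (n + (my + mz))) * h1
  obtain ⟨⟨_, s, rfl⟩, hs⟩ := (IsLocalization.eq_iff_exists (Submonoid.powers x) _).mp e
  dsimp at hs
  refine ⟨s + (my + mz), ?_⟩
  have e' : x ^ (n + (s + (my + mz))) =
      f * (x ^ s * (x ^ mz * k)) + x ^ s * (x ^ (n + 1) * (x ^ my * l)) := by
    linear_combination hs
  rw [e']
  refine add_mem (mem_sup_left (mul_mem_mul (mem_span_singleton_self f) ?_)) (mem_sup_right ?_)
  · rw [pow_add, add_comm my, pow_add]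
    exact mul_mem_mul (pow_mem_pow hx s) (mul_mem_mul (pow_mem_pow hx mz) hk)
  · rw [show n + (s + (my + mz)) + 1 = s + ((n + 1) + (my + mz)) by ring, pow_add,
      pow_add K (n + 1), pow_add K my]
    exact mul_mem_mul (pow_mem_pow hx s) (mul_mem_mul (pow_mem_pow hx _)
      (mul_mem_mul (pow_mem_pow hx my) hl))

/-- The ideal `K` is a finite sum of principal ideals, so a high power expands into products
containing a high power of one summand; `hT` absorbs the other factors. -/
lemma exists_pow_le_of_forall_exists_pow_mem (hK : K.FG)
    (H : ∀ x ∈ K, ∃ m, x ^ (n + m) ∈ span {f} * K ^ m ⊔ K ^ (n + m + 1)) :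
    ∃ m, K ^ (n + m) ≤ span {f} * K ^ m ⊔ K ^ (n + m + 1) := by
  have hT (m s : ℕ) : (span {f} * K ^ m ⊔ K ^ (n + m + 1)) * K ^ s ≤
      span {f} * K ^ (m + s) ⊔ K ^ (n + (m + s) + 1) := by
    rw [Ideal.sup_mul, mul_assoc, ← pow_add, ← pow_add,
      show n + m + 1 + s = n + (m + s) + 1 by ring]
  suffices ∀ J : Ideal A, J.FG → J ≤ K →
      ∃ m, J ^ (n + m) ≤ span {f} * K ^ m ⊔ K ^ (n + m + 1) from this K hK le_rfl
  intro J hJ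
  induction J, hJ using Submodule.fg_induction with
  | singleton x =>
    intro hx
    obtain ⟨m, hm⟩ := H x ((span_singleton_le_iff_mem _).mp hx)
    refine ⟨m, ?_⟩
    rw [submodule_span_eq, span_singleton_pow, span_singleton_le_iff_mem]
    exact hm
  | sup J₁ J₂ _ _ h₁ h₂ =>
    intro hJ
    obtain ⟨m₁, hm₁⟩ := h₁ (le_sup_left.trans hJ)
    obtain ⟨m₂, hm₂⟩ := h₂ (le_sup_right.trans hJ)
    -- In degree `n + (n + m₁ + m₂)` each binomial term has exponent at least `n + m₁` on `J₁` or at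
    -- least `n + m₂` on `J₂`.
    refine ⟨n + m₁ + m₂, ?_⟩
    rw [← add_eq_sup, add_pow]
    refine Finset.sum_induction _ (fun I ↦ I ≤ _) (fun I I' h h' ↦ sup_le h h') bot_le fun a ha ↦ ?_
    have ha' : a ≤ n + (n + m₁ + m₂) := Nat.lt_succ_iff.mp (Finset.mem_range.mp ha)
    refine (show J₁ ^ a * J₂ ^ (n + (n + m₁ + m₂) - a) * _ ≤
      J₁ ^ a * J₂ ^ (n + (n + m₁ + m₂) - a) from Ideal.mul_le_left).trans ?_
    have hJ₁ := le_sup_left.trans hJ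
    have hJ₂ := le_sup_right.trans hJ
    obtain h | h := le_total (n + m₁) a
    · obtain ⟨c, rfl⟩ := Nat.exists_eq_add_of_le h
      obtain ⟨d, hd⟩ := Nat.exists_eq_add_of_le ha'
      rw [show n + (n + m₁ + m₂) - (n + m₁ + c) = d by omega, pow_add, mul_assoc]
      refine (mul_mono hm₁ (mul_mono (pow_right_mono hJ₁ c) (pow_right_mono hJ₂ d))).trans ?_
      rw [← pow_add]
      refine (hT _ _).trans_eq ?_
      rw [show m₁ + (c + d) = n + m₁ + m₂ by omega]
    · obtain ⟨c, hc⟩ := Nat.exists_eq_add_of_le h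
      rw [show n + (n + m₁ + m₂) - a = (n + m₂) + c by omega, pow_add, mul_left_comm]
      refine (mul_mono hm₂ (mul_mono (pow_right_mono hJ₁ a) (pow_right_mono hJ₂ c))).trans ?_
      rw [← pow_add]
      refine (hT _ _).trans_eq ?_
      rw [show m₂ + (a + c) = n + m₁ + m₂ by omega]

/-- Nakayama's lemma for reductions of ideals. -/
lemma exists_localization_pow_le (hK : K.FG) {m : ℕ}
    (h : K ^ (n + m) ≤ span {f} * K ^ m ⊔ K ^ (n + m + 1)) : ∃ r, r - 1 ∈ K ∧
      (K.map (algebraMap A (Localization.Away r))) ^ (n + m) ≤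
        span {algebraMap A (Localization.Away r) f} *
          (K.map (algebraMap A (Localization.Away r))) ^ m := by
  -- As `r - 1 ∈ K`, no point of the zero locus of `K` is lost by inverting `r`.
  obtain ⟨r, hr, hr'⟩ := Submodule.exists_sub_one_mem_and_smul_le_of_fg_of_le_sup
    (I := K) (N := span {f} * K ^ m) (N' := K ^ (n + m)) (P := K ^ (n + m)) (hK.pow) le_rfl
    (by rwa [smul_eq_mul, ← pow_succ'])
  refine ⟨r, hr, ?_⟩
  rw [← Ideal.map_pow, ← Ideal.map_pow, ← Set.image_singleton, ← Ideal.map_span, ← Ideal.map_mul,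
    map_le_iff_le_comap]
  intro x hx
  have hu : IsUnit (algebraMap A (Localization.Away r) r) :=
    IsLocalization.Away.algebraMap_isUnit r
  have := mem_map_of_mem (algebraMap A (Localization.Away r))
    (hr' (Submodule.smul_mem_pointwise_smul x r _ hx))
  rw [smul_eq_mul, map_mul] at this
  exact (unit_mul_mem_iff_mem _ hu).mp this

/-- Iterating `h` gives `K^(ni+m+s) ≤ f^i K^(m+s)`. Taking `i = m + 1` and `m + s = n (m + 1)` makes
the degree of `g = f^(m+1)` equal to the exponent of the remaining power of `K`. -/
lemma exists_pow_two_mul_le (hn : n ≠ 0) (hf : f ∈ K ^ n) {m : ℕ}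
    (h : K ^ (n + m) ≤ span {f} * K ^ m) :
    ∃ N, ∃ g ∈ K ^ (N + 1), K ^ (2 * (N + 1)) ≤ span {g} * K ^ (N + 1) := by
  have key (i s : ℕ) : K ^ (n * i + m + s) ≤ span {f} ^ i * K ^ (m + s) := by
    induction i with
    | zero => simp
    | succ i ih =>
      rw [show n * (i + 1) + m + s = (n * i + m + s) + n by ring, pow_add]
      refine (mul_mono_left ih).trans ?_
      rw [mul_assoc, ← pow_add, show m + s + n = n + m + s by ring, pow_add K (n + m), pow_succ,
        mul_assoc, pow_add K m, ← mul_assoc (span {f})]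
      exact mul_mono_right (mul_mono_left h)
  obtain ⟨N, hN⟩ := Nat.exists_eq_add_of_le' (show 1 ≤ n * (m + 1) by
    exact Nat.one_le_iff_ne_zero.mpr (mul_ne_zero hn (by simp)))
  have hm : m ≤ N + 1 := by
    rw [← hN]
    nlinarith [Nat.one_le_iff_ne_zero.mpr hn]
  obtain ⟨s, hs⟩ := Nat.exists_eq_add_of_le hm
  refine ⟨N, f ^ (m + 1), ?_, ?_⟩
  · rw [← hN, pow_mul]
    exact pow_mem_pow hf _
  · have := key (m + 1) s
    rwa [hN, add_assoc, ← hs, ← two_mul, span_singleton_pow] at this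

end

end Ideal

namespace Ideal

section

variable {A : Type*} [CommRing A] {K : Ideal A} {N : ℕ} {g : A} (hg : g ∈ K ^ N)
  {L : Type*} [CommRing L] [Algebra A L] [IsLocalization.Away g L]
  (h : K ^ (2 * N) ≤ span {g} * K ^ N)

include h

/-- The chart of the blowup algebra defined by a reduction is finite. -/
lemma finite_blowupSubalgebra (hK : K.FG) : Module.Finite A (blowupSubalgebra K N g hg L) := by
  have hu : IsUnit (algebraMap A L g) := IsLocalization.Away.algebraMap_isUnit g
  obtain ⟨v, hv⟩ := hu.exists_left_inv
  have key (m : ℕ) : K ^ (N * (m + 1)) ≤ span {g ^ m} * K ^ N := by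
    induction m with
    | zero => simp
    | succ m ih =>
      rw [mul_add, mul_one, pow_add]
      refine (mul_mono_left ih).trans ?_
      rw [mul_assoc, ← pow_add, ← two_mul, pow_succ, ← span_singleton_mul_span_singleton, mul_assoc]
      exact mul_mono_right h
  -- This is `k ↦ k / g`; the chart is shown to be the module `g⁻¹ K^N`.
  let e : A →ₗ[A] L := v • Algebra.linearMap A L
  have : Subalgebra.toSubmodule (blowupSubalgebra K N g hg L) = Submodule.map e (K ^ N) := by
    refine le_antisymm ?_ ?_
    · rintro x ⟨m, k, hk, hx⟩
      -- The fraction `k / g^m` equals `k g / g^(m+1)`, and `k g` lies in `K^(N(m+1)) ≤ g^m K^N`.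
      have hgk : k * g ∈ K ^ (N * (m + 1)) := by
        rw [mul_add, mul_one, pow_add]
        exact mul_mem_mul hk hg
      obtain ⟨l, hl, hlk⟩ := mem_span_singleton_mul.mp (key m hgk)
      refine ⟨l, hl, ?_⟩
      have e₁ : algebraMap A L g * x = algebraMap A L l := by
        refine (hu.pow m).mul_left_cancel ?_
        rw [← map_pow, ← map_mul, hlk, map_mul, ← hx, map_pow]
        ring
      change v * algebraMap A L l = x
      rw [← e₁, ← mul_assoc, hv, one_mul]
    · rintro _ ⟨k, hk, rfl⟩
      refine ⟨1, k, by rwa [mul_one], ?_⟩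
      change _ * (v * algebraMap A L k) = _
      rw [pow_one, ← mul_assoc, mul_comm _ v, hv, one_mul]
  have hfin : Module.Finite A (Subalgebra.toSubmodule (blowupSubalgebra K N g hg L)) := by
    rw [Module.Finite.iff_fg, this]
    exact Submodule.FG.map e hK.pow
  exact hfin

end

/-- The chart of the blowup algebra defined by a reduction is the blowup algebra. -/
lemma isBlowupAlgebra_blowupSubalgebra {A L : Type u} [CommRing A] {K : Ideal A} {N : ℕ} {g : A}
    (hg : g ∈ K ^ N) [CommRing L] [Algebra A L] [IsLocalization.Away g L]
    (h : K ^ (2 * N) ≤ span {g} * K ^ N) :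
    (algebraMap A (blowupSubalgebra K N g hg L)).IsBlowupAlgebra K := by
  intro C _ θ t ht hK
  have hcoeff {n : ℕ} {k : A} (hk : k ∈ K ^ n) := exists_map_eq_mul_pow hK hk
  -- Extending `h` to `C` and cancelling `t ^ N` shows that `θ g` divides `t ^ N`. So `θ g` is a
  -- nonzerodivisor, and `C` embeds in `M`, where the extension is forced.
  obtain ⟨d, hd⟩ : ∃ d, t ^ N = θ g * d := by
    have h₁ := map_mono (f := θ) h
    rw [Ideal.map_mul, Ideal.map_pow, Ideal.map_pow, hK, Ideal.map_span, Set.image_singleton,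
      span_singleton_pow, span_singleton_pow, span_singleton_mul_span_singleton,
      span_singleton_le_span_singleton] at h₁
    obtain ⟨d, hd⟩ := h₁
    refine ⟨d, (mul_cancel_right_mem_nonZeroDivisors (pow_mem ht N)).mp ?_⟩
    rw [← pow_add, ← two_mul, hd]
    ring
  have hθg : θ g ∈ nonZeroDivisors C := (mul_mem_nonZeroDivisors.mp (hd ▸ pow_mem ht N)).1
  let M := Localization.Away (θ g)
  have hι : Function.Injective (algebraMap C M) :=
    IsLocalization.injective M (Submonoid.powers_le.mpr hθg)
  have hu : IsUnit (((algebraMap C M).comp θ) g) := IsLocalization.Away.algebraMap_isUnit (θ g)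
  let Λ : L →+* M := IsLocalization.Away.lift g hu
  have hΛ (k : A) : Λ (algebraMap A L k) = algebraMap C M (θ k) := IsLocalization.Away.lift_eq g hu k
  -- The image of `k / g^m` is `a t^(Nm) / (θ g)^m = a d^m`, which lies in `C`.
  have hex (x : blowupSubalgebra K N g hg L) : ∃ y, algebraMap C M y = Λ x := by
    obtain ⟨m, k, hk, hx⟩ := x.2
    obtain ⟨a, ha⟩ := hcoeff hk
    refine ⟨a * d ^ m, (hu.pow m).mul_left_cancel ?_⟩
    have := congr_arg Λ hx
    rw [map_mul, map_pow, hΛ, hΛ] at this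
    refine Eq.trans ?_ this.symm
    rw [RingHom.comp_apply, ← map_pow, ← map_mul, ha, pow_mul, hd]
    congr 1
    ring
  choose y hy using hex
  refine ⟨{
    toFun := y
    map_one' := hι (by rw [hy]; simp)
    map_zero' := hι (by rw [hy]; simp)
    map_mul' := fun a b ↦ hι (by rw [map_mul, hy, hy, hy]; simp)
    map_add' := fun a b ↦ hι (by rw [map_add, hy, hy, hy]; simp) },
    RingHom.ext fun k ↦ hι ((hy _).trans (hΛ k)), fun θ' hθ' ↦ RingHom.ext fun x ↦ hι ?_⟩
  obtain ⟨m, k, hk, hx⟩ := x.2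
  refine Eq.trans ((hu.pow m).mul_left_cancel ?_) (hy x).symm
  have h₁ := congr_arg Λ hx
  rw [map_mul, map_pow, hΛ, hΛ] at h₁
  refine Eq.trans ?_ h₁.symm
  have h₂ : algebraMap A (blowupSubalgebra K N g hg L) (g ^ m) * x = algebraMap A _ k :=
    Subtype.ext (show algebraMap A L (g ^ m) * (x : L) = algebraMap A L k by rw [map_pow, hx])
  have h₃ := congr_arg θ' h₂
  have h₄ (r : A) : θ' (algebraMap A _ r) = θ r := congr($hθ' r)
  rw [map_mul, h₄, h₄] at h₃
  rw [RingHom.comp_apply, ← map_pow, ← map_pow, ← map_mul, h₃]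

/-- If a form of degree `n` vanishes nowhere on the exceptional divisor, then near the centre the
blowup algebra exists and is finite. -/
lemma exists_finite_isBlowupAlgebra {A : Type u} [CommRing A] {K : Ideal A} (hK : K.FG) {n : ℕ}
    (hn : n ≠ 0) {f : A} (hf : f ∈ K ^ n)
    (H : ∀ (C : Type u) [CommRing C] (θ : A →+* C) (t : C), t ∈ nonZeroDivisors C →
      K.map θ = span {t} → ∀ c, θ f = c * t ^ n → span {c} ⊔ span {t} = ⊤) :
    ∃ r, r - 1 ∈ K ∧ ∃ (A' : Type u) (_ : CommRing A') (φ : Localization.Away r →+* A'),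
      φ.Finite ∧
      ((K.map (algebraMap A (Localization.Away r))).map φ).IsLocallyPrincipalNonzerodivisor ∧
      φ.IsBlowupAlgebra (K.map (algebraMap A (Localization.Away r))) := by
  -- The hypothesis `H` is tested on the algebras `A[K/x]`, in which `x` generates the extension of
  -- `K`.
  obtain ⟨m, hm⟩ := exists_pow_le_of_forall_exists_pow_mem (f := f) (n := n) hK fun x hx ↦
    exists_pow_mem_of_forall_sup_eq_top hx hf fun c hc ↦
      H _ _ _ (algebraMap_blowupSubalgebra_mem_nonZeroDivisors _)
        (by simpa using map_pow_blowupSubalgebra (K := K) (N := 1) (g := x) (by rwa [pow_one])) c hc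
  obtain ⟨r, hr, hm'⟩ := exists_localization_pow_le hK hm
  have hf' := mem_map_of_mem (algebraMap A (Localization.Away r)) hf
  rw [Ideal.map_pow] at hf'
  obtain ⟨N, g, hg, hN⟩ := exists_pow_two_mul_le hn hf' hm'
  refine ⟨r, hr, blowupSubalgebra _ (N + 1) g hg (Localization.Away g), inferInstance,
    algebraMap _ _, ?_, ?_, isBlowupAlgebra_blowupSubalgebra hg hN⟩
  · rw [RingHom.finite_algebraMap]
    exact finite_blowupSubalgebra hg hN (hK.map _)
  · refine isLocallyPrincipalNonzerodivisor_of_pow (N := N)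
      (algebraMap_blowupSubalgebra_mem_nonZeroDivisors hg) ?_
    rw [← Ideal.map_pow, map_pow_blowupSubalgebra]

end Ideal

/-! ### Finiteness of a blowup with finite exceptional divisor. -/

namespace AlgebraicGeometry

open Scheme.IdealSheafData

/-- A closed subscheme of a scheme locally of finite type is locally cut out by a finitely generated
ideal if it is locally of finite presentation. -/
lemma exists_fg_on_ker {D X S : Scheme.{u}} (j : D ⟶ X) [IsClosedImmersion j] (p : X ⟶ S)
    [LocallyOfFiniteType p] (hjp : LocallyOfFinitePresentation (j ≫ p)) (x : X) :
    ∃ (A : CommRingCat.{u}) (a : Spec A ⟶ X), IsOpenImmersion a ∧ x ∈ Set.range a ∧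
      (j.ker.on a).FG := by
  obtain ⟨R, s, hs, hxs, -⟩ :=
    Scheme.exists_affine_mem_range_and_range_subset (x := p x) (U := ⊤) trivial
  obtain ⟨A, a, ha, hxa, har⟩ :=
    Scheme.exists_affine_mem_range_and_range_subset (x := x) (U := p ⁻¹ᵁ s.opensRange) hxs
  refine ⟨A, a, ha, hxa, ?_⟩
  have har' : Set.range (a ≫ p) ⊆ Set.range s := by
    rintro _ ⟨z, rfl⟩
    rw [Scheme.Hom.comp_apply]
    exact har ⟨z, rfl⟩
  obtain ⟨r, hr⟩ := Spec.map_surjective (IsOpenImmersion.lift s _ har')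
  have hr' : a ≫ p = Spec.map r ≫ s := by rw [hr, IsOpenImmersion.lift_fac]
  obtain ⟨k, hk⟩ := IsClosedImmersion.exists_isPullback j rfl a
  have hko : IsOpenImmersion k := MorphismProperty.of_isPullback hk inferInstance
  let π : A ⟶ CommRingCat.of (A ⧸ j.ker.on a) := CommRingCat.ofHom (Ideal.Quotient.mk (j.ker.on a))
  have h₁ : LocallyOfFiniteType (Spec.map r) := by
    refine of_comp_mono @LocallyOfFiniteType.{u} _ s ?_
    rw [← hr']
    infer_instance
  have h₂ : LocallyOfFinitePresentation (Spec.map (r ≫ π)) := by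
    refine of_comp_mono @LocallyOfFinitePresentation.{u} _ s ?_
    rw [Spec.map_comp, Category.assoc, ← hr', ← Category.assoc, hk.w, Category.assoc]
    infer_instance
  have h₃ : r.hom.FiniteType := HasRingHomProperty.Spec_iff.mp h₁
  have h₄ : π.hom.FinitePresentation :=
    .of_comp_finiteType _ ((LocallyOfFinitePresentation.SpecMap_iff _).mp h₂) h₃
  have : Algebra.FinitePresentation A (A ⧸ j.ker.on a) := h₄
  have h' := Algebra.FinitePresentation.ker_fG_of_surjective (Ideal.Quotient.mkₐ A (j.ker.on a))
    Ideal.Quotient.mk_surjective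
  have e : RingHom.ker (Ideal.Quotient.mkₐ A (j.ker.on a)).toRingHom = j.ker.on a := Ideal.mk_ker
  rwa [e] at h'

lemma mem_range_iff_on_ker_le {D X : Scheme.{u}} (j : D ⟶ X) [IsClosedImmersion j]
    {A : CommRingCat.{u}} (a : Spec A ⟶ X) (p : Spec A) :
    a p ∈ Set.range j ↔ j.ker.on a ≤ p.asIdeal := by
  obtain ⟨k, hk⟩ := IsClosedImmersion.exists_isPullback j rfl a
  have : a p ∈ Set.range j ↔
      p ∈ Set.range (Spec.map (CommRingCat.ofHom (Ideal.Quotient.mk (j.ker.on a)))) := by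
    constructor
    · rintro ⟨d, hd⟩
      obtain ⟨z, hz, -⟩ := Scheme.exists_preimage_of_isPullback hk p d hd.symm
      exact ⟨z, hz⟩
    · rintro ⟨z, rfl⟩
      exact ⟨k z, (Scheme.comp_eq_apply hk.w z).symm⟩
  rw [this]
  have h2 := range_comap_of_surjective _ _
    (Ideal.Quotient.mk_surjective (I := j.ker.on a))
  rw [Ideal.mk_ker] at h2
  exact (Set.ext_iff.mp h2 p).trans (PrimeSpectrum.mem_zeroLocus _ _)

section

variable {B X : Scheme.{u}} (b : B ⟶ X) {A : CommRingCat.{u}} (a : Spec A ⟶ X) (K : Ideal A)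
  (n : ℕ) (f : A)

/-- The points at which the element `f` of `K ^ n` generates the `n`-th power of the ideal of the
exceptional divisor. -/
def nonvanishingLocus : Set B :=
  { x | ∃ (C : CommRingCat.{u}) (c : Spec C ⟶ B) (θ : A ⟶ C) (t : C) (p : Spec C),
    IsOpenImmersion c ∧ c p = x ∧ c ≫ b = Spec.map θ ≫ a ∧ t ∈ nonZeroDivisors C ∧
    K.map θ.hom = Ideal.span {t} ∧ Ideal.NonvanishingAt θ.hom t p.asIdeal n f }

lemma isOpen_nonvanishingLocus : IsOpen (nonvanishingLocus b a K n f) := by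
  rw [isOpen_iff_forall_mem_open]
  rintro _ ⟨C, c, θ, t, p, hc, rfl, hcb, ht, hK, u, hu, hf⟩
  refine ⟨c '' (PrimeSpectrum.basicOpen u : Set (PrimeSpectrum C)), ?_, ?_, ⟨p, hu, rfl⟩⟩
  · rintro _ ⟨p', hp', rfl⟩
    exact ⟨C, c, θ, t, p', hc, rfl, hcb, ht, hK, u, hp', hf⟩
  · exact c.isOpenEmbedding.isOpenMap _ (PrimeSpectrum.basicOpen u).2

variable {b a K n f}

/-- Nonvanishing is independent of the chart: locally the two equations differ by a unit `v`, and
the two coefficients by `v ^ n`. As `g` need not be an open immersion, this also covers test rings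
mapping to the blowup. -/
lemma notMem_of_mem_nonvanishingLocus [IsOpenImmersion a] {C : CommRingCat.{u}} {θ : A ⟶ C} {t : C}
    (ht : t ∈ nonZeroDivisors C) (hK : K.map θ.hom = Ideal.span {t}) {g : Spec C ⟶ B}
    (hg : g ≫ b = Spec.map θ ≫ a) {p : Spec C} (hp : g p ∈ nonvanishingLocus b a K n f) {c : C}
    (hc : θ.hom f = c * t ^ n) : c ∉ p.asIdeal := by
  obtain ⟨C₁, c₁, θ₁, t₁, p₁, hc₁, hp₁, hcb, ht₁, hK₁, u, hu, hf⟩ := hp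
  obtain ⟨s, hs, hsr⟩ := exists_away_range_le g p c₁.opensRange ⟨p₁, hp₁⟩
  replace hsr : Set.range (Spec.away s ≫ g) ⊆ Set.range c₁ := hsr
  obtain ⟨σ, hσ⟩ := Spec.map_surjective (IsOpenImmersion.lift c₁ _ hsr)
  have hσ' : Spec.map σ ≫ c₁ = Spec.away s ≫ g := by rw [hσ, IsOpenImmersion.lift_fac]
  obtain ⟨ps, rfl⟩ := (Spec.mem_range_away s p).mpr hs
  let l : C ⟶ CommRingCat.of (Localization.Away s) :=
    CommRingCat.ofHom (algebraMap C (Localization.Away s))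
  have hps : Spec.map σ ps = p₁ := c₁.isOpenEmbedding.injective
    ((Scheme.comp_eq_apply hσ' ps).trans hp₁.symm)
  have hcomp : θ₁ ≫ σ = θ ≫ l := by
    apply Spec.map_injective
    rw [← cancel_mono a, Spec.map_comp, Spec.map_comp, Category.assoc, Category.assoc, ← hcb, ← hg,
      ← Category.assoc, hσ', Category.assoc]
  have hcomp' (x : A) : σ.hom (θ₁.hom x) = l.hom (θ.hom x) := congr(($hcomp).hom x)
  have hspan : Ideal.span {σ.hom t₁} = Ideal.span {l.hom t} := by
    have h₁ : (K.map θ₁.hom).map σ.hom = (K.map θ.hom).map l.hom := by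
      rw [Ideal.map_map, Ideal.map_map, ← CommRingCat.hom_comp, ← CommRingCat.hom_comp, hcomp]
    rwa [hK, hK₁, Ideal.map_span, Ideal.map_span, Set.image_singleton, Set.image_singleton] at h₁
  have hlt : l.hom t ∈ nonZeroDivisors (Localization.Away s) :=
    map_mem_nonZeroDivisors_of_flat (flat_of_isOpenImmersion_SpecMap l) ht
  obtain ⟨v, hv⟩ := Ideal.mem_span_singleton'.mp (hspan.le (Ideal.mem_span_singleton_self _))
  obtain ⟨w, hw⟩ := Ideal.mem_span_singleton'.mp (hspan.ge (Ideal.mem_span_singleton_self _))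
  have hwv : w * v = 1 := (mul_cancel_right_mem_nonZeroDivisors hlt).mp (by
    rw [mul_assoc, hv, hw, one_mul])
  have hc' : l.hom c = σ.hom u * v ^ n := (mul_cancel_right_mem_nonZeroDivisors (pow_mem hlt n)).mp (by
    rw [← map_pow, ← map_mul, ← hc, ← hcomp', hf, map_mul, map_pow, ← hv, map_pow]; ring)
  intro h
  have h₁ : l.hom c ∈ ps.asIdeal := h
  rw [hc'] at h₁
  obtain h₂ | h₂ := ps.isPrime.mem_or_mem h₁
  · have : u ∈ (Spec.map σ ps).asIdeal := h₂
    rw [hps] at this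
    exact hu this
  · have := ps.asIdeal.mul_mem_left w (ps.isPrime.mem_of_pow_mem n h₂)
    rw [hwv] at this
    exact ps.isPrime.one_notMem this

end

namespace IsBlowup

variable {B X D : Scheme.{u}} {b : B ⟶ X} {j : D ⟶ X}
  (hb : IsBlowup b j.ker) {A : CommRingCat.{u}} (a : Spec A ⟶ X) [IsOpenImmersion a]

include hb

lemma exists_chart (x : B) (hx : b x ∈ Set.range a) : ∃ (C : CommRingCat.{u}) (c : Spec C ⟶ B)
    (θ : A ⟶ C) (t : C) (p : Spec C), IsOpenImmersion c ∧ c p = x ∧ c ≫ b = Spec.map θ ≫ a ∧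
      t ∈ nonZeroDivisors C ∧ (j.ker.on a).map θ.hom = Ideal.span {t} := by
  obtain ⟨C, c, hc, ⟨p, hp⟩, hcr, t, ht, ht'⟩ :=
    hb.isEffectiveCartier.exists_chart_le x (b ⁻¹ᵁ a.opensRange) hx
  have hr : Set.range (c ≫ b) ⊆ Set.range a := by
    rintro _ ⟨z, rfl⟩
    rw [Scheme.Hom.comp_apply]
    exact hcr ⟨z, rfl⟩
  obtain ⟨θ, hθ⟩ := Spec.map_surjective (IsOpenImmersion.lift a _ hr)
  have hθ' : c ≫ b = Spec.map θ ≫ a := by rw [hθ, IsOpenImmersion.lift_fac]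
  exact ⟨C, c, θ, t, p, hc, hp, hθ', ht, by rw [← ht', on_comap, hθ', on_SpecMap_comp]⟩

/-- Some form vanishes at no point of a finite fiber of the exceptional divisor. -/
lemma exists_forall_mem_nonvanishingLocus {s : Set B} (hs : s.Finite)
    (hsa : ∀ x ∈ s, b x ∈ Set.range a) : ∃ n ≠ 0, ∃ f ∈ j.ker.on a ^ n,
      s ⊆ nonvanishingLocus b a (j.ker.on a) n f := by
  choose C c θ t p hc hcp hcb ht hK using fun x : s ↦ hb.exists_chart a x (hsa x x.2)
  have := hs.to_subtype
  have hp (x : s) : (p x).asIdeal.IsPrime := (p x).isPrime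
  have := Fintype.ofFinite s
  obtain ⟨n, f, hf, H⟩ := Ideal.exists_forall_nonvanishingAt (fun x ↦ (θ x).hom) t
    (fun x ↦ (p x).asIdeal) ht hK Finset.univ
  exact ⟨n + 1, by simp, f, hf, fun x hx ↦ ⟨C ⟨x, hx⟩, c ⟨x, hx⟩, θ ⟨x, hx⟩, t ⟨x, hx⟩, p ⟨x, hx⟩,
    hc _, hcp _, hcb _, ht _, hK _, H _ (Finset.mem_univ _)⟩⟩

/-- If the exceptional divisor is finite over the centre, then locally on the base there is a form
which vanishes nowhere on the exceptional divisor. -/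
lemma exists_away_forall_sup_eq_top [IsClosedImmersion j] [IsFinite (pullback.snd b j)] (d : Spec A) :
    ∃ h ∉ d.asIdeal, ∃ n ≠ 0, ∃ f ∈ j.ker.on a ^ n,
      ∀ (C : Type u) [CommRing C] (θ : Localization.Away h →+* C) (t : C), t ∈ nonZeroDivisors C →
        ((j.ker.on a).map (algebraMap A (Localization.Away h))).map θ = Ideal.span {t} →
        ∀ c, θ (algebraMap A _ f) = c * t ^ n → Ideal.span {c} ⊔ Ideal.span {t} = ⊤ := by
  obtain ⟨n, hn, f, hf, hF⟩ := hb.exists_forall_mem_nonvanishingLocus a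
    (s := pullback.fst b j '' (pullback.snd b j ⁻¹' (j ⁻¹' {a d})))
    (((pullback.snd b j).finite_preimage (Set.Finite.preimage j.isClosedEmbedding.injective.injOn
      (Set.finite_singleton _))).image _) (by
    rintro _ ⟨e, he, rfl⟩
    rw [Scheme.comp_eq_apply pullback.condition e]
    exact ⟨d, (he : j (pullback.snd b j e) = a d).symm⟩)
  let G := nonvanishingLocus b a (j.ker.on a) n f
  -- The image in `X` of the points of the exceptional divisor at which `f` vanishes.
  let Z : Set X := j '' (pullback.snd b j '' (pullback.fst b j ⁻¹' Gᶜ))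
  have hZ : IsClosed Z := by
    refine j.isClosedEmbedding.isClosedMap _ ((pullback.snd b j).isClosedMap _ ?_)
    exact (isOpen_nonvanishingLocus ..).isClosed_compl.preimage (Scheme.Hom.continuous _)
  have hd : a d ∉ Z := by
    rintro ⟨_, ⟨e, he, rfl⟩, he'⟩
    exact he (hF ⟨e, he', rfl⟩)
  obtain ⟨h, hh, hr⟩ := exists_away_range_le a d ⟨Zᶜ, hZ.isOpen_compl⟩ hd
  refine ⟨h, hh, n, hn, f, hf, fun C _ θ t ht hK c hc ↦ ?_⟩
  -- A maximal ideal containing `c` and `t` is a point which the universal property sends to the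
  -- exceptional divisor, over the complement of `Z`. There `f` does not vanish, so `c` cannot lie
  -- in that ideal.
  by_contra hne
  obtain ⟨m, hm, hcm⟩ := Ideal.exists_le_maximal _ hne
  let p : Spec (.of C) := ⟨m, hm.isPrime⟩
  let θ' : A ⟶ .of C := CommRingCat.ofHom (θ.comp (algebraMap A (Localization.Away h)))
  have hθ' : Spec.map θ' = Spec.map (CommRingCat.ofHom θ) ≫ Spec.away h := by
    rw [← Spec.map_comp]; rfl
  have hK' : (j.ker.on a).map θ'.hom = Ideal.span {t} := by rw [← hK, Ideal.map_map]; rfl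
  obtain ⟨g, hg, -⟩ := hb.existsUnique_lift _ (Spec.map θ' ≫ a) (by
    rw [isEffectiveCartier_iff]
    refine fun x ↦ ⟨_, 𝟙 _, inferInstance, ⟨x, rfl⟩, t, ht, ?_⟩
    rw [on_comap, Category.id_comp, on_SpecMap_comp, hK'])
  have hgp : b (g p) = a (Spec.map θ' p) := Scheme.comp_eq_apply hg p
  obtain ⟨d', hd'⟩ : a (Spec.map θ' p) ∈ Set.range j := by
    rw [mem_range_iff_on_ker_le]
    have : (j.ker.on a).map θ'.hom ≤ m := by rw [hK']; exact le_sup_right.trans hcm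
    exact Ideal.map_le_iff_le_comap.mp this
  obtain ⟨e, he, hed⟩ := Scheme.Pullback.exists_preimage_pullback (g p) d' (hgp.trans hd'.symm)
  have hG : g p ∈ G := by
    by_contra hG
    have hmem : a (Spec.map θ' p) ∈ Set.range (Spec.away h ≫ a) :=
      ⟨Spec.map (CommRingCat.ofHom θ) p, by
        rw [hθ', Scheme.Hom.comp_apply, Scheme.Hom.comp_apply]⟩
    exact (show _ ∉ Z from hr hmem) ⟨d', ⟨e, by rwa [Set.mem_preimage, he], hed⟩, hd'⟩
  refine notMem_of_mem_nonvanishingLocus ht hK' hg hG hc ?_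
  exact hcm (Ideal.mem_sup_left (Ideal.mem_span_singleton_self c))

end IsBlowup

end AlgebraicGeometry

/-! ### The finite blowup as a pinching. -/

namespace AlgebraicGeometry

open Scheme.IdealSheafData

/-- Blowups are isomorphisms off the centre. -/
lemma IsBlowup.isIso_morphismRestrict {B X : Scheme.{u}} {b : B ⟶ X} {I : X.IdealSheafData}
    (hb : IsBlowup b I) : IsIso (b ∣_ I.support.compl) := by
  have h := hb.of_isPullback (isPullback_morphismRestrict b I.support.compl).flip
  have : I.comap (Scheme.Opens.ι I.support.compl) = ⊤ := by
    rw [← support_eq_bot_iff, support_comap]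
    ext x
    exact ⟨fun hx ↦ (x.2 hx).elim, fun hx ↦ hx.elim⟩
  rw [this] at h
  exact h.isIso

/-- A blowup with finite exceptional divisor is finite. -/
lemma IsBlowup.isFinite {B X D : Scheme.{u}} {b : B ⟶ X} {j : D ⟶ X} [IsClosedImmersion j]
    [IsFinite (pullback.snd b j)] (hb : IsBlowup b j.ker)
    (hj : ∀ x : X, ∃ (A : CommRingCat.{u}) (a : Spec A ⟶ X), IsOpenImmersion a ∧ x ∈ Set.range a ∧
      (j.ker.on a).FG) : IsFinite b := by
  have : IsZariskiLocalAtTarget @IsFinite.{u} :=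
    @HasAffineProperty.instIsZariskiLocalAtTarget _ _
      IsFinite.instHasAffinePropertyAndIsAffineFiniteCarrierObjOppositeOpensCarrierCarrierCommRingCatPresheafOpOpensTopHomAppTop
  refine IsZariskiLocalAtTarget.of_forall_isPullback @IsFinite b fun x ↦ ?_
  by_cases hx : x ∈ Set.range j
  · obtain ⟨A, a, ha, ⟨d, rfl⟩, hfg⟩ := hj x
    obtain ⟨h, hh, n, hn, f, hf, H⟩ := hb.exists_away_forall_sup_eq_top a d
    let a₁ : Spec (.of (Localization.Away h)) ⟶ X := Spec.away h ≫ a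
    have hK : (j.ker.on a).map (algebraMap A (Localization.Away h)) = j.ker.on a₁ :=
      (on_SpecMap_comp j.ker (CommRingCat.ofHom (algebraMap A (Localization.Away h))) a).symm
    have hf' := Ideal.mem_map_of_mem (algebraMap A (Localization.Away h)) hf
    rw [Ideal.map_pow, hK] at hf'
    rw [hK] at H
    obtain ⟨r, hr, A', _, φ, hφ, hφ', hφB⟩ :=
      Ideal.exists_finite_isBlowupAlgebra (hK ▸ hfg.map _) hn hf' H
    obtain ⟨d₁, hd₁⟩ := mem_range_away_comp a d hh
    let a₂ : Spec (.of (Localization.Away r)) ⟶ X := Spec.away (A := .of (Localization.Away h)) r ≫ a₁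
    have hr₁ : r ∉ d₁.asIdeal := fun hr₁ ↦ by
      have h₁ : j.ker.on a₁ ≤ d₁.asIdeal := (mem_range_iff_on_ker_le j a₁ d₁).mp (hd₁ ▸ hx)
      have := d₁.asIdeal.sub_mem hr₁ (h₁ hr)
      rw [sub_sub_cancel] at this
      exact d₁.isPrime.one_notMem this
    have hK₂ : (j.ker.comap a₂).specIdeal =
        (j.ker.on a₁).map (algebraMap (Localization.Away h) (Localization.Away r)) :=
      on_SpecMap_comp j.ker (CommRingCat.ofHom (algebraMap (Localization.Away h)
        (Localization.Away r))) a₁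
    rw [← hK₂] at hφ' hφB
    have hB := isBlowup_SpecMap (CommRingCat.ofHom φ) _ hφ' hφB
    have hp := IsPullback.of_hasPullback b a₂
    -- Over this neighbourhood the restriction of `b` and the spectrum of the finite algebra are
    -- blowups of the same ideal.
    obtain ⟨e, he, -⟩ := (hb.of_isPullback hp).existsUnique_iso hB
    have hfin : IsFinite (Spec.map (CommRingCat.ofHom φ)) := (IsFinite.SpecMap_iff _).mpr hφ
    refine ⟨_, _, _, _, a₂, inferInstance, ?_, hp, ?_⟩
    · rw [← hd₁]
      exact mem_range_away_comp a₁ d₁ hr₁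
    · rw [← he]
      infer_instance
  · have := hb.isIso_morphismRestrict
    refine ⟨_, _, _, _, Scheme.Opens.ι j.ker.support.compl, inferInstance, ?_,
      (isPullback_morphismRestrict b j.ker.support.compl).flip, inferInstance⟩
    rw [Scheme.Opens.range_ι]
    intro h
    have h' : x ∈ (j.ker.support : Set X) := h
    rw [Scheme.Hom.support_ker, j.isClosedEmbedding.isClosed_range.closure_eq] at h'
    exact hx h'

/-- A cartesian square of affine morphisms, along which the ideals of the closed subschemes agree,
is a pinching square. -/
lemma IsPinching.of_idealsAgree {X' D' D X : Scheme.{u}} {i : D' ⟶ X'} {q : D' ⟶ D} {ν : X' ⟶ X}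
    {j : D ⟶ X} [IsClosedImmersion i] [IsClosedImmersion j] [IsAffineHom ν] [IsIntegralHom q]
    (w : i ≫ ν = q ≫ j) (h : IdealsAgree ν j i) : IsPinching i q ν j where
  w := w
  exists_chart x := by
    obtain ⟨U, hU, hx, -⟩ := TopologicalSpace.Opens.isBasis_iff_nbhd.mp X.isBasis_affineOpens
      (show x ∈ (⊤ : X.Opens) from trivial)
    have hν : IsAffineOpen (ν ⁻¹ᵁ U) := hU.preimage ν
    have hj : IsAffineOpen (j ⁻¹ᵁ U) := hU.preimage j
    have hi : IsAffineOpen (i ⁻¹ᵁ ν ⁻¹ᵁ U) := hν.preimage i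
    have e : i ⁻¹ᵁ ν ⁻¹ᵁ U = q ⁻¹ᵁ j ⁻¹ᵁ U := by
      rw [← Scheme.Hom.comp_preimage, w, Scheme.Hom.comp_preimage]
    have hcomm : ν.app U ≫ i.app (ν ⁻¹ᵁ U) = j.app U ≫ q.appLE (j ⁻¹ᵁ U) _ e.le := by
      rw [i.app_eq_appLE]
      refine (Scheme.Hom.comp_appLE i ν U _ le_rfl).symm.trans
        (Eq.trans ?_ (Scheme.Hom.comp_appLE q j U _ e.le))
      have key (f : D' ⟶ X) (hf : f = q ≫ j) (h₁ : i ⁻¹ᵁ ν ⁻¹ᵁ U ≤ f ⁻¹ᵁ U) :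
          f.appLE U _ h₁ = (q ≫ j).appLE U _ (hf ▸ h₁) := by subst hf; rfl
      exact key _ w _
    have hiso : IsIso (D'.presheaf.map (homOfLE e.le).op) := by
      rw [show homOfLE e.le = eqToHom e from rfl]
      infer_instance
    have hFa : IsOpenImmersion hU.fromSpec := hU.isOpenImmersion_fromSpec
    have hFa' : IsOpenImmersion hν.fromSpec := hν.isOpenImmersion_fromSpec
    have hFb : IsOpenImmersion hj.fromSpec := hj.isOpenImmersion_fromSpec
    have hFb' : IsOpenImmersion hi.fromSpec := hi.isOpenImmersion_fromSpec
    exact ⟨{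
      A := Γ(X, U)
      A' := Γ(X', ν ⁻¹ᵁ U)
      B := Γ(D, j ⁻¹ᵁ U)
      B' := Γ(D', i ⁻¹ᵁ ν ⁻¹ᵁ U)
      φ := ν.app U
      ψ := j.app U
      π := i.app (ν ⁻¹ᵁ U)
      ρ := q.appLE (j ⁻¹ᵁ U) _ e.le
      isFiberSquare := .of_ker_bijOn (fun a ↦ congr(($hcomm).hom a)) (j.app_surjective U hU) (h U)
      surjective := i.app_surjective _ hν
      isIntegral := by
        have h₁ := q.isIntegral_app _ hj
        have h₂ := RingHom.isIntegral_of_surjective (D'.presheaf.map (homOfLE e.le).op).hom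
          (ConcreteCategory.bijective_of_isIso (D'.presheaf.map (homOfLE e.le).op)).2
        exact RingHom.IsIntegral.trans _ _ h₁ h₂
      a := hU.fromSpec
      a' := hν.fromSpec
      b := hj.fromSpec
      b' := hi.fromSpec
      a'_comp := by rw [ν.app_eq_appLE, hU.SpecMap_appLE_fromSpec ν hν]
      b_comp := by rw [j.app_eq_appLE, hU.SpecMap_appLE_fromSpec j hj]
      b'_comp_i := by rw [i.app_eq_appLE, hν.SpecMap_appLE_fromSpec i hi]
      b'_comp_q := by rw [hj.SpecMap_appLE_fromSpec q hi]
      preimage_ν := by rw [hU.opensRange_fromSpec, hν.opensRange_fromSpec]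
      preimage_j := by rw [hU.opensRange_fromSpec, hj.opensRange_fromSpec]
      preimage_i := by rw [hν.opensRange_fromSpec, hi.opensRange_fromSpec] },
      by rwa [hU.range_fromSpec]⟩

end AlgebraicGeometry

theorem mainTheorem10 (S : Scheme.{u}) :
    -- pushout, then blowup
    (∀ (X' D' D : Scheme.{u}) (pX' : X' ⟶ S) (pD' : D' ⟶ S) (pD : D ⟶ S)
        (i : D' ⟶ X') (q : D' ⟶ D),
      i ≫ pX' = pD' → q ≫ pD = pD' →
      IsProperFlatFP pX' → IsProperFlatFP pD' → IsProperFlatFP pD →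
      IsFinite q → Flat q →
      IsClosedImmersion i → IsEffectiveCartier i.ker →
      (∀ y : D, ∃ U : X'.affineOpens, ∀ z : D', q z = y → i z ∈ U.1) →
      HasPushout i q ∧
      ∀ (X : Scheme.{u}) (ν : X' ⟶ X) (j : D ⟶ X), IsPushout i q ν j →
        ∀ p : X ⟶ S, ν ≫ p = pX' → j ≫ p = pD →
          IsClosedImmersion j ∧
          IsProperFlatFP p ∧
          (∀ m : ℕ, Flat ((j.ker ^ m).subschemeι ≫ p)) ∧
          (∃ (B : Scheme.{u}) (b : B ⟶ X), IsBlowup b j.ker) ∧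
          ∀ (B : Scheme.{u}) (b : B ⟶ X), IsBlowup b j.ker →
            ∃! e : (X' ≅ B) × (D' ≅ pullback b j),
              e.1.hom ≫ b = ν ∧
              e.2.hom ≫ pullback.fst b j = i ≫ e.1.hom ∧
              e.2.hom ≫ pullback.snd b j = q) ∧
    -- blowup, then pushout
    (∀ (X D : Scheme.{u}) (p : X ⟶ S) (j : D ⟶ X),
      IsClosedImmersion j → IsProperFlatFP p → IsProperFlatFP (j ≫ p) →
      (∀ n : ℕ, 1 ≤ n → IsFlatIdealOver p (j.ker ^ n)) →
      ∀ (B : Scheme.{u}) (b : B ⟶ X), IsBlowup b j.ker →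
        IsFinite (pullback.snd b j) → Flat (pullback.snd b j) →
        IdealsAgree b j (pullback.fst b j) →
        IsFinite b ∧
        IsIso (b ∣_ j.ker.support.compl) ∧
        HasPushout (pullback.fst b j) (pullback.snd b j) ∧
        ∀ (P : Scheme.{u}) (inl : B ⟶ P) (inr : D ⟶ P),
          IsPushout (pullback.fst b j) (pullback.snd b j) inl inr →
            ∃! e : P ≅ X, inl ≫ e.hom = b ∧ inr ≫ e.hom = j) := by
  refine ⟨?_, ?_⟩
  · rintro X' D' D pX' pD' pD i q rfl hq hX' hD' hD hqf - hi hiC H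
    obtain ⟨X₀, ν₀, j₀, h₀⟩ := exists_isPinching H
    refine ⟨h₀.isPushout.hasPushout, ?_⟩
    rintro X ν j hpush p rfl rfl
    -- An arbitrary pushout is isomorphic to the glued one, and so inherits its charts.
    have h := isPinching_of_isPushout H hpush
    refine ⟨h.isClosedImmersion, h.isProperFlatFP hiC hX' hD hD',
      h.flat_pow hiC hD.flat hD'.flat, ⟨X', ν, h.isBlowup hiC⟩, fun B b hb ↦ ?_⟩
    exact (h.isBlowup hiC).existsUnique_iso_pair h.isPullback hb
  · rintro X D p j hj hX hD - B b hb hq - hI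
    have := hX.finitePresentation
    have hfin : IsFinite b := hb.isFinite (exists_fg_on_ker j p hD.finitePresentation)
    -- Finiteness makes `b` affine, so the agreement of ideals gives fiber squares of rings over the
    -- affine opens of `X`.
    have h := IsPinching.of_idealsAgree pullback.condition hI
    refine ⟨hfin, hb.isIso_morphismRestrict, h.isPushout.hasPushout, fun P inl inr hP ↦ ?_⟩
    refine ⟨hP.isoIsPushout _ _ h.isPushout, ⟨hP.inl_isoIsPushout_hom _ _ h.isPushout,
      hP.inr_isoIsPushout_hom _ _ h.isPushout⟩, fun e he ↦ Iso.ext (hP.hom_ext ?_ ?_)⟩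
    · rw [he.1, hP.inl_isoIsPushout_hom]
    · rw [he.2, hP.inr_isoIsPushout_hom]
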